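/- Let $T>0$, $\alpha\in(0,1)$, $\beta\in[\alpha,1)$, and let $k\ge 4$, $\lambda>0$, $d\ge 5$ be real numbers. For $0<t<T$ and $0\le x\le 1$ put $$\Theta(t)=\frac{1}{t^k(T-t)^k},\qquad \varphi(t,x)=\lambda\,\Theta(t)\,\bigl(x^{2-\beta}-d\bigr).$$ Let $H^1_\alpha(0,1)$ be the space of absolutely continuous functions $u$ on $[0,1]$ with $u(0)=u(1)=0$ and $x^{\alpha/2}u_x\in L^2(0,1)$. Then there exist constants $C>0$ and $s_0>0$, depending only on $T,\alpha,\beta,k,\lambda,d$, such that for every $y_0\in H^1_\alpha(0,1)$, every $f\in L^2((0,T)\times(0,1))$ and every weak (equivalently, mild) solution $y\in C([0,T];L^2(0,1))\cap L^2(0,T;H^1_\alpha(0,1))$ of $$y_t-(x^\alpha y_x)_x=f \ \text{ in } (0,T)\times(0,1),\qquad y(t,0)=y(t,1)=0,\qquad y(0,x)=y_0(x),$$ the one-sided derivative $y_x(t,1)$ exists for almost every $t\in(0,T)$ and, for all $s\ge s_0$, the three integrals below are finite and $$\int_0^T\!\!\int_0^1\Bigl(s\Theta(t)\,x^{2\alpha-\beta}y_x^2+s^3\Theta^3(t)\,x^{2+2\alpha-3\beta}y^2\Bigr)e^{2s\varphi(t,x)}\,dx\,dt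 \le C\left(\int_0^T\!\!\int_0^1 f^2(t,x)\,e^{2s\varphi(t,x)}\,dx\,dt+\int_0^T s\Theta(t)\,y_x^2(t,1)\,e^{2s\varphi(t,1)}\,dt\right).$$ Here a weak solution is one that satisfies, for all $t\in[0,T]$ and all $v\in H^1_\alpha(0,1)$, $$\int_0^1 y(t,x)v(x)\,dx+\int_0^t\!\!\int_0^1 x^\alpha y_x v_x\,dx\,d\tau=\int_0^1 y_0(x)v(x)\,dx+\int_0^t\!\!\int_0^1 f v\,dx\,d\tau .$$ -/

import Mathlib

open MeasureTheory Set Filter Topology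

noncomputable section

namespace DegenerateParabolic

/-- The space-time domain `(0,T) × (0,1)`, with points written `(t, x)`. -/
def domain (T : ℝ) : Set (ℝ × ℝ) := Ioo 0 T ×ˢ Ioo 0 1

/-- Square integrability of `g(t,x)` on `(0,T) × (0,1)`. -/
def MemL2 (T : ℝ) (g : ℝ → ℝ → ℝ) : Prop :=
  MemLp (fun p : ℝ × ℝ => g p.1 p.2) 2 (volume.restrict (domain T))

/-- The weighted space `H¹_α(0,1)`: functions `u ∈ L²(0,1)`, absolutely continuous on `[0,1]`, with
`x^{α/2} u_x ∈ L²(0,1)` and `u(0) = u(1) = 0`. Values outside `[0,1]` play no role. -/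
structure MemH1 (α : ℝ) (u : ℝ → ℝ) : Prop where
  memLp : MemLp u 2 (volume.restrict (Ioo 0 1))
  absCont : AbsolutelyContinuousOnInterval u 0 1
  memLp_deriv : MemLp (fun x => x ^ (α / 2) * deriv u x) 2 (volume.restrict (Ioo 0 1))
  left_zero : u 0 = 0
  right_zero : u 1 = 0

/-- `y` is a (weak, equivalently mild) solution, in the class
`C([0,T]; L²(0,1)) ∩ L²(0,T; H¹_α(0,1))`, of
`y_t - (x^α y_x)_x = f` on `(0,T) × (0,1)`, `y(t,0) = y(t,1) = 0`, `y(0,x) = y₀(x)`.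
For almost every `t` the function `y t` is the absolutely continuous representative, so the
boundary conditions are contained in `memH1`. -/
structure IsSolution (T α : ℝ) (y₀ : ℝ → ℝ) (f y : ℝ → ℝ → ℝ) : Prop where
  memL2 : MemL2 T y
  memLp : ∀ t ∈ Icc 0 T, MemLp (y t) 2 (volume.restrict (Ioo 0 1))
  continuous : ∀ t₀ ∈ Icc 0 T,
    Tendsto (fun t => eLpNorm (y t - y t₀) 2 (volume.restrict (Ioo 0 1)))
      (𝓝[Icc 0 T] t₀) (𝓝 0)
  memH1 : ∀ᵐ t ∂(volume.restrict (Ioo 0 T)), MemH1 α (y t)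
  memL2_deriv : MemL2 T (fun t x => x ^ (α / 2) * deriv (y t) x)
  initial : ∀ᵐ x ∂(volume.restrict (Ioo 0 1)), y 0 x = y₀ x
  /-- The equation, integrated over `(0,t)` and tested against `v ∈ H¹_α(0,1)`. -/
  equation : ∀ t ∈ Icc 0 T, ∀ v : ℝ → ℝ, MemH1 α v →
    (∫ x in Ioo 0 1, y t x * v x)
        + ∫ p in domain t, p.2 ^ α * deriv (y p.1) p.2 * deriv v p.2
      = (∫ x in Ioo 0 1, y₀ x * v x) + ∫ p in domain t, f p.1 p.2 * v p.2

/-- `Θ(t) = 1 / (t^k (T-t)^k)`. -/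
def Theta (T k t : ℝ) : ℝ := 1 / (t ^ k * (T - t) ^ k)

/-- `φ(t,x) = Θ(t) ψ(x)` with `ψ(x) = λ (x^{2-β} - d)`. -/
def phi (T k β lam d t x : ℝ) : ℝ := Theta T k t * (lam * (x ^ (2 - β) - d))

/-- `y_x(t,1)`, the (one-sided) derivative in `x` at the right end point of `[0,1]`. -/
def derivAtOne (y : ℝ → ℝ → ℝ) (t : ℝ) : ℝ := derivWithin (y t) (Icc 0 1) 1

/-- `(s Θ x^{2α-β} y_x² + s³ Θ³ x^{2+2α-3β} y²) e^{2sφ}` at `(t, x)`. -/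
def interiorTerm (T α β k lam d s : ℝ) (y : ℝ → ℝ → ℝ) (t x : ℝ) : ℝ :=
  (s * Theta T k t * x ^ (2 * α - β) * deriv (y t) x ^ 2
      + s ^ 3 * Theta T k t ^ 3 * x ^ (2 + 2 * α - 3 * β) * y t x ^ 2)
    * Real.exp (2 * s * phi T k β lam d t x)

/-- `f² e^{2sφ}` at `(t, x)`. -/
def sourceTerm (T β k lam d s : ℝ) (f : ℝ → ℝ → ℝ) (t x : ℝ) : ℝ :=
  f t x ^ 2 * Real.exp (2 * s * phi T k β lam d t x)

/-- `s Θ(t) y_x(t,1)² e^{2sφ(t,1)}`. -/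
def boundaryTerm (T β k lam d s : ℝ) (y : ℝ → ℝ → ℝ) (t : ℝ) : ℝ :=
  s * Theta T k t * derivAtOne y t ^ 2 * Real.exp (2 * s * phi T k β lam d t 1)

end DegenerateParabolic

end

open MeasureTheory Set Filter Topology

noncomputable section

namespace DegenerateParabolic

/-! Write Z = e^{sφ}u. The equation becomes P₊Z + P₋Z = e^{sφ}f with P₊Z = -(x^α Z_x)_x - (s²x^α
φ_x² + sφ_t)Z and P₋Z = Z_t + 2s x^α φ_x Z_x + s(x^α φ_x)_x Z. The inequality yz ≤ (y+z)²/4 bounds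
the product P₊Z·P₋Z pointwise by f²e^{2sφ}/4. The product itself is the x-derivative of a flux, plus
the t-derivative of an energy, plus a quadratic form in Z_x and Z (`carleman_identity`). With c =
λ(2-β), the exact derivative of m s c Θ x^{2α-β-1} Z² is added to the flux part and subtracted from
the form. For a suitable m the form is then positive definite in (Z_x, Z/x); this plays the role of
Hardy's inequality. The terms containing time derivatives of Θ are absorbed for large s
(`exists_carlemanForm_coercive`). Upon integration over a rectangle the energy disappears if u
vanishes at both end times, the flux at x = 0 disappears because u and u_t are O(x^{1-α}), and the
flux at x = 1 is a negative multiple of sΘ y_x² e^{2sφ}. This gives the estimate for regular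
solutions (`exists_carleman_regular`).

The computation needs u_xt and an absolutely continuous flux x^α u_x, so a weak solution is
mollified in time. Smoothing in t alone suffices (`WeakSolution.regular`): the lemma of du
Bois-Reymond recovers the flux as its value at x = 1 minus ∫_x^1 (u_t - f), bounded uniformly in t.
In the limit the interior term is handled by Fatou's lemma and the source by L² convergence. The
boundary term needs convergence of the fluxes at x = 1: the energy estimate ‖u_t‖ ≤ ‖f‖, applied to
differences of mollifications, makes u_t converge in L², hence also the traces
(`WeakSolution.exists_trace`).

A general solution does not vanish at the end times, so it is multiplied by cut-offs χ_n(t). This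
changes the source to χ_n f + χ_n' y. Since χ_n' = O(1/(t(T-t))) and e^{2sφ} decays exponentially in
Θ at both ends, the commutator χ_n' y tends to 0 in the weighted norm by dominated convergence; the
initial value therefore does not appear in the estimate. Applied with the single cut-off t(T-t), the
trace theorem also yields y_x(t,1) for almost every t and the finiteness of the boundary integral
(`SolutionRep.exists_normalDeriv`). -/

/-! ### Coercivity of the Carleman quadratic form -/

/-- A positive definite binary quadratic form is coercive. -/
theorem exists_coercive_of_sq_lt {A B C : ℝ} (hA : 0 < A) (hC : 0 < C) (h : B ^ 2 < 4 * A * C) :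
    ∃ κ > 0, ∀ X Y : ℝ, κ * (X ^ 2 + Y ^ 2) ≤ A * X ^ 2 - B * (X * Y) + C * Y ^ 2 := by
  -- Determinant over trace of the matrix of the form, a lower bound for its smaller eigenvalue.
  set κ := (4 * A * C - B ^ 2) / (4 * (A + C)) with hκ
  have hAC : 0 < A + C := by linarith
  have hκ0 : 0 < κ := by
    rw [hκ]; apply div_pos <;> linarith
  have e : κ * (4 * (A + C)) = 4 * A * C - B ^ 2 := by
    rw [hκ]; field_simp
  have hκA : κ < A := by
    rw [hκ, div_lt_iff₀ (by linarith)]; nlinarith [sq_nonneg B]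
  refine ⟨κ, hκ0, fun X Y => ?_⟩
  -- Completing the square leaves ((A-κ)(C-κ) - B²/4)Y², and this coefficient is exactly κ² by the
  -- choice of κ.
  have h1 : 0 ≤ (A - κ) * ((A - κ) * X ^ 2 - B * (X * Y) + (C - κ) * Y ^ 2) := by
    nlinarith [sq_nonneg ((A - κ) * X - B / 2 * Y), sq_nonneg (κ * Y)]
  have h2 := nonneg_of_mul_nonneg_right h1 (by linarith)
  nlinarith

/-- The quadratic form left over in the Carleman computation. The letters `a`, `e` stand for
`x ^ α`, `x ^ (-β)`, and `Θ₁`, `Θ₂` for the derivatives of `Θ`. -/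
def carlemanForm (α β lam m s Θ Θ₁ Θ₂ ψ a e x Z Zx : ℝ) : ℝ :=
  s * (lam * (2 - β)) * Θ * (a ^ 2 * e) *
      (((1 - β) + (1 + α - β)) * Zx ^ 2
        - ((β - α) * (1 + α - β) + 2 * m) * (Z / x * Zx) + m * (1 + β - 2 * α) * (Z / x) ^ 2)
    + s ^ 3 * (lam * (2 - β)) ^ 3 * (2 + α - 2 * β) * Θ ^ 3 * (x ^ 2 * a ^ 2 * e ^ 3) * Z ^ 2
    + 2 * s ^ 2 * (lam * (2 - β)) ^ 2 * Θ * Θ₁ * (a * e ^ 2 * x ^ 2) * Z ^ 2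
    + s * Θ₂ * ψ / 2 * Z ^ 2

/-- The parameter m is free because its terms come from an exact derivative. It is chosen to make
the form in (Z_x, Z/x) positive definite. The resulting square of Z/x is then spent entirely on the
term with Θ₂, which has no spatial weight of its own; the term with Θ₁ is absorbed by the cubic term
in s. Both absorptions use a e = x^{α-β} ≥ 1, that is, β ≥ α. -/
theorem exists_carlemanForm_coercive {α β lam d : ℝ} (hα : α ∈ Ioo (0 : ℝ) 1)
    (hβ : β ∈ Ico α 1) (hlam : 0 < lam) (hd : 0 ≤ d) {C₀ : ℝ} (hC₀ : 0 ≤ C₀) :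
    ∃ m κ s₀ : ℝ, 0 < κ ∧ 1 ≤ s₀ ∧ ∀ s Θ Θ₁ Θ₂ ψ a e x Z Zx : ℝ, s₀ ≤ s → 0 < Θ →
      |Θ₁| ≤ C₀ * Θ ^ 2 → |Θ₂| ≤ C₀ * Θ ^ 2 → |ψ| ≤ lam * d → 0 < a → 0 < e → 1 ≤ a * e → 0 < x →
      κ * (s * Θ * (a ^ 2 * e) * Zx ^ 2 + s ^ 3 * Θ ^ 3 * (x ^ 2 * a ^ 2 * e ^ 3) * Z ^ 2) ≤
        carlemanForm α β lam m s Θ Θ₁ Θ₂ ψ a e x Z Zx := by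
  obtain ⟨hα0, hα1⟩ := hα
  obtain ⟨hβα, hβ1⟩ := hβ
  set c := lam * (2 - β) with hc
  have hc0 : 0 < c := mul_pos hlam (by linarith)
  set ω := 2 + α - 2 * β with hω
  have hω0 : 0 < ω := by rw [hω]; linarith
  set k := (β - α) * (1 + α - β) with hk
  set A := (1 - β) + (1 + α - β) with hA
  set D := 1 + β - 2 * α with hD
  have hA0 : 0 < A := by rw [hA]; linarith
  have hD0 : 0 < D := by rw [hD]; linarith
  have hk0 : 0 ≤ k := mul_nonneg (by linarith) (by linarith)
  have hG : 2 * k < A * D := by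
    have : A * D - 2 * k = (1 - β) ^ 2 + 2 * (1 - β) * (β - α) + (1 + α - β) * (1 - β) := by
      rw [hA, hD, hk]; ring
    have h1 : 0 < (1 - β) ^ 2 := by have : 0 < 1 - β := by linarith
                                    positivity
    have h2 : 0 ≤ (1 - β) * (β - α) := mul_nonneg (by linarith) (by linarith)
    have h3 : 0 ≤ (1 + α - β) * (1 - β) := mul_nonneg (by linarith) (by linarith)
    linarith
  -- This m minimises (k + 2m)² - 4AmD; the minimum is k² - (AD - k)², negative precisely because 2k
  -- < AD.
  set m := (A * D - k) / 2 with hm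
  have hm0 : 0 < m := by rw [hm]; linarith
  obtain ⟨κ₁, hκ₁, hform⟩ := exists_coercive_of_sq_lt (A := A) (B := k + 2 * m) (C := m * D) hA0
    (mul_pos hm0 hD0) (by rw [hm]; nlinarith)
  set κ₂ := c ^ 3 * ω with hκ₂
  have hκ₂0 : 0 < κ₂ := by positivity
  set κ₃ := c * κ₁ with hκ₃
  have hκ₃0 : 0 < κ₃ := by positivity
  set κ := min κ₃ (κ₂ / 4) with hκ
  have hκ0 : 0 < κ := lt_min hκ₃0 (by positivity)
  set N := lam * d * C₀ / 4 with hN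
  have hN0 : 0 ≤ N := by positivity
  -- One summand for each of the absorptions `hsN1`, `hsN2`, `hsN3`, and 1 for s₀ ≥ 1. The cubic
  -- term κ₂ loses one half to Θ₁ and one quarter to Θ₂, so a quarter remains in κ.
  refine ⟨m, κ, 1 + N / κ₃ + N / (κ₂ / 4) + 2 * c ^ 2 * C₀ / (κ₂ / 2), hκ0, ?_, ?_⟩
  · have h1 : 0 ≤ N / κ₃ := by positivity
    have h2 : 0 ≤ N / (κ₂ / 4) := by positivity
    have h3 : 0 ≤ 2 * c ^ 2 * C₀ / (κ₂ / 2) := by positivity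
    linarith
  intro s Θ Θ₁ Θ₂ ψ a e x Z Zx hs hΘ hΘ₁ hΘ₂ hψ ha he hae hx
  have h1 : 0 ≤ N / κ₃ := by positivity
  have h2 : 0 ≤ N / (κ₂ / 4) := by positivity
  have h3 : 0 ≤ 2 * c ^ 2 * C₀ / (κ₂ / 2) := by positivity
  have hs1 : 1 ≤ s := by linarith
  have hs0 : 0 < s := by linarith
  have hsN1 : N ≤ κ₃ * s := by
    have : N / κ₃ ≤ s := by linarith
    rwa [div_le_iff₀' hκ₃0] at this
  have hsN2 : N ≤ κ₂ / 4 * s := by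
    have : N / (κ₂ / 4) ≤ s := by linarith
    rwa [div_le_iff₀' (by positivity)] at this
  have hsN3 : 2 * c ^ 2 * C₀ ≤ κ₂ / 2 * s := by
    have : 2 * c ^ 2 * C₀ / (κ₂ / 2) ≤ s := by linarith
    rwa [div_le_iff₀' (by positivity)] at this
  -- the two error terms
  set S := s * Θ * (a ^ 2 * e) with hS
  have hS0 : 0 < S := by positivity
  set R := s ^ 3 * Θ ^ 3 * (x ^ 2 * a ^ 2 * e ^ 3) with hR
  have hR0 : 0 < R := by positivity
  have hZ2 : 0 ≤ Z ^ 2 := sq_nonneg Z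
  have err1 : -(κ₂ / 2 * R * Z ^ 2) ≤ 2 * s ^ 2 * c ^ 2 * Θ * Θ₁ * (a * e ^ 2 * x ^ 2) * Z ^ 2 := by
    have t1 : |2 * s ^ 2 * c ^ 2 * Θ * Θ₁ * (a * e ^ 2 * x ^ 2)| ≤ κ₂ / 2 * R := by
      rw [abs_mul, abs_mul, abs_of_pos (show 0 < 2 * s ^ 2 * c ^ 2 * Θ by positivity),
        abs_of_pos (show 0 < a * e ^ 2 * x ^ 2 by positivity)]
      calc 2 * s ^ 2 * c ^ 2 * Θ * |Θ₁| * (a * e ^ 2 * x ^ 2)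
          ≤ 2 * s ^ 2 * c ^ 2 * Θ * (C₀ * Θ ^ 2) * (a * e ^ 2 * x ^ 2) := by gcongr
        _ ≤ 2 * s ^ 2 * c ^ 2 * Θ * (C₀ * Θ ^ 2) * (a * e ^ 2 * x ^ 2) * (a * e) :=
            le_mul_of_one_le_right (by positivity) hae
        _ = (2 * c ^ 2 * C₀) * (s ^ 2 * Θ ^ 3 * (x ^ 2 * a ^ 2 * e ^ 3)) := by ring
        _ ≤ (κ₂ / 2 * s) * (s ^ 2 * Θ ^ 3 * (x ^ 2 * a ^ 2 * e ^ 3)) := by gcongr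
        _ = κ₂ / 2 * R := by rw [hR]; ring
    have := mul_le_mul_of_nonneg_right (abs_le.1 t1).1 hZ2
    linarith
  have err2 : -(κ₃ * S * (Z / x) ^ 2 + κ₂ / 4 * R * Z ^ 2) ≤ s * Θ₂ * ψ / 2 * Z ^ 2 := by
    have t1 : |s * Θ₂ * ψ / 2| ≤ 2 * N * (s * Θ ^ 2) := by
      rw [abs_div, abs_mul, abs_mul, abs_of_pos hs0, abs_two]
      calc s * |Θ₂| * |ψ| / 2 ≤ s * (C₀ * Θ ^ 2) * (lam * d) / 2 := by gcongr
        _ = 2 * N * (s * Θ ^ 2) := by rw [hN]; ring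
    -- Arithmetic-geometric mean: the product of the weights of (Z/x)² and Z² has root s²Θ²(ae)² Z²,
    -- one power of s more than needed.
    have t2 : 2 * (s * Θ ^ 2) * Z ^ 2 ≤ (S * (Z / x) ^ 2 + R * Z ^ 2) / s := by
      have q0 : 1 ≤ (a * e) ^ 2 := one_le_pow₀ hae
      have q1 : 2 * (s * Θ ^ 2) * Z ^ 2 ≤ 2 * (s * Θ ^ 2) * Z ^ 2 * (a * e) ^ 2 :=
        le_mul_of_one_le_right (by positivity) q0
      have q2 : (S * (Z / x) ^ 2 + R * Z ^ 2) / s - 2 * (s * Θ ^ 2) * Z ^ 2 * (a * e) ^ 2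
          = Θ * a ^ 2 * e * (Z / x - s * Θ * x * e * Z) ^ 2 := by
        rw [hS, hR]; field_simp; ring
      have q3 : 0 ≤ Θ * a ^ 2 * e * (Z / x - s * Θ * x * e * Z) ^ 2 := by positivity
      linarith
    have t3 : N / s ≤ κ₃ := by rwa [div_le_iff₀ hs0]
    have t4 : N / s ≤ κ₂ / 4 := by rwa [div_le_iff₀ hs0]
    have t5 : 2 * N * (s * Θ ^ 2) * Z ^ 2 ≤ κ₃ * S * (Z / x) ^ 2 + κ₂ / 4 * R * Z ^ 2 := by
      calc 2 * N * (s * Θ ^ 2) * Z ^ 2 = N * (2 * (s * Θ ^ 2) * Z ^ 2) := by ring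
        _ ≤ N * ((S * (Z / x) ^ 2 + R * Z ^ 2) / s) := by gcongr
        _ = N / s * (S * (Z / x) ^ 2) + N / s * (R * Z ^ 2) := by ring
        _ ≤ κ₃ * (S * (Z / x) ^ 2) + κ₂ / 4 * (R * Z ^ 2) := by gcongr
        _ = _ := by ring
    have := mul_le_mul_of_nonneg_right (abs_le.1 t1).1 hZ2
    linarith
  have main := hform Zx (Z / x)
  have main' : κ₃ * S * Zx ^ 2 + κ₃ * S * (Z / x) ^ 2 ≤
      s * c * Θ * (a ^ 2 * e) * (A * Zx ^ 2 - (k + 2 * m) * (Z / x * Zx) + m * D * (Z / x) ^ 2) := by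
    have : κ₃ * S * Zx ^ 2 + κ₃ * S * (Z / x) ^ 2 =
      s * c * Θ * (a ^ 2 * e) * (κ₁ * (Zx ^ 2 + (Z / x) ^ 2)) := by rw [hκ₃, hS]; ring
    rw [this]
    gcongr
    linarith
  have hκle1 : κ * (S * Zx ^ 2) ≤ κ₃ * (S * Zx ^ 2) := by gcongr; exact min_le_left _ _
  have hκle2 : κ * (R * Z ^ 2) ≤ κ₂ / 4 * (R * Z ^ 2) := by gcongr; exact min_le_right _ _
  have hR' : s ^ 3 * c ^ 3 * ω * Θ ^ 3 * (x ^ 2 * a ^ 2 * e ^ 3) * Z ^ 2 = κ₂ * (R * Z ^ 2) := by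
    rw [hκ₂, hR]; ring
  unfold carlemanForm
  rw [← hc, ← hω, ← hk, ← hA, ← hD]
  rw [hR', mul_add]
  linarith

/-! ### The pointwise Carleman identity -/

/-- The square root `exp (s φ)` of the Carleman weight, where `Θ` is the value of the time factor. -/
def weight (β lam d s Θ x : ℝ) : ℝ := Real.exp (s * (Θ * (lam * (x ^ (2 - β) - d))))

/-- The spatial flux in the Carleman computation for a solution with values `u`, flux `w = x ^ α u_x`
and time derivative `q` at `x`. -/
def carlemanFlux (α β lam d m s Θ Θ₁ x u w q : ℝ) : ℝ :=
  -(weight β lam d s Θ x * (w + s * (lam * (2 - β) * Θ * (x ^ α * x ^ (-β) * x)) * u)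
      * (weight β lam d s Θ x * (q + s * (Θ₁ * (lam * (x ^ (2 - β) - d))) * u)))
  - s * (lam * (2 - β) * Θ * (x ^ (-β) * x))
      * (weight β lam d s Θ x * (w + s * (lam * (2 - β) * Θ * (x ^ α * x ^ (-β) * x)) * u)) ^ 2
  - s * (lam * (2 - β) * (1 + α - β) * Θ * (x ^ α * x ^ (-β)))
      * (weight β lam d s Θ x * (w + s * (lam * (2 - β) * Θ * (x ^ α * x ^ (-β) * x)) * u)
        * (weight β lam d s Θ x * u))
  - s * ((s ^ 2 * (lam * (2 - β)) ^ 2 * Θ ^ 2 * (x ^ α * (x ^ (-β)) ^ 2 * x ^ 2)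
          + s * Θ₁ * (lam * (x ^ (2 - β) - d)))
        * (lam * (2 - β) * Θ * (x ^ α * x ^ (-β) * x))) * (weight β lam d s Θ x * u) ^ 2
  + s * m * (lam * (2 - β)) * Θ * ((x ^ α) ^ 2 * x ^ (-β) / x) * (weight β lam d s Θ x * u) ^ 2

/-- The energy density whose time derivative appears in the Carleman computation. -/
def carlemanEnergy (α β lam d s Θ Θ₁ x u p : ℝ) : ℝ :=
  (x ^ α * (weight β lam d s Θ x * (p + s * (lam * (2 - β) * Θ * (x ^ (-β) * x)) * u)) ^ 2
    - (s ^ 2 * (lam * (2 - β)) ^ 2 * Θ ^ 2 * (x ^ α * (x ^ (-β)) ^ 2 * x ^ 2)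
          + s * Θ₁ * (lam * (x ^ (2 - β) - d))) * (weight β lam d s Θ x * u) ^ 2) / 2

/-- The time derivative of `carlemanEnergy`. -/
def carlemanEnergyDeriv (α β lam d s Θ Θ₁ Θ₂ x u p q r : ℝ) : ℝ :=
  x ^ α * (weight β lam d s Θ x * (p + s * (lam * (2 - β) * Θ * (x ^ (-β) * x)) * u))
      * (weight β lam d s Θ x * (r + s * (lam * (2 - β) * Θ₁ * (x ^ (-β) * x)) * u
            + s * (lam * (2 - β) * Θ * (x ^ (-β) * x)) * q
          + s * (Θ₁ * (lam * (x ^ (2 - β) - d)))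
            * (p + s * (lam * (2 - β) * Θ * (x ^ (-β) * x)) * u)))
    - (s ^ 2 * (lam * (2 - β)) ^ 2 * Θ ^ 2 * (x ^ α * (x ^ (-β)) ^ 2 * x ^ 2)
          + s * Θ₁ * (lam * (x ^ (2 - β) - d))) * (weight β lam d s Θ x * u)
        * (weight β lam d s Θ x * (q + s * (Θ₁ * (lam * (x ^ (2 - β) - d))) * u))
    - (2 * s ^ 2 * (lam * (2 - β)) ^ 2 * (Θ * Θ₁) * (x ^ α * (x ^ (-β)) ^ 2 * x ^ 2)
          + s * Θ₂ * (lam * (x ^ (2 - β) - d))) / 2 * (weight β lam d s Θ x * u) ^ 2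

theorem hasDerivAt_carlemanEnergy (α β lam d s x : ℝ) {Θ Θ₁ u p : ℝ → ℝ} {Θ₂ q r t : ℝ}
    (hΘ : HasDerivAt Θ (Θ₁ t) t) (hΘ₁ : HasDerivAt Θ₁ Θ₂ t) (hu : HasDerivAt u q t)
    (hp : HasDerivAt p r t) :
    HasDerivAt (fun t => carlemanEnergy α β lam d s (Θ t) (Θ₁ t) x (u t) (p t))
      (carlemanEnergyDeriv α β lam d s (Θ t) (Θ₁ t) Θ₂ x (u t) (p t) q r) t := by
  set a := x ^ α
  set e := x ^ (-β)
  set ψ := lam * (x ^ (2 - β) - d) with hψ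
  have hE : HasDerivAt (fun t => weight β lam d s (Θ t) x)
      (weight β lam d s (Θ t) x * (s * (Θ₁ t * ψ))) t :=
    ((hΘ.mul_const ψ).const_mul s).exp
  have hZ : HasDerivAt (fun t => weight β lam d s (Θ t) x * u t)
      (weight β lam d s (Θ t) x * (q + s * (Θ₁ t * ψ) * u t)) t :=
    (hE.fun_mul hu).congr_deriv (by ring)
  have hP := (hp.fun_add (((((hΘ.const_mul (lam * (2 - β))).mul_const (e * x)).const_mul s)).fun_mul hu))
  have hZx := hE.fun_mul hP
  have hV := ((((hΘ.fun_pow 2).const_mul (s ^ 2 * (lam * (2 - β)) ^ 2)).mul_const (a * e ^ 2 * x ^ 2)).fun_add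
    ((hΘ₁.const_mul s).mul_const ψ))
  refine ((((hZx.fun_pow 2).const_mul a).fun_sub (hV.fun_mul (hZ.fun_pow 2))).div_const 2).congr_deriv ?_
  simp only [carlemanEnergyDeriv]
  ring

/-- The left side is P₊Z·P₋Z, where Wx stands for (x^α Z_x)_x, H for Z_t and Hx for Z_tx. On the
right, the first bracket is the x-derivative of the flux, the second the t-derivative of the energy,
the third the Carleman form. The terms with m cancel between the first and the third. Treating all
derivatives as independent letters makes this an identity of rational functions. -/
theorem carleman_identity (c s m α β Θ Θ₁ Θ₂ ψ a e x Z Zx Wx H Hx : ℝ) (hx : x ≠ 0) :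
    (-Wx - (s ^ 2 * c ^ 2 * Θ ^ 2 * (a * e ^ 2 * x ^ 2) + s * Θ₁ * ψ) * Z)
        * (H + 2 * s * (c * Θ * (a * e * x)) * Zx + s * (c * (1 + α - β) * Θ * (a * e)) * Z)
      = (-(Wx * H + a * Zx * Hx)
          - s * (c * (1 - β) * Θ * e) * (a * Zx) ^ 2 - 2 * s * (c * Θ * (e * x)) * (a * Zx) * Wx
          - s * (c * (1 + α - β) * (α - β) * Θ * (a * e / x)) * (a * Zx * Z)
          - s * (c * (1 + α - β) * Θ * (a * e)) * (Wx * Z + a * Zx * Zx)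
          - s * ((s ^ 2 * c ^ 2 * (2 + α - 2 * β) * Θ ^ 2 * (a * e ^ 2 * x) + s * Θ₁ * (c * (e * x)))
              * (c * Θ * (a * e * x))
            + (s ^ 2 * c ^ 2 * Θ ^ 2 * (a * e ^ 2 * x ^ 2) + s * Θ₁ * ψ)
              * (c * (1 + α - β) * Θ * (a * e))) * Z ^ 2
          - s * ((s ^ 2 * c ^ 2 * Θ ^ 2 * (a * e ^ 2 * x ^ 2) + s * Θ₁ * ψ)
            * (c * Θ * (a * e * x))) * (2 * Z * Zx)
          + s * m * c * Θ * ((2 * α - β - 1) * (a ^ 2 * e / x ^ 2)) * Z ^ 2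
          + s * m * c * Θ * (a ^ 2 * e / x) * (2 * Z * Zx))
        + (a * Zx * Hx - (s ^ 2 * c ^ 2 * Θ ^ 2 * (a * e ^ 2 * x ^ 2) + s * Θ₁ * ψ) * Z * H
          - (2 * s ^ 2 * c ^ 2 * (Θ * Θ₁) * (a * e ^ 2 * x ^ 2) + s * Θ₂ * ψ) / 2 * Z ^ 2)
        + (s * c * Θ * (a ^ 2 * e) *
      (((1 - β) + (1 + α - β)) * Zx ^ 2
        - ((β - α) * (1 + α - β) + 2 * m) * (Z / x * Zx) + m * (1 + β - 2 * α) * (Z / x) ^ 2)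
    + s ^ 3 * c ^ 3 * (2 + α - 2 * β) * Θ ^ 3 * (x ^ 2 * a ^ 2 * e ^ 3) * Z ^ 2
    + 2 * s ^ 2 * c ^ 2 * Θ * Θ₁ * (a * e ^ 2 * x ^ 2) * Z ^ 2
    + s * Θ₂ * ψ / 2 * Z ^ 2) := by
  field_simp
  ring

theorem hasDerivAt_rpow_div {x : ℝ} (hx : 0 < x) (γ : ℝ) :
    HasDerivAt (fun y : ℝ => y ^ γ) (γ * x ^ γ / x) x := by
  refine (Real.hasDerivAt_rpow_const (p := γ) (Or.inl hx.ne')).congr_deriv ?_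
  rw [Real.rpow_sub_one hx.ne']; ring

theorem rpow_two_sub {x : ℝ} (hx : 0 < x) (β : ℝ) : x ^ (2 - β) = x ^ 2 * x ^ (-β) := by
  rw [sub_eq_add_neg, Real.rpow_add hx]; norm_num

theorem hasDerivAt_weight {x : ℝ} (hx : 0 < x) (β lam d s Θ : ℝ) :
    HasDerivAt (weight β lam d s Θ)
      (weight β lam d s Θ x * (s * (lam * (2 - β) * Θ * (x ^ (-β) * x)))) x := by
  refine ((((((hasDerivAt_rpow_div hx (2 - β)).sub_const d).const_mul lam).const_mul Θ).const_mul
    s).exp).congr_deriv ?_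
  rw [rpow_two_sub hx]
  simp only [weight, rpow_two_sub hx]
  field_simp

/-- The derivatives in `x` of the coefficients in `carlemanFlux`. -/
theorem hasDerivAt_carleman_coefficients (α β lam d s Θ Θ₁ : ℝ) {x : ℝ} (hx : 0 < x) {c : ℝ}
    (hc : c = lam * (2 - β)) :
    HasDerivAt (fun y : ℝ => lam * (y ^ (2 - β) - d)) (c * (x ^ (-β) * x)) x ∧
    HasDerivAt (fun y : ℝ => c * Θ * (y ^ α * y ^ (-β) * y))
      (c * (1 + α - β) * Θ * (x ^ α * x ^ (-β))) x ∧
    HasDerivAt (fun y : ℝ => c * Θ * (y ^ (-β) * y)) (c * (1 - β) * Θ * x ^ (-β)) x ∧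
    HasDerivAt (fun y : ℝ => c * (1 + α - β) * Θ * (y ^ α * y ^ (-β)))
      (c * (1 + α - β) * (α - β) * Θ * (x ^ α * x ^ (-β) / x)) x ∧
    HasDerivAt (fun y : ℝ => s ^ 2 * c ^ 2 * Θ ^ 2 * (y ^ α * (y ^ (-β)) ^ 2 * y ^ 2)
      + s * Θ₁ * (lam * (y ^ (2 - β) - d)))
      (s ^ 2 * c ^ 2 * (2 + α - 2 * β) * Θ ^ 2 * (x ^ α * (x ^ (-β)) ^ 2 * x)
        + s * Θ₁ * (c * (x ^ (-β) * x))) x ∧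
    HasDerivAt (fun y : ℝ => (y ^ α) ^ 2 * y ^ (-β) / y)
      ((2 * α - β - 1) * ((x ^ α) ^ 2 * x ^ (-β) / x ^ 2)) x := by
  have ha := hasDerivAt_rpow_div hx α
  have he := hasDerivAt_rpow_div hx (-β)
  have hx1 := hasDerivAt_id' x
  have hxne := hx.ne'
  have hψ : HasDerivAt (fun y : ℝ => lam * (y ^ (2 - β) - d)) (c * (x ^ (-β) * x)) x := by
    refine (((hasDerivAt_rpow_div hx (2 - β)).sub_const d).const_mul lam).congr_deriv ?_
    rw [rpow_two_sub hx, hc]; field_simp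
  have hA : HasDerivAt (fun y : ℝ => c * Θ * (y ^ α * y ^ (-β) * y))
      (c * (1 + α - β) * Θ * (x ^ α * x ^ (-β))) x := by
    refine ((((ha.fun_mul he).fun_mul hx1)).const_mul (c * Θ)).congr_deriv ?_
    field_simp; ring
  have hφ : HasDerivAt (fun y : ℝ => c * Θ * (y ^ (-β) * y)) (c * (1 - β) * Θ * x ^ (-β)) x := by
    refine ((he.fun_mul hx1).const_mul (c * Θ)).congr_deriv ?_
    field_simp; ring
  have hAx : HasDerivAt (fun y : ℝ => c * (1 + α - β) * Θ * (y ^ α * y ^ (-β)))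
      (c * (1 + α - β) * (α - β) * Θ * (x ^ α * x ^ (-β) / x)) x := by
    refine ((ha.fun_mul he).const_mul (c * (1 + α - β) * Θ)).congr_deriv ?_
    field_simp; ring
  have hV : HasDerivAt (fun y : ℝ => s ^ 2 * c ^ 2 * Θ ^ 2 * (y ^ α * (y ^ (-β)) ^ 2 * y ^ 2)
      + s * Θ₁ * (lam * (y ^ (2 - β) - d)))
      (s ^ 2 * c ^ 2 * (2 + α - 2 * β) * Θ ^ 2 * (x ^ α * (x ^ (-β)) ^ 2 * x)
        + s * Θ₁ * (c * (x ^ (-β) * x))) x := by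
    refine ((((ha.fun_mul (he.fun_pow 2)).fun_mul (hx1.fun_pow 2)).const_mul (s ^ 2 * c ^ 2 * Θ ^ 2)).fun_add
      (hψ.const_mul (s * Θ₁))).congr_deriv ?_
    field_simp; ring
  have hg : HasDerivAt (fun y : ℝ => (y ^ α) ^ 2 * y ^ (-β) / y)
      ((2 * α - β - 1) * ((x ^ α) ^ 2 * x ^ (-β) / x ^ 2)) x := by
    refine (((ha.fun_pow 2).fun_mul he).fun_div hx1 hxne).congr_deriv ?_
    field_simp; ring
  exact ⟨hψ, hA, hφ, hAx, hV, hg⟩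

-- The equation enters here only through q - w', the value of the source. Since the flux contains q
-- = u_t, its x-derivative requires r = u_xt, which is why solutions are first regularised in time.
set_option maxHeartbeats 800000 in
theorem hasDerivAt_carlemanFlux (α β lam d m s Θ Θ₁ Θ₂ : ℝ) {x : ℝ} (hx : 0 < x) {u w q : ℝ → ℝ}
    {p w' r : ℝ} (hu : HasDerivAt u p x) (hw : HasDerivAt w w' x) (hq : HasDerivAt q r x)
    (hwp : w x = x ^ α * p) :
    ∃ J' : ℝ, HasDerivAt (fun x => carlemanFlux α β lam d m s Θ Θ₁ x (u x) (w x) (q x)) J' x ∧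
      J' + carlemanEnergyDeriv α β lam d s Θ Θ₁ Θ₂ x (u x) p (q x) r ≤
        (q x - w') ^ 2 * weight β lam d s Θ x ^ 2 / 4
          - carlemanForm α β lam m s Θ Θ₁ Θ₂ (lam * (x ^ (2 - β) - d)) (x ^ α) (x ^ (-β)) x
              (weight β lam d s Θ x * u x)
              (weight β lam d s Θ x * (p + s * (lam * (2 - β) * Θ * (x ^ (-β) * x)) * u x)) := by
  have hE := hasDerivAt_weight hx β lam d s Θ
  have hxne := hx.ne'
  set c := lam * (2 - β) with hc
  obtain ⟨hψ, hA, hφ, hAx, hV, hg⟩ := hasDerivAt_carleman_coefficients α β lam d s Θ Θ₁ hx hc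
  have hZ : HasDerivAt (fun y => weight β lam d s Θ y * u y)
      (weight β lam d s Θ x * (p + s * (c * Θ * (x ^ (-β) * x)) * u x)) x :=
    (hE.fun_mul hu).congr_deriv (by ring)
  have hW := hE.fun_mul (hw.fun_add ((hA.const_mul s).fun_mul hu))
  have hH := hE.fun_mul (hq.fun_add (((hψ.const_mul Θ₁).const_mul s).fun_mul hu))
  set Z := weight β lam d s Θ x * u x with hZdef
  set Zx := weight β lam d s Θ x * (p + s * (c * Θ * (x ^ (-β) * x)) * u x) with hZxdef
  set Wx := weight β lam d s Θ x * (s * (c * Θ * (x ^ (-β) * x))) *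
      (w x + s * (c * Θ * (x ^ α * x ^ (-β) * x)) * u x) +
    weight β lam d s Θ x * (w' + (s * (c * (1 + α - β) * Θ * (x ^ α * x ^ (-β))) * u x +
      s * (c * Θ * (x ^ α * x ^ (-β) * x)) * p)) with hWx
  set H := weight β lam d s Θ x * (q x + s * (Θ₁ * (lam * (x ^ (2 - β) - d))) * u x) with hHdef
  -- The mixed derivative Z_tx: it arises as the x-derivative of Z_t in the flux and as the
  -- t-derivative of Z_x in the energy, so the two contributions cancel.
  set Hx := weight β lam d s Θ x * (r + s * (c * Θ₁ * (x ^ (-β) * x)) * u x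
            + s * (c * Θ * (x ^ (-β) * x)) * q x
          + s * (Θ₁ * (lam * (x ^ (2 - β) - d)))
            * (p + s * (c * Θ * (x ^ (-β) * x)) * u x)) with hHxdef
  have hWeq : weight β lam d s Θ x * (w x + s * (c * Θ * (x ^ α * x ^ (-β) * x)) * u x)
      = x ^ α * Zx := by rw [hwp, hZxdef]; ring
  have hJ := ((((hW.fun_mul hH).neg.fun_sub ((hφ.const_mul s).fun_mul (hW.fun_pow 2))).sub
    ((hAx.const_mul s).fun_mul (hW.fun_mul hZ))).fun_sub (((hV.fun_mul hA).const_mul s).fun_mul (hZ.fun_pow 2))).fun_add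
    ((hg.const_mul (s * m * c * Θ)).fun_mul (hZ.fun_pow 2))
  refine ⟨_, hJ, ?_⟩
  have key := carleman_identity c s m α β Θ Θ₁ Θ₂ (lam * (x ^ (2 - β) - d)) (x ^ α) (x ^ (-β)) x
    Z Zx Wx H Hx hxne
  have hPP : (q x - w') * weight β lam d s Θ x =
      (-Wx - (s ^ 2 * c ^ 2 * Θ ^ 2 * (x ^ α * (x ^ (-β)) ^ 2 * x ^ 2)
          + s * Θ₁ * (lam * (x ^ (2 - β) - d))) * Z)
        + (H + 2 * s * (c * Θ * (x ^ α * x ^ (-β) * x)) * Zx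
          + s * (c * (1 + α - β) * Θ * (x ^ α * x ^ (-β))) * Z) := by
    rw [hZdef, hZxdef, hWx, hHdef, hwp]; ring
  have hHx' : weight β lam d s Θ x * (s * (c * Θ * (x ^ (-β) * x))) *
        (q x + s * (Θ₁ * (lam * (x ^ (2 - β) - d))) * u x) +
      weight β lam d s Θ x * (r + (s * (Θ₁ * (c * (x ^ (-β) * x))) * u x
        + s * (Θ₁ * (lam * (x ^ (2 - β) - d))) * p)) = Hx := by
    rw [hHxdef]; ring
  -- The squares of P₊Z and P₋Z are discarded; this is the source of the factor 1/4.
  have h4 : ∀ y z : ℝ, y * z ≤ (y + z) ^ 2 / 4 := fun y z => by nlinarith [sq_nonneg (y - z)]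
  have hfin := h4 (-Wx - (s ^ 2 * c ^ 2 * Θ ^ 2 * (x ^ α * (x ^ (-β)) ^ 2 * x ^ 2)
          + s * Θ₁ * (lam * (x ^ (2 - β) - d))) * Z)
        (H + 2 * s * (c * Θ * (x ^ α * x ^ (-β) * x)) * Zx
          + s * (c * (1 + α - β) * Θ * (x ^ α * x ^ (-β))) * Z)
  rw [← hPP, key, mul_pow (q x - w')] at hfin
  simp only [hHx', hWeq]
  unfold carlemanForm carlemanEnergyDeriv
  simp only [← hc, ← hZdef, ← hZxdef, ← hHdef, ← hHxdef]
  refine le_trans (le_of_eq ?_) (le_sub_iff_add_le.2 hfin)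
  ring

/-! ### Integration over space-time rectangles, and regular solutions -/

/-- Lebesgue measure on the unit interval. -/
abbrev unitVol : Measure ℝ := volume.restrict (Ioo 0 1)

instance : IsProbabilityMeasure unitVol := ⟨by simp⟩

/-- Divergence theorem as an inequality on a space-time rectangle. -/
theorem integral_flux_le {t₀ t₁ η : ℝ} (ht : t₀ ≤ t₁) (hη : η ∈ Ioo (0 : ℝ) 1)
    {J K Kt I : ℝ → ℝ → ℝ}
    (hJ : ∀ t ∈ Icc t₀ t₁, AbsolutelyContinuousOnInterval (J t) η 1)
    (hK : ∀ᵐ x ∂(volume.restrict (Ioo η 1)), ∀ t ∈ Icc t₀ t₁,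
      HasDerivAt (fun t => K t x) (Kt t x) t)
    (hK0 : ∀ x, K t₀ x = 0 ∧ K t₁ x = 0)
    (hle : ∀ t ∈ Icc t₀ t₁, ∀ᵐ x ∂(volume.restrict (Ioo η 1)),
      ∃ J', HasDerivAt (J t) J' x ∧ J' + Kt t x ≤ I t x)
    (hKt : Integrable (fun z : ℝ × ℝ => Kt z.1 z.2)
      ((volume.restrict (Ioo t₀ t₁)).prod (volume.restrict (Ioo η 1))))
    (hI : Integrable (fun z : ℝ × ℝ => I z.1 z.2)
      ((volume.restrict (Ioo t₀ t₁)).prod (volume.restrict (Ioo η 1))))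
    (hJi : IntegrableOn (fun t => J t 1 - J t η) (Ioo t₀ t₁)) :
    ∫ t in Ioo t₀ t₁, (J t 1 - J t η) ≤
      ∫ z, I z.1 z.2 ∂((volume.restrict (Ioo t₀ t₁)).prod (volume.restrict (Ioo η 1))) := by
  have hKt0 : ∫ z, Kt z.1 z.2
      ∂((volume.restrict (Ioo t₀ t₁)).prod (volume.restrict (Ioo η 1))) = 0 := by
    rw [integral_prod_symm _ hKt]
    refine integral_eq_zero_of_ae ?_
    filter_upwards [hK, hKt.prod_left_ae] with x hx hxi
    rw [Pi.zero_apply, ← integral_Ioc_eq_integral_Ioo, ← intervalIntegral.integral_of_le ht,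
      intervalIntegral.integral_eq_sub_of_hasDerivAt (f := fun t => K t x)]
    · simp [(hK0 x).1, (hK0 x).2]
    · rwa [uIcc_of_le ht]
    · rw [intervalIntegrable_iff_integrableOn_Ioo_of_le ht]
      exact hxi
  have hD := hI.sub hKt
  have h1 : ∫ t in Ioo t₀ t₁, (J t 1 - J t η) ≤
      ∫ t in Ioo t₀ t₁, ∫ x in Ioo η 1, (I t x - Kt t x) := by
    refine integral_mono_ae hJi hD.integral_prod_left ?_
    filter_upwards [hD.prod_right_ae, ae_restrict_mem measurableSet_Ioo] with t hti htm
    have htm' := Ioo_subset_Icc_self htm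
    rw [← (hJ t htm').integral_deriv_eq_sub, intervalIntegral.integral_of_le hη.2.le,
      integral_Ioc_eq_integral_Ioo]
    refine integral_mono_ae ?_ hti ?_
    · have := (hJ t htm').intervalIntegrable_deriv
      rwa [intervalIntegrable_iff_integrableOn_Ioo_of_le hη.2.le] at this
    · filter_upwards [hle t htm'] with x hx
      obtain ⟨J', hJ', hle'⟩ := hx
      rw [hJ'.deriv]
      change J' ≤ I t x - Kt t x
      linarith
  have h2 : ∫ t in Ioo t₀ t₁, ∫ x in Ioo η 1, (I t x - Kt t x) =
      ∫ z, I z.1 z.2 ∂((volume.restrict (Ioo t₀ t₁)).prod (volume.restrict (Ioo η 1))) := by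
    have h3 := integral_prod _ hD
    simp only [Pi.sub_apply] at h3
    rw [← h3, integral_sub hI hKt, hKt0, sub_zero]
  exact h1.trans_eq h2

/-- A solution of `u_t - (x ^ α u_x)_x = F` with Dirichlet conditions that is smooth in time,
with `p = u_x`, `q = u_t`, `r = u_xt`, `w = x ^ α u_x`, and vanishes at the times `t₀` and `t₁`. -/
structure RegularSolution (α t₀ t₁ : ℝ) (u p q r w F : ℝ → ℝ → ℝ) : Prop where
  meas_p : Measurable (fun z : ℝ × ℝ => p z.1 z.2)
  meas_r : Measurable (fun z : ℝ × ℝ => r z.1 z.2)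
  meas_u : Measurable (fun z : ℝ × ℝ => u z.1 z.2)
  meas_q : Measurable (fun z : ℝ × ℝ => q z.1 z.2)
  meas_w : Measurable (fun z : ℝ × ℝ => w z.1 z.2)
  time_deriv : ∀ᵐ x ∂unitVol, ∀ t,
    HasDerivAt (fun t => u t x) (q t x) t ∧ HasDerivAt (fun t => p t x) (r t x) t
  vanish : ∀ t, t = t₀ ∨ t = t₁ → ∀ x, u t x = 0 ∧ p t x = 0
  u_eq : ∀ t x, u t x = ∫ ξ in (0 : ℝ)..x, p t ξ
  q_eq : ∀ t x, q t x = ∫ ξ in (0 : ℝ)..x, r t ξ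
  u_one : ∀ t, u t 1 = 0
  q_one : ∀ t, q t 1 = 0
  w_eq : ∀ t x, w t x = w t 1 - ∫ ξ in x..1, (q t ξ - F t ξ)
  w_ae : ∀ t, ∀ᵐ x ∂unitVol, w t x = x ^ α * p t x
  bound : ∃ M, ∀ t, (∀ x ∈ Icc (0 : ℝ) 1, |w t x| ≤ M) ∧ ∀ᵐ x ∂unitVol, |x ^ α * r t x| ≤ M
  F_memLp : MemLp (fun z : ℝ × ℝ => F z.1 z.2) 2 ((volume.restrict (Ioo t₀ t₁)).prod unitVol)
  F_integrable : ∀ t, IntervalIntegrable (F t) volume 0 1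

theorem ae_restrict_Ioo_of_unitVol {P : ℝ → Prop} (h : ∀ᵐ x ∂unitVol, P x) {η : ℝ} (hη : 0 ≤ η) :
    ∀ᵐ x ∂(volume.restrict (Ioo η 1)), P x :=
  ae_mono (Measure.restrict_mono (Ioo_subset_Ioo_left hη) le_rfl) h

theorem abs_le_mul_rpow_neg {α M x v : ℝ} (hx : 0 < x) (h : |x ^ α * v| ≤ M) :
    |v| ≤ M * x ^ (-α) := by
  rw [abs_mul, abs_of_pos (Real.rpow_pos_of_pos hx α)] at h
  rw [Real.rpow_neg hx.le, ← div_eq_mul_inv, le_div_iff₀ (Real.rpow_pos_of_pos hx α)]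
  linarith

theorem intervalIntegrable_of_bound {α M : ℝ} (hα1 : α < 1) {p : ℝ → ℝ} (hm : Measurable p)
    (h : ∀ᵐ x ∂unitVol, |x ^ α * p x| ≤ M) : IntervalIntegrable p volume 0 1 := by
  have h1 : IntervalIntegrable (fun x : ℝ => M * x ^ (-α)) volume 0 1 :=
    (intervalIntegral.intervalIntegrable_rpow' (by linarith)).const_mul M
  rw [intervalIntegrable_iff_integrableOn_Ioo_of_le zero_le_one] at h1 ⊢
  refine Integrable.mono' h1 hm.aestronglyMeasurable ?_
  filter_upwards [h, ae_restrict_mem measurableSet_Ioo] with x hx hx0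
  exact abs_le_mul_rpow_neg hx0.1 hx

theorem abs_integral_le_rpow {α M : ℝ} (hα1 : α < 1) {p : ℝ → ℝ}
    (h : ∀ᵐ x ∂unitVol, |x ^ α * p x| ≤ M) {x : ℝ} (hx : x ∈ Icc (0 : ℝ) 1) :
    |∫ ξ in (0 : ℝ)..x, p ξ| ≤ M / (1 - α) * x ^ (1 - α) := by
  have h2 : ∫ ξ in (0 : ℝ)..x, M * ξ ^ (-α) = M / (1 - α) * x ^ (1 - α) := by
    rw [intervalIntegral.integral_const_mul, integral_rpow (Or.inl (by linarith)),
      Real.zero_rpow (by linarith)]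
    rw [show -α + 1 = 1 - α by ring]; ring
  rw [← h2, ← Real.norm_eq_abs]
  refine intervalIntegral.norm_integral_le_of_norm_le hx.1 ?_
    ((intervalIntegral.intervalIntegrable_rpow' (by linarith)).const_mul M)
  have h3 := (ae_restrict_iff' measurableSet_Ioo).1 h
  have h4 : ∀ᵐ ξ : ℝ, ξ ≠ 1 := by simp [ae_iff, measure_singleton]
  filter_upwards [h3, h4] with ξ hξ hξ1 hξm
  exact abs_le_mul_rpow_neg hξm.1 (hξ ⟨hξm.1, lt_of_le_of_ne (hξm.2.trans hx.2) hξ1⟩)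

theorem abs_eq_integral_ae_hasDerivAt {u p : ℝ → ℝ} (hp : IntervalIntegrable p volume 0 1)
    {C c : ℝ} (hc : c ∈ Icc (0 : ℝ) 1) (hu : ∀ x, u x = C + ∫ ξ in c..x, p ξ) :
    AbsolutelyContinuousOnInterval u 0 1 ∧ ∀ᵐ x ∂unitVol, HasDerivAt u (p x) x := by
  have hu' : u = (fun _ => C) + (fun x => ∫ ξ in c..x, p ξ) := funext hu
  have hc' : c ∈ uIcc (0 : ℝ) 1 := by rwa [uIcc_of_le zero_le_one]
  constructor
  · rw [hu']
    exact (contDiffOn_const.absolutelyContinuousOnInterval).add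
      (hp.absolutelyContinuousOnInterval_intervalIntegral hc')
  · rw [ae_restrict_iff' measurableSet_Ioo]
    filter_upwards [hp.ae_hasDerivAt_integral] with x hx hxm
    rw [uIcc_of_le zero_le_one] at hx
    rw [hu']
    exact ((hx (Ioo_subset_Icc_self hxm) c hc).const_add C)

namespace RegularSolution

variable {α t₀ t₁ : ℝ} {u p q r w F : ℝ → ℝ → ℝ}

/-- Bounded x^α u_x and x^α u_xt integrate, from the zero value at x = 0, to O(x^{1-α}). This rate
for u and u_t is what makes every flux vanish at the degenerate end. -/
theorem exists_bounds (h : RegularSolution α t₀ t₁ u p q r w F) (hα : α ∈ Ioo (0 : ℝ) 1) :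
    ∃ M, 0 ≤ M ∧ (∀ t, ∀ x ∈ Icc (0 : ℝ) 1, |w t x| ≤ M) ∧
      (∀ t, ∀ᵐ x ∂unitVol, |x ^ α * p t x| ≤ M) ∧ (∀ t, ∀ᵐ x ∂unitVol, |x ^ α * r t x| ≤ M) ∧
      (∀ t, ∀ x ∈ Icc (0 : ℝ) 1, |u t x| ≤ M * x ^ (1 - α)) ∧
      (∀ t, ∀ x ∈ Icc (0 : ℝ) 1, |q t x| ≤ M * x ^ (1 - α)) := by
  obtain ⟨M, hM⟩ := h.bound
  have hM0 : 0 ≤ M := (abs_nonneg _).trans ((hM 0).1 0 ⟨le_rfl, zero_le_one⟩)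
  have hα' : 0 < 1 - α := by linarith [hα.2]
  have hle : M ≤ M / (1 - α) := le_div_self hM0 hα' (by linarith [hα.1])
  have hp : ∀ t, ∀ᵐ x ∂unitVol, |x ^ α * p t x| ≤ M := fun t => by
    filter_upwards [h.w_ae t, ae_restrict_mem measurableSet_Ioo] with x hx hxm
    rw [← hx]; exact (hM t).1 x (Ioo_subset_Icc_self hxm)
  refine ⟨M / (1 - α), by positivity, fun t x hx => ((hM t).1 x hx).trans hle,
    fun t => (hp t).mono fun x hx => hx.trans hle, fun t => (hM t).2.mono fun x hx => hx.trans hle,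
    fun t x hx => ?_, fun t x hx => ?_⟩
  · rw [h.u_eq]; exact abs_integral_le_rpow hα.2 (hp t) hx
  · rw [h.q_eq]; exact abs_integral_le_rpow hα.2 (hM t).2 hx

theorem ac_u (h : RegularSolution α t₀ t₁ u p q r w F) (hα : α ∈ Ioo (0 : ℝ) 1) (t : ℝ) :
    AbsolutelyContinuousOnInterval (u t) 0 1 ∧ ∀ᵐ x ∂unitVol, HasDerivAt (u t) (p t x) x := by
  obtain ⟨M, -, -, hp, -⟩ := h.exists_bounds hα
  exact abs_eq_integral_ae_hasDerivAt
    (intervalIntegrable_of_bound hα.2 (h.meas_p.comp measurable_prodMk_left) (hp t))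
    (C := 0) (c := 0) ⟨le_rfl, zero_le_one⟩ (fun x => by rw [h.u_eq]; simp)

theorem ac_q (h : RegularSolution α t₀ t₁ u p q r w F) (hα : α ∈ Ioo (0 : ℝ) 1) (t : ℝ) :
    AbsolutelyContinuousOnInterval (q t) 0 1 ∧ ∀ᵐ x ∂unitVol, HasDerivAt (q t) (r t x) x := by
  obtain ⟨M, -, -, -, hr, -⟩ := h.exists_bounds hα
  exact abs_eq_integral_ae_hasDerivAt
    (intervalIntegrable_of_bound hα.2 (h.meas_r.comp measurable_prodMk_left) (hr t))
    (C := 0) (c := 0) ⟨le_rfl, zero_le_one⟩ (fun x => by rw [h.q_eq]; simp)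

theorem ac_w (h : RegularSolution α t₀ t₁ u p q r w F) (hα : α ∈ Ioo (0 : ℝ) 1) (t : ℝ) :
    AbsolutelyContinuousOnInterval (w t) 0 1 ∧
      ∀ᵐ x ∂unitVol, HasDerivAt (w t) (q t x - F t x) x := by
  refine abs_eq_integral_ae_hasDerivAt (C := w t 1) (c := 1)
    (((h.ac_q hα t).1.continuousOn.intervalIntegrable).sub (h.F_integrable t))
    ⟨zero_le_one, le_rfl⟩ (fun x => ?_)
  rw [h.w_eq t x, intervalIntegral.integral_symm]; ring

end RegularSolution

theorem prod_unitVol_restrict (μ : Measure ℝ) [SFinite μ] (s : Set ℝ) :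
    μ.prod (volume.restrict s) = (μ.prod volume).restrict (univ ×ˢ s) := by
  rw [← Measure.prod_restrict, Measure.restrict_univ]

/-- Exhaustion of the unit interval by the intervals `(η, 1)`. -/
theorem lintegral_prod_unitVol_le {μ : Measure ℝ} [SFinite μ] {f : ℝ × ℝ → ENNReal} {B : ENNReal}
    {C σ : ℝ} (hσ : 0 < σ)
    (h : ∀ η ∈ Ioo (0 : ℝ) 1,
      ∫⁻ z, f z ∂(μ.prod (volume.restrict (Ioo η 1))) ≤ B + ENNReal.ofReal (C * η ^ σ)) :
    ∫⁻ z, f z ∂(μ.prod unitVol) ≤ B := by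
  have hη : ∀ n : ℕ, (1 / ((n : ℝ) + 2)) ∈ Ioo (0 : ℝ) 1 := fun n => by
    have : (0 : ℝ) < (n : ℝ) + 2 := by positivity
    refine ⟨by positivity, ?_⟩
    rw [div_lt_one this]; have : (0 : ℝ) ≤ n := n.cast_nonneg
    linarith
  have hlim : Tendsto (fun n : ℕ => (1 / ((n : ℝ) + 2))) atTop (𝓝 0) := by
    have := (tendsto_one_div_add_atTop_nhds_zero_nat (𝕜 := ℝ)).comp (tendsto_add_atTop_nat 1)
    refine this.congr fun n => ?_
    simp only [Function.comp_apply, Nat.cast_add, Nat.cast_one]; ring_nf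
  have hU : (univ : Set ℝ) ×ˢ Ioo (0 : ℝ) 1 = ⋃ n : ℕ, univ ×ˢ Ioo (1 / ((n : ℝ) + 2)) 1 := by
    ext ⟨t, x⟩
    simp only [mem_prod, mem_univ, true_and, mem_iUnion, mem_Ioo]
    constructor
    · rintro ⟨h0, h1⟩
      obtain ⟨n, hn⟩ := ((tendsto_order.1 hlim).2 x h0).exists
      exact ⟨n, hn, h1⟩
    · rintro ⟨n, h0, h1⟩
      exact ⟨(hη n).1.trans h0, h1⟩
  have hdir : Directed (· ⊆ ·) (fun n : ℕ => (univ : Set ℝ) ×ˢ Ioo (1 / ((n : ℝ) + 2)) 1) := by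
    refine Monotone.directed_le ?_
    intro m n hmn
    refine prod_mono le_rfl (Ioo_subset_Ioo_left ?_)
    have : (m : ℝ) ≤ n := by exact_mod_cast hmn
    have h0 : (0 : ℝ) ≤ m := m.cast_nonneg
    gcongr
  have hsup : ∫⁻ z, f z ∂(μ.prod unitVol) =
      ⨆ n : ℕ, ∫⁻ z, f z ∂(μ.prod (volume.restrict (Ioo (1 / ((n : ℝ) + 2)) 1))) := by
    simp only [prod_unitVol_restrict]
    rw [hU, setLIntegral_iUnion_of_directed _ hdir]
  have hlim2 : Tendsto (fun n : ℕ => B + ENNReal.ofReal (C * (1 / ((n : ℝ) + 2)) ^ σ)) atTop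
      (𝓝 (B + ENNReal.ofReal (C * 0))) := by
    refine tendsto_const_nhds.add (ENNReal.tendsto_ofReal (Tendsto.const_mul C ?_))
    have := hlim.rpow_const (p := σ) (Or.inr hσ.le)
    rwa [Real.zero_rpow hσ.ne'] at this
  rw [mul_zero, ENNReal.ofReal_zero, add_zero] at hlim2
  rw [hsup]
  have hmono : Monotone fun n : ℕ =>
      ∫⁻ z, f z ∂(μ.prod (volume.restrict (Ioo (1 / ((n : ℝ) + 2)) 1))) := by
    intro m n hmn
    refine lintegral_mono' ?_ le_rfl
    rw [prod_unitVol_restrict, prod_unitVol_restrict]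
    refine Measure.restrict_mono ?_ le_rfl
    refine prod_mono le_rfl (Ioo_subset_Ioo_left ?_)
    have : (m : ℝ) ≤ n := by exact_mod_cast hmn
    have h0 : (0 : ℝ) ≤ m := m.cast_nonneg
    gcongr
  exact le_of_tendsto_of_tendsto' (tendsto_atTop_iSup hmono) hlim2 fun n => h _ (hη n)

/-- From a differential inequality `∂_x J + ∂_t K ≤ g - f` to an integral estimate for `f`,
when the flux `J` vanishes at `x = 0`. -/
theorem lintegral_le_of_flux {t₀ t₁ C σ : ℝ} (ht : t₀ ≤ t₁) (hσ : 0 < σ)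
    {J K Kt f g : ℝ → ℝ → ℝ}
    (hJ : ∀ t ∈ Icc t₀ t₁, ∀ η ∈ Ioo (0 : ℝ) 1, AbsolutelyContinuousOnInterval (J t) η 1)
    (hK : ∀ᵐ x ∂unitVol, ∀ t ∈ Icc t₀ t₁, HasDerivAt (fun t => K t x) (Kt t x) t)
    (hK0 : ∀ x, K t₀ x = 0 ∧ K t₁ x = 0)
    (hle : ∀ t ∈ Icc t₀ t₁, ∀ᵐ x ∂unitVol,
      ∃ J', HasDerivAt (J t) J' x ∧ J' + Kt t x ≤ g t x - f t x)
    (hKt : ∀ η ∈ Ioo (0 : ℝ) 1, Integrable (fun z : ℝ × ℝ => Kt z.1 z.2)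
      ((volume.restrict (Ioo t₀ t₁)).prod (volume.restrict (Ioo η 1))))
    (hf : ∀ η ∈ Ioo (0 : ℝ) 1, Integrable (fun z : ℝ × ℝ => f z.1 z.2)
      ((volume.restrict (Ioo t₀ t₁)).prod (volume.restrict (Ioo η 1))))
    (hf0 : ∀ t ∈ Ioo t₀ t₁, ∀ x ∈ Ioo (0 : ℝ) 1, 0 ≤ f t x) (hg0 : ∀ t x, 0 ≤ g t x)
    (hg : Integrable (fun z : ℝ × ℝ => g z.1 z.2) ((volume.restrict (Ioo t₀ t₁)).prod unitVol))
    (hJm : ∀ η, Measurable fun t => J t η)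
    (hJη : ∀ t ∈ Icc t₀ t₁, ∀ η ∈ Ioo (0 : ℝ) 1, |J t η| ≤ C * η ^ σ)
    (hJ1 : IntegrableOn (fun t => J t 1) (Ioo t₀ t₁)) :
    ∫⁻ z, ENNReal.ofReal (f z.1 z.2) ∂((volume.restrict (Ioo t₀ t₁)).prod unitVol) ≤
      ENNReal.ofReal ((∫ z, g z.1 z.2 ∂((volume.restrict (Ioo t₀ t₁)).prod unitVol))
        - ∫ t in Ioo t₀ t₁, J t 1) := by
  -- Integrability of f is known only away from x = 0, so the estimate is made on (η, 1) with a
  -- lower integral; the flux through x = η costs C(t₁ - t₀)η^σ, which disappears in the limit.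
  refine lintegral_prod_unitVol_le (C := C * (t₁ - t₀)) hσ fun η hη => ?_
  have hmeas : (volume.restrict (Ioo t₀ t₁)).prod (volume.restrict (Ioo η 1)) ≤
      (volume.restrict (Ioo t₀ t₁)).prod unitVol := by
    rw [prod_unitVol_restrict, prod_unitVol_restrict]
    exact Measure.restrict_mono (prod_mono le_rfl (Ioo_subset_Ioo_left hη.1.le)) le_rfl
  have hgη := hg.mono_measure hmeas
  have hJηi : IntegrableOn (fun t => J t η) (Ioo t₀ t₁) := by
    refine Integrable.mono' (g := fun _ => C * η ^ σ) (integrable_const _)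
      (hJm η).aestronglyMeasurable ?_
    filter_upwards [ae_restrict_mem measurableSet_Ioo] with t htm
    exact hJη t (Ioo_subset_Icc_self htm) η hη
  have key := integral_flux_le (J := J) (I := fun t x => g t x - f t x) ht hη
    (fun t htm => hJ t htm η hη) (ae_restrict_Ioo_of_unitVol hK hη.1.le) hK0
    (fun t htm => ae_restrict_Ioo_of_unitVol (hle t htm) hη.1.le) (hKt η hη)
    (hgη.sub (hf η hη)) (hJ1.sub hJηi)
  rw [integral_sub hgη (hf η hη), integral_sub hJ1 hJηi] at key
  have h1 : ∫ t in Ioo t₀ t₁, J t η ≤ C * (t₁ - t₀) * η ^ σ := by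
    calc ∫ t in Ioo t₀ t₁, J t η ≤ ∫ t in Ioo t₀ t₁, C * η ^ σ := by
          refine integral_mono_ae hJηi (integrable_const _) ?_
          filter_upwards [ae_restrict_mem measurableSet_Ioo] with t htm
          exact (abs_le.1 (hJη t (Ioo_subset_Icc_self htm) η hη)).2
      _ = C * (t₁ - t₀) * η ^ σ := by
          rw [setIntegral_const, Real.volume_real_Ioo_of_le ht, smul_eq_mul]; ring
  have h2 : ∫ z, g z.1 z.2 ∂((volume.restrict (Ioo t₀ t₁)).prod (volume.restrict (Ioo η 1))) ≤
      ∫ z, g z.1 z.2 ∂((volume.restrict (Ioo t₀ t₁)).prod unitVol) :=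
    integral_mono_measure hmeas (ae_of_all _ fun z => hg0 _ _) hg
  have hfae : 0 ≤ᵐ[(volume.restrict (Ioo t₀ t₁)).prod (volume.restrict (Ioo η 1))]
      fun z : ℝ × ℝ => f z.1 z.2 := by
    rw [Measure.prod_restrict]
    filter_upwards [ae_restrict_mem (measurableSet_Ioo.prod measurableSet_Ioo)] with z hz
    exact hf0 _ hz.1 _ ⟨hη.1.trans hz.2.1, hz.2.2⟩
  rw [← ofReal_integral_eq_lintegral_ofReal (hf η hη) hfae]
  refine le_trans (ENNReal.ofReal_le_ofReal ?_) ENNReal.ofReal_add_le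
  linarith

namespace RegularSolution

variable {α t₀ t₁ : ℝ} {u p q r w F : ℝ → ℝ → ℝ}

theorem ae_prod_bound {v : ℝ → ℝ → ℝ} (hv : Measurable (fun z : ℝ × ℝ => v z.1 z.2)) {M : ℝ}
    (h : ∀ t, ∀ᵐ x ∂unitVol, |x ^ α * v t x| ≤ M) (μ : Measure ℝ) [SFinite μ] :
    ∀ᵐ z ∂(μ.prod unitVol), |z.2 ^ α * v z.1 z.2| ≤ M := by
  refine (Measure.ae_prod_iff_ae_ae (p := fun z : ℝ × ℝ => |z.2 ^ α * v z.1 z.2| ≤ M) ?_).2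
    (ae_of_all _ h)
  exact measurableSet_le ((measurable_snd.pow_const α).mul hv).abs measurable_const

theorem ae_strip_bound {v : ℝ → ℝ → ℝ} (hv : Measurable (fun z : ℝ × ℝ => v z.1 z.2)) {M : ℝ}
    (hM : 0 ≤ M) (hα : 0 < α) (h : ∀ t, ∀ᵐ x ∂unitVol, |x ^ α * v t x| ≤ M) {η : ℝ} (hη : 0 < η) :
    ∀ᵐ z ∂((volume.restrict (Ioo t₀ t₁)).prod (volume.restrict (Ioo η 1))),
      z ∈ Ioo t₀ t₁ ×ˢ Ioo η 1 ∧ |v z.1 z.2| ≤ M * η ^ (-α) := by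
  have hmeas : (volume.restrict (Ioo t₀ t₁)).prod (volume.restrict (Ioo η 1)) ≤
      (volume.restrict (Ioo t₀ t₁)).prod unitVol := by
    rw [prod_unitVol_restrict, prod_unitVol_restrict]
    exact Measure.restrict_mono (prod_mono le_rfl (Ioo_subset_Ioo_left hη.le)) le_rfl
  have h1 := ae_mono hmeas (ae_prod_bound hv h (volume.restrict (Ioo t₀ t₁)))
  have h2 : ∀ᵐ z ∂((volume.restrict (Ioo t₀ t₁)).prod (volume.restrict (Ioo η 1))),
      z ∈ Ioo t₀ t₁ ×ˢ Ioo η 1 := by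
    rw [Measure.prod_restrict]
    exact ae_restrict_mem (measurableSet_Ioo.prod measurableSet_Ioo)
  filter_upwards [h1, h2] with z hz hz2
  refine ⟨hz2, (abs_le_mul_rpow_neg (hη.trans hz2.2.1) hz).trans ?_⟩
  gcongr M * ?_
  exact Real.rpow_le_rpow_of_nonpos hη hz2.2.1.le (by linarith)

/-- Bounded measurable functions are integrable on the strip. -/
theorem integrable_strip {f : ℝ × ℝ → ℝ} (hf : Measurable f) {C η : ℝ}
    (h : ∀ᵐ z ∂((volume.restrict (Ioo t₀ t₁)).prod (volume.restrict (Ioo η 1))), |f z| ≤ C) :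
    Integrable f ((volume.restrict (Ioo t₀ t₁)).prod (volume.restrict (Ioo η 1))) :=
  Integrable.mono' (integrable_const C) hf.aestronglyMeasurable h

/-- The energy estimate: `‖u_t‖ ≤ ‖F‖` in `L²`. -/
theorem energy (h : RegularSolution α t₀ t₁ u p q r w F) (hα : α ∈ Ioo (0 : ℝ) 1) (ht : t₀ ≤ t₁) :
    ∫⁻ z, ENNReal.ofReal (q z.1 z.2 ^ 2) ∂((volume.restrict (Ioo t₀ t₁)).prod unitVol) ≤
      ENNReal.ofReal (∫ z, F z.1 z.2 ^ 2 ∂((volume.restrict (Ioo t₀ t₁)).prod unitVol)) := by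
  obtain ⟨M, hM0, hw, hp, hr, hu, hq⟩ := h.exists_bounds hα
  have hF2 : Integrable (fun z : ℝ × ℝ => F z.1 z.2 ^ 2)
      ((volume.restrict (Ioo t₀ t₁)).prod unitVol) := h.F_memLp.integrable_sq
  have hqle : ∀ t, ∀ x ∈ Icc (0 : ℝ) 1, |q t x| ≤ M := fun t x hx =>
    (hq t x hx).trans (mul_le_of_le_one_right hM0
      (Real.rpow_le_one hx.1 hx.2 (by linarith [hα.2])))
  -- The equation is multiplied by u_t: ∂_x J + ∂_t K = Fq - q² ≤ F²/2 - q²/2. The exponent 1 - α is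
  -- the decay of q at x = 0.
  have key := lintegral_le_of_flux (J := fun t x => -(w t x * q t x))
    (K := fun t x => x ^ α * p t x ^ 2 / 2) (Kt := fun t x => x ^ α * p t x * r t x)
    (f := fun t x => q t x ^ 2 / 2) (g := fun t x => F t x ^ 2 / 2) (C := M * M) (σ := 1 - α)
    ht (by linarith [hα.2])
    (fun t _ η hη => (((h.ac_w hα t).1.fun_mul (h.ac_q hα t).1).fun_neg).mono (by
      rw [uIcc_of_le hη.2.le, uIcc_of_le zero_le_one]; exact Icc_subset_Icc_left hη.1.le))
    (by
      filter_upwards [h.time_deriv] with x hx t _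
      exact ((((hx t).2.fun_pow 2).const_mul (x ^ α)).div_const 2).congr_deriv (by ring))
    (fun x => by simp [(h.vanish t₀ (Or.inl rfl) x).2, (h.vanish t₁ (Or.inr rfl) x).2])
    (fun t _ => by
      filter_upwards [(h.ac_w hα t).2, (h.ac_q hα t).2, h.w_ae t] with x hwx hqx hwp
      refine ⟨_, (hwx.fun_mul hqx).fun_neg, ?_⟩
      rw [hwp]
      nlinarith [sq_nonneg (F t x - q t x)])
    (fun η hη => by
      refine integrable_strip (((measurable_snd.pow_const α).mul h.meas_p).mul h.meas_r)
        (C := M * η ^ (-α) * (M * η ^ (-α))) ?_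
      filter_upwards [ae_strip_bound h.meas_p hM0 hα.1 hp hη.1,
        ae_strip_bound h.meas_r hM0 hα.1 hr hη.1] with z h1 h2
      have hz0 : 0 < z.2 := hη.1.trans h1.1.2.1
      have hz1 : z.2 ^ α ≤ 1 := Real.rpow_le_one hz0.le h1.1.2.2.le hα.1.le
      simp only [Pi.mul_apply]
      rw [abs_mul, abs_mul, abs_of_pos (Real.rpow_pos_of_pos hz0 α)]
      have : z.2 ^ α * |p z.1 z.2| ≤ 1 * (M * η ^ (-α)) := by gcongr; exact h1.2
      rw [one_mul] at this
      exact mul_le_mul this h2.2 (abs_nonneg _) ((abs_nonneg _).trans h1.2))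
    (fun η hη => by
      refine integrable_strip ((h.meas_q.pow_const 2).div_const 2) (C := M ^ 2) ?_
      filter_upwards [ae_strip_bound h.meas_p hM0 hα.1 hp hη.1] with z h1
      have h3 := hqle z.1 z.2 ⟨(hη.1.trans h1.1.2.1).le, h1.1.2.2.le⟩
      rw [abs_of_nonneg (by positivity)]
      have := sq_le_sq' (abs_le.1 h3).1 (abs_le.1 h3).2
      nlinarith [sq_nonneg (q z.1 z.2)])
    (fun t _ x _ => by positivity) (fun t x => by positivity) (hF2.div_const 2)
    (fun η => ((h.meas_w.comp measurable_prodMk_right).mul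
      (h.meas_q.comp measurable_prodMk_right)).neg)
    (fun t _ η hη => by
      rw [abs_neg, abs_mul, mul_assoc]
      have h1 := hw t η (Ioo_subset_Icc_self hη)
      have h2 := hq t η (Ioo_subset_Icc_self hη)
      gcongr)
    (by simp [h.q_one])
  simp only [h.q_one, mul_zero, neg_zero, integral_zero, sub_zero] at key
  rw [integral_div] at key
  have h2 : ∀ z : ℝ × ℝ, ENNReal.ofReal (q z.1 z.2 ^ 2) =
      ENNReal.ofReal 2 * ENNReal.ofReal (q z.1 z.2 ^ 2 / 2) := fun z => by
    rw [← ENNReal.ofReal_mul zero_le_two]; congr 1; ring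
  simp only [h2]
  rw [lintegral_const_mul _ (((h.meas_q.pow_const 2).div_const 2).ennreal_ofReal)]
  refine (mul_le_mul' le_rfl key).trans (le_of_eq ?_)
  rw [← ENNReal.ofReal_mul zero_le_two]; congr 1; ring

end RegularSolution

/-! ### Bounds for the time factor, the weight and the flux -/

/-- The first derivative of `Theta`. -/
def thetaDeriv (T k t : ℝ) : ℝ := -(k * (T - 2 * t) * Theta T k t / (t * (T - t)))

/-- The second derivative of `Theta`. -/
def thetaDeriv₂ (T k t : ℝ) : ℝ :=
  Theta T k t * (k * (k + 1) * (T - 2 * t) ^ 2 / (t * (T - t)) ^ 2 + 2 * k / (t * (T - t)))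

theorem measurable_theta (T k : ℝ) : Measurable (Theta T k) := by
  unfold Theta; fun_prop

theorem measurable_thetaDeriv (T k : ℝ) : Measurable (thetaDeriv T k) := by
  have := measurable_theta T k
  unfold thetaDeriv; fun_prop

theorem measurable_thetaDeriv₂ (T k : ℝ) : Measurable (thetaDeriv₂ T k) := by
  have := measurable_theta T k
  unfold thetaDeriv₂; fun_prop

theorem theta_pos {T k t : ℝ} (ht : t ∈ Ioo 0 T) : 0 < Theta T k t := by
  have h1 := Real.rpow_pos_of_pos ht.1 k
  have h2 := Real.rpow_pos_of_pos (sub_pos.2 ht.2) k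
  unfold Theta; positivity

theorem hasDerivAt_theta {T k t : ℝ} (ht : t ∈ Ioo 0 T) :
    HasDerivAt (Theta T k) (thetaDeriv T k t) t := by
  have h1 := (Real.rpow_pos_of_pos ht.1 k).ne'
  have h2 := (Real.rpow_pos_of_pos (sub_pos.2 ht.2) k).ne'
  have h3 := ht.1.ne'
  have h4 := (sub_pos.2 ht.2).ne'
  have d1 := hasDerivAt_rpow_div ht.1 k
  have d2 : HasDerivAt (fun t => (T - t) ^ k) (k * (T - t) ^ k / (T - t) * (-1)) t :=
    (hasDerivAt_rpow_div (sub_pos.2 ht.2) k).comp t ((hasDerivAt_id' t).const_sub T)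
  refine ((hasDerivAt_const t (1 : ℝ)).fun_div (d1.fun_mul d2) (mul_ne_zero h1 h2)).congr_deriv ?_
  unfold thetaDeriv Theta
  field_simp
  ring

theorem hasDerivAt_thetaDeriv {T k t : ℝ} (ht : t ∈ Ioo 0 T) :
    HasDerivAt (thetaDeriv T k) (thetaDeriv₂ T k t) t := by
  have h3 := ht.1.ne'
  have h4 := (sub_pos.2 ht.2).ne'
  have d1 := hasDerivAt_id' t
  have d2 : HasDerivAt (fun t => T - 2 * t) (-(2 * 1)) t := (d1.const_mul 2).const_sub T
  have d3 : HasDerivAt (fun t => t * (T - t)) (1 * (T - t) + t * (-1)) t :=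
    d1.fun_mul (d1.const_sub T)
  refine ((((d2.const_mul k).fun_mul (hasDerivAt_theta ht)).fun_div d3
    (mul_ne_zero h3 h4)).fun_neg).congr_deriv ?_
  unfold thetaDeriv₂ thetaDeriv
  field_simp
  ring

/-- With m = t(T - t) one has Θ = m^{-k}, so 1/m² = m^{k-2}Θ is at most a multiple of Θ because m ≤
T². Each time derivative costs a factor 1/m, and Θ/m and Θ/m² are both O(Θ²). -/
theorem exists_theta_bounds {T k : ℝ} (hT : 0 < T) (hk : 4 ≤ k) :
    ∃ C₀, 0 ≤ C₀ ∧ ∀ t ∈ Ioo 0 T, 1 / (t * (T - t)) ^ 2 ≤ C₀ * Theta T k t ∧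
      |thetaDeriv T k t| ≤ C₀ * Theta T k t ^ 2 ∧
      |thetaDeriv₂ T k t| ≤ C₀ * Theta T k t ^ 2 := by
  set D := (T ^ 2) ^ (k - 2) with hD
  have hD0 : 0 < D := Real.rpow_pos_of_pos (by positivity) _
  have hk0 : 0 < k := by linarith
  refine ⟨D + k * T * (T ^ 2 * D) + (k * (k + 1) * T ^ 2 * D + 2 * k * (T ^ 2 * D)), by positivity,
    fun t ht => ?_⟩
  set m := t * (T - t) with hm
  have hTt : 0 < T - t := sub_pos.2 ht.2
  have hm0 : 0 < m := mul_pos ht.1 hTt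
  have hmT : m ≤ T ^ 2 := by rw [hm, sq]; nlinarith [ht.1, ht.2]
  have hΘ0 := theta_pos (k := k) ht
  set Θ := Theta T k t with hΘ
  have hΘm : Θ = 1 / m ^ k := by
    rw [hΘ, hm, Real.mul_rpow ht.1.le hTt.le]; rfl
  have e2 : 1 / m ^ 2 ≤ D * Θ := by
    have h1 : m ^ (k - 2) ≤ D := Real.rpow_le_rpow hm0.le hmT (by linarith)
    rw [Real.rpow_sub hm0] at h1
    have hmk := Real.rpow_pos_of_pos hm0 k
    rw [hΘm]
    calc 1 / m ^ 2 = m ^ k / m ^ (2 : ℝ) * (1 / m ^ k) := by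
          rw [Real.rpow_two]; field_simp
      _ ≤ _ := by gcongr
  have e1 : 1 / m ≤ T ^ 2 * D * Θ := by
    calc 1 / m = m * (1 / m ^ 2) := by field_simp
      _ ≤ T ^ 2 * (D * Θ) := by gcongr
      _ = _ := by ring
  have hT2 : |T - 2 * t| ≤ T := by rw [abs_le]; constructor <;> linarith [ht.1, ht.2]
  have hT3 : (T - 2 * t) ^ 2 ≤ T ^ 2 := sq_le_sq' (by linarith [ht.2]) (by linarith [ht.1])
  have f1 : |thetaDeriv T k t| ≤ k * T * (T ^ 2 * D) * Θ ^ 2 := by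
    unfold thetaDeriv
    rw [abs_neg, abs_div, abs_mul, abs_mul, abs_of_pos hk0, ← hm, abs_of_pos hm0, ← hΘ,
      abs_of_pos hΘ0]
    calc k * |T - 2 * t| * Θ / m = k * |T - 2 * t| * Θ * (1 / m) := by ring
      _ ≤ k * T * Θ * (T ^ 2 * D * Θ) := by gcongr
      _ = _ := by ring
  have f2 : |thetaDeriv₂ T k t| ≤ (k * (k + 1) * T ^ 2 * D + 2 * k * (T ^ 2 * D)) * Θ ^ 2 := by
    unfold thetaDeriv₂
    rw [← hm, ← hΘ, abs_of_nonneg (by positivity)]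
    calc Θ * (k * (k + 1) * (T - 2 * t) ^ 2 / m ^ 2 + 2 * k / m)
        = Θ * (k * (k + 1) * (T - 2 * t) ^ 2 * (1 / m ^ 2) + 2 * k * (1 / m)) := by ring
      _ ≤ Θ * (k * (k + 1) * T ^ 2 * (D * Θ) + 2 * k * (T ^ 2 * D * Θ)) := by gcongr
      _ = _ := by ring
  have g1 : 0 ≤ k * T * (T ^ 2 * D) := by positivity
  have g2 : 0 ≤ k * (k + 1) * T ^ 2 * D + 2 * k * (T ^ 2 * D) := by positivity
  exact ⟨e2.trans (mul_le_mul_of_nonneg_right (by linarith) hΘ0.le),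
    f1.trans (mul_le_mul_of_nonneg_right (by linarith) (by positivity)),
    f2.trans (mul_le_mul_of_nonneg_right (by linarith) (by positivity))⟩

theorem weight_sq_eq (T k β lam d s t x : ℝ) :
    weight β lam d s (Theta T k t) x ^ 2 = Real.exp (2 * s * phi T k β lam d t x) := by
  unfold weight phi
  rw [sq, ← Real.exp_add]; ring_nf

/-- The gap between x^{2-β} ≤ 1 and d ≥ 5 keeps ψ away from 0. Hence the weight is at most 1 and
decays exponentially in Θ. -/
theorem psi_bounds {β lam d x : ℝ} (hβ : β < 1) (hlam : 0 < lam) (hd : 5 ≤ d) (hx : x ∈ Icc (0 : ℝ) 1) :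
    lam * (x ^ (2 - β) - d) ≤ -(4 * lam) ∧ |lam * (x ^ (2 - β) - d)| ≤ lam * d := by
  have h0 := Real.rpow_nonneg hx.1 (2 - β)
  have h1 : x ^ (2 - β) ≤ 1 := Real.rpow_le_one hx.1 hx.2 (by linarith)
  constructor
  · nlinarith
  · rw [abs_le]; constructor <;> nlinarith

theorem weight_le_one {β lam d s Θ x : ℝ} (hβ : β < 1) (hlam : 0 < lam) (hd : 5 ≤ d) (hs : 0 ≤ s)
    (hΘ : 0 ≤ Θ) (hx : x ∈ Icc (0 : ℝ) 1) : weight β lam d s Θ x ≤ 1 := by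
  unfold weight
  rw [Real.exp_le_one_iff]
  have := (psi_bounds hβ hlam hd hx).1
  exact mul_nonpos_of_nonneg_of_nonpos hs (mul_nonpos_of_nonneg_of_nonpos hΘ (by linarith))

theorem rpow_one_sub {x : ℝ} (hx : 0 < x) (α : ℝ) : x ^ (1 - α) = x ^ (-α) * x := by
  rw [sub_eq_neg_add, Real.rpow_add hx, Real.rpow_one]

/-- The flux tends to `0` at `x = 0`, uniformly for bounded data. -/
theorem exists_abs_carlemanFlux_le {α β lam d m s B M : ℝ} (hα : α ∈ Ioo (0 : ℝ) 1)
    (hβ : β ∈ Ico α 1) (hlam : 0 < lam) (hd : 5 ≤ d) (hs : 0 ≤ s) (hM : 0 ≤ M) :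
    ∃ C, ∀ x ∈ Ioo (0 : ℝ) 1, ∀ Θ Θ₁ u w q : ℝ, 0 ≤ Θ → Θ ≤ B → |Θ₁| ≤ B → |w| ≤ M →
      |u| ≤ M * x ^ (1 - α) → |q| ≤ M * x ^ (1 - α) →
      |carlemanFlux α β lam d m s Θ Θ₁ x u w q| ≤ C * x ^ (1 - β) := by
  obtain ⟨hα0, hα1⟩ := hα
  obtain ⟨hβα, hβ1⟩ := hβ
  set c := lam * (2 - β) with hc
  have hc0 : 0 < c := mul_pos hlam (by linarith)
  have hd0 : 0 < d := by linarith
  have hab : 0 ≤ 1 + α - β := by linarith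
  refine ⟨(M + s * (c * B) * M) * (M + s * (B * (lam * d)) * M) + s * (c * B) * (M + s * (c * B) * M) ^ 2
    + s * (c * (1 + α - β) * B) * ((M + s * (c * B) * M) * M)
    + s * ((s ^ 2 * c ^ 2 * B ^ 2 + s * B * (lam * d)) * (c * B)) * M ^ 2
    + s * |m| * c * B * M ^ 2, fun x hx Θ Θ₁ u w q hΘ hΘB hΘ₁ hw hu hq => ?_⟩
  have hB : 0 ≤ B := hΘ.trans hΘB
  have hxI := Ioo_subset_Icc_self hx
  obtain ⟨hx0, hx1⟩ := hx
  set a := x ^ α with ha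
  set e := x ^ (-β) with he
  set ψ := lam * (x ^ (2 - β) - d) with hψ
  set E := weight β lam d s Θ x with hE
  have hψd : |ψ| ≤ lam * d := (psi_bounds hβ1 hlam hd hxI).2
  have hE0 : 0 ≤ E := (Real.exp_pos _).le
  have hE1 : E ≤ 1 := weight_le_one hβ1 hlam hd hs hΘ hxI
  have ha0 : 0 < a := Real.rpow_pos_of_pos hx0 _
  have he0 : 0 < e := Real.rpow_pos_of_pos hx0 _
  have ha1 : a ≤ 1 := Real.rpow_le_one hx0.le hx1.le hα0.le
  have hy : x ^ (1 - β) = e * x := rpow_one_sub hx0 β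
  rw [hy]
  set y := e * x with hydef
  have hy0 : 0 < y := by positivity
  have hy1 : y ≤ 1 := by rw [← hy]; exact Real.rpow_le_one hx0.le hx1.le (by linarith)
  have hxa : x ^ (1 - α) * a = x := by
    rw [ha, ← Real.rpow_add hx0]; norm_num
  have hxy : x ^ (1 - α) ≤ y := by
    rw [← hy]; exact Real.rpow_le_rpow_of_exponent_ge hx0 hx1.le (by linarith)
  have huy : |u| ≤ M * y := hu.trans (by gcongr)
  have hqy : |q| ≤ M * y := hq.trans (by gcongr)
  -- The coefficients x^{α-β} and x^{2α-β-1} of the flux may be unbounded at 0. They are compensated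
  -- by x^α|u| ≤ Mx, which leaves at least a factor y = x^{1-β} in each of these terms (`haeZ`,
  -- `hg`).
  have hau : a * |u| ≤ M * x := by
    calc a * |u| ≤ a * (M * x ^ (1 - α)) := by gcongr
      _ = M * (x ^ (1 - α) * a) := by ring
      _ = M * x := by rw [hxa]
  have huM : |u| ≤ M := huy.trans (mul_le_of_le_one_right hM hy1)
  have hA : |c * Θ * (a * e * x)| ≤ c * B := by
    rw [abs_of_nonneg (by positivity)]
    have : a * e * x ≤ 1 := by rw [mul_assoc]; exact mul_le_one₀ ha1 hy0.le hy1
    calc c * Θ * (a * e * x) ≤ c * B * 1 := by gcongr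
      _ = _ := mul_one _
  have hW : |E * (w + s * (c * Θ * (a * e * x)) * u)| ≤ M + s * (c * B) * M := by
    rw [abs_mul, abs_of_nonneg hE0]
    calc E * |w + s * (c * Θ * (a * e * x)) * u|
        ≤ 1 * (|w| + |s * (c * Θ * (a * e * x)) * u|) := by gcongr; exact abs_add_le _ _
      _ ≤ 1 * (M + s * (c * B) * M) := by
        rw [abs_mul, abs_mul, abs_of_nonneg hs]; gcongr
      _ = _ := one_mul _
  have hH : |E * (q + s * (Θ₁ * ψ) * u)| ≤ (M + s * (B * (lam * d)) * M) * y := by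
    rw [abs_mul, abs_of_nonneg hE0]
    calc E * |q + s * (Θ₁ * ψ) * u|
        ≤ 1 * (|q| + |s * (Θ₁ * ψ) * u|) := by gcongr; exact abs_add_le _ _
      _ ≤ 1 * (M * y + s * (B * (lam * d)) * (M * y)) := by
        rw [abs_mul, abs_mul, abs_mul, abs_of_nonneg hs]; gcongr
      _ = _ := by ring
  have hφ : |s * (c * Θ * (e * x))| ≤ s * (c * B) * y := by
    rw [abs_of_nonneg (by positivity), ← hydef]
    calc s * (c * Θ * y) ≤ s * (c * B * y) := by gcongr
      _ = _ := by ring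
  have haeZ : |a * e * (E * u)| ≤ M * y := by
    rw [abs_mul, abs_mul E, abs_of_nonneg hE0, abs_of_pos (by positivity)]
    calc a * e * (E * |u|) ≤ a * e * (1 * |u|) := by gcongr
      _ = e * (a * |u|) := by ring
      _ ≤ e * (M * x) := by gcongr
      _ = M * y := by rw [hydef]; ring
  have hV : |s ^ 2 * c ^ 2 * Θ ^ 2 * (a * e ^ 2 * x ^ 2) + s * Θ₁ * ψ|
      ≤ s ^ 2 * c ^ 2 * B ^ 2 + s * B * (lam * d) := by
    refine (abs_add_le _ _).trans ?_
    rw [abs_of_nonneg (show 0 ≤ s ^ 2 * c ^ 2 * Θ ^ 2 * (a * e ^ 2 * x ^ 2) by positivity),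
      abs_mul, abs_mul, abs_of_nonneg hs]
    have h1 : a * e ^ 2 * x ^ 2 ≤ 1 := by
      have : a * e ^ 2 * x ^ 2 = a * y ^ 2 := by rw [hydef]; ring
      rw [this]; exact mul_le_one₀ ha1 (by positivity) (pow_le_one₀ hy0.le hy1)
    have h2 : s ^ 2 * c ^ 2 * Θ ^ 2 * (a * e ^ 2 * x ^ 2) ≤ s ^ 2 * c ^ 2 * B ^ 2 * 1 := by gcongr
    rw [mul_one] at h2
    gcongr
  have hZ : |E * u| ≤ M * y := by
    rw [abs_mul, abs_of_nonneg hE0]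
    calc E * |u| ≤ 1 * |u| := by gcongr
      _ ≤ _ := by rwa [one_mul]
  have hZ2 : |(E * u) ^ 2| ≤ M ^ 2 * y := by
    rw [abs_pow]
    calc |E * u| ^ 2 ≤ (M * y) ^ 2 := by gcongr
      _ = M ^ 2 * (y * y) := by ring
      _ ≤ M ^ 2 * (y * 1) := by gcongr
      _ = _ := by ring
  have hg : |a ^ 2 * e / x * (E * u) ^ 2| ≤ M ^ 2 * y := by
    rw [abs_of_nonneg (by positivity)]
    have h1 : a * |E * u| ≤ M * x := by
      rw [abs_mul, abs_of_nonneg hE0]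
      calc a * (E * |u|) ≤ a * (1 * |u|) := by gcongr
        _ ≤ _ := by rwa [one_mul]
    calc a ^ 2 * e / x * (E * u) ^ 2 = e / x * (a * |E * u|) ^ 2 := by
          rw [mul_pow a, sq_abs]; ring
      _ ≤ e / x * (M * x) ^ 2 := by gcongr
      _ = M ^ 2 * y := by rw [hydef]; field_simp
  have T1 : |E * (w + s * (c * Θ * (a * e * x)) * u) * (E * (q + s * (Θ₁ * ψ) * u))|
      ≤ (M + s * (c * B) * M) * ((M + s * (B * (lam * d)) * M) * y) := by
    rw [abs_mul]; gcongr
  have T2 : |s * (c * Θ * (e * x)) * (E * (w + s * (c * Θ * (a * e * x)) * u)) ^ 2|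
      ≤ s * (c * B) * y * (M + s * (c * B) * M) ^ 2 := by
    rw [abs_mul, abs_pow]; gcongr
  have T3 : |s * (c * (1 + α - β) * Θ * (a * e))
      * (E * (w + s * (c * Θ * (a * e * x)) * u) * (E * u))|
      ≤ s * (c * (1 + α - β) * B) * ((M + s * (c * B) * M) * (M * y)) := by
    have : s * (c * (1 + α - β) * Θ * (a * e))
      * (E * (w + s * (c * Θ * (a * e * x)) * u) * (E * u)) =
      s * (c * (1 + α - β) * Θ) * (E * (w + s * (c * Θ * (a * e * x)) * u) * (a * e * (E * u))) := by
      ring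
    rw [this, abs_mul, abs_of_nonneg (show 0 ≤ s * (c * (1 + α - β) * Θ) by positivity), abs_mul]
    gcongr
  have T4 : |s * ((s ^ 2 * c ^ 2 * Θ ^ 2 * (a * e ^ 2 * x ^ 2) + s * Θ₁ * ψ)
        * (c * Θ * (a * e * x))) * (E * u) ^ 2|
      ≤ s * ((s ^ 2 * c ^ 2 * B ^ 2 + s * B * (lam * d)) * (c * B)) * (M ^ 2 * y) := by
    rw [abs_mul, abs_mul, abs_mul, abs_of_nonneg hs]; gcongr
  have T5 : |s * m * c * Θ * (a ^ 2 * e / x) * (E * u) ^ 2| ≤ s * |m| * c * B * (M ^ 2 * y) := by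
    rw [mul_assoc _ (a ^ 2 * e / x), abs_mul, abs_mul, abs_mul, abs_mul, abs_of_nonneg hs,
      abs_of_pos hc0, abs_of_nonneg hΘ]
    gcongr
  unfold carlemanFlux
  rw [← hc, ← ha, ← he, ← hψ, ← hE]
  rw [abs_le] at T1 T2 T3 T4 T5 ⊢
  constructor <;> linarith [T1.1, T1.2, T2.1, T2.2, T3.1, T3.2, T4.1, T4.2, T5.1, T5.2]

theorem contDiffOn_rpow {η : ℝ} (hη : η ∈ Ioo (0 : ℝ) 1) (γ : ℝ) :
    ContDiffOn ℝ 1 (fun x : ℝ => x ^ γ) (uIcc η 1) := by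
  refine contDiffOn_id.rpow_const_of_ne fun x hx => ?_
  rw [uIcc_of_le hη.2.le] at hx
  exact (hη.1.trans_le hx.1).ne'

theorem ac_carlemanFlux {η : ℝ} (hη : η ∈ Ioo (0 : ℝ) 1) (α β lam d m s Θ Θ₁ : ℝ) {u w q : ℝ → ℝ}
    (hu : AbsolutelyContinuousOnInterval u η 1) (hw : AbsolutelyContinuousOnInterval w η 1)
    (hq : AbsolutelyContinuousOnInterval q η 1) :
    AbsolutelyContinuousOnInterval
      (fun x => carlemanFlux α β lam d m s Θ Θ₁ x (u x) (w x) (q x)) η 1 := by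
  have ha := (contDiffOn_rpow hη α).absolutelyContinuousOnInterval
  have he := (contDiffOn_rpow hη (-β)).absolutelyContinuousOnInterval
  have hx : AbsolutelyContinuousOnInterval (fun x : ℝ => x) η 1 :=
    contDiffOn_id.absolutelyContinuousOnInterval
  have hinv : AbsolutelyContinuousOnInterval (fun x : ℝ => x⁻¹) η 1 := by
    refine ContDiffOn.absolutelyContinuousOnInterval (contDiffOn_id.inv fun x hx => ?_)
    rw [uIcc_of_le hη.2.le] at hx
    exact (hη.1.trans_le hx.1).ne'
  have hψc : ContDiffOn ℝ 1 (fun x : ℝ => lam * (x ^ (2 - β) - d)) (uIcc η 1) :=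
    contDiffOn_const.mul ((contDiffOn_rpow hη (2 - β)).sub contDiffOn_const)
  have hψ := hψc.absolutelyContinuousOnInterval
  have hE : AbsolutelyContinuousOnInterval (weight β lam d s Θ) η 1 :=
    (contDiffOn_const.mul (contDiffOn_const.mul hψc)).exp.absolutelyContinuousOnInterval
  have sq : ∀ {f : ℝ → ℝ}, AbsolutelyContinuousOnInterval f η 1 →
      AbsolutelyContinuousOnInterval (fun x => f x ^ 2) η 1 := fun {f} hf => by
    simp only [pow_two]; exact hf.fun_mul hf
  have hA := ((ha.fun_mul he).fun_mul hx).const_mul (lam * (2 - β) * Θ)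
  have hW := hE.fun_mul (hw.fun_add ((hA.const_mul s).fun_mul hu))
  have hH := hE.fun_mul (hq.fun_add (((hψ.const_mul Θ₁).const_mul s).fun_mul hu))
  have hZ := hE.fun_mul hu
  have hV := (((ha.fun_mul (sq he)).fun_mul (sq hx)).const_mul
    (s ^ 2 * (lam * (2 - β)) ^ 2 * Θ ^ 2)).fun_add (hψ.const_mul (s * Θ₁))
  have hg := ((((sq ha).fun_mul he).fun_mul hinv).const_mul (s * m * (lam * (2 - β)) * Θ)).fun_mul
    (sq hZ)
  have := (((((hW.fun_mul hH).fun_neg).fun_sub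
    ((((he.fun_mul hx).const_mul (lam * (2 - β) * Θ)).const_mul s).fun_mul (sq hW))).fun_sub
    ((((ha.fun_mul he).const_mul (lam * (2 - β) * (1 + α - β) * Θ)).const_mul s).fun_mul
      (hW.fun_mul hZ))).fun_sub (((hV.fun_mul hA).const_mul s).fun_mul (sq hZ))).fun_add hg
  simpa only [carlemanFlux, div_eq_mul_inv] using this

/-! ### The Carleman estimate for regular solutions -/

/-- The weighted density of `interiorTerm` for the values `u` and `p` of `y` and `y_x`. -/
def carlemanDensity (T α β k lam d s t x u p : ℝ) : ℝ :=
  (s * Theta T k t * x ^ (2 * α - β) * p ^ 2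
      + s ^ 3 * Theta T k t ^ 3 * x ^ (2 + 2 * α - 3 * β) * u ^ 2)
    * Real.exp (2 * s * phi T k β lam d t x)

theorem rpow_carleman_exponents {x : ℝ} (hx : 0 < x) (α β : ℝ) :
    x ^ (2 * α - β) = (x ^ α) ^ 2 * x ^ (-β) ∧
      x ^ (2 + 2 * α - 3 * β) = x ^ 2 * (x ^ α) ^ 2 * (x ^ (-β)) ^ 3 := by
  have h : ∀ γ : ℝ, ∀ n : ℕ, (x ^ γ) ^ n = x ^ (γ * n) := fun γ n => by
    rw [Real.rpow_mul hx.le, Real.rpow_natCast]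
  constructor
  · rw [h, ← Real.rpow_add hx]; congr 1; push_cast; ring
  · rw [h, h, ← Real.rpow_natCast x 2, ← Real.rpow_add hx, ← Real.rpow_add hx]
    congr 1; push_cast; ring

/-- The Carleman form controls the weighted density of the solution itself. -/
theorem exists_carlemanDensity_le {T α β k lam d : ℝ} (hT : 0 < T) (hα : α ∈ Ioo (0 : ℝ) 1)
    (hβ : β ∈ Ico α 1) (hk : 4 ≤ k) (hlam : 0 < lam) (hd : 5 ≤ d) :
    ∃ m κ s₀ : ℝ, 0 < κ ∧ 1 ≤ s₀ ∧ ∀ s t x u p : ℝ, s₀ ≤ s → t ∈ Ioo 0 T → x ∈ Ioo (0 : ℝ) 1 →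
      κ * carlemanDensity T α β k lam d s t x u p ≤
        carlemanForm α β lam m s (Theta T k t) (thetaDeriv T k t) (thetaDeriv₂ T k t)
          (lam * (x ^ (2 - β) - d)) (x ^ α) (x ^ (-β)) x
          (weight β lam d s (Theta T k t) x * u)
          (weight β lam d s (Theta T k t) x *
            (p + s * (lam * (2 - β) * Theta T k t * (x ^ (-β) * x)) * u)) := by
  obtain ⟨C₀, hC₀, hΘ⟩ := exists_theta_bounds hT hk
  obtain ⟨m, κ, s₀, hκ, hs₀, H⟩ := exists_carlemanForm_coercive hα hβ hlam
    (show 0 ≤ d by linarith) hC₀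
  set c := lam * (2 - β) with hc
  -- Going back from Z_x to u_x: the square of e^{sφ}u_x = Z_x - sφ_x Z is at most 2Z_x² +
  -- 2s²φ_x²Z², and the weighted second term is 2c² times the cubic term in s. The cubic term
  -- already present adds 1.
  refine ⟨m, κ / (2 * c ^ 2 + 2), s₀, by positivity, hs₀, fun s t x u p hs ht hx => ?_⟩
  have hΘ0 := theta_pos (k := k) ht
  obtain ⟨-, hΘ1, hΘ2⟩ := hΘ t ht
  have hae : 1 ≤ x ^ α * x ^ (-β) := by
    rw [← Real.rpow_add hx.1]
    exact Real.one_le_rpow_of_pos_of_le_one_of_nonpos hx.1 hx.2.le (by linarith [hβ.1])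
  refine le_trans ?_ (H s (Theta T k t) (thetaDeriv T k t) (thetaDeriv₂ T k t) _ (x ^ α) (x ^ (-β)) x
    _ _ hs hΘ0 hΘ1 hΘ2 (psi_bounds hβ.2 hlam hd (Ioo_subset_Icc_self hx)).2
    (Real.rpow_pos_of_pos hx.1 _) (Real.rpow_pos_of_pos hx.1 _) hae hx.1)
  unfold carlemanDensity
  rw [(rpow_carleman_exponents hx.1 α β).1, (rpow_carleman_exponents hx.1 α β).2,
    ← weight_sq_eq]
  have ha0 : 0 < x ^ α := Real.rpow_pos_of_pos hx.1 _
  have he0 : 0 < x ^ (-β) := Real.rpow_pos_of_pos hx.1 _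
  set a := x ^ α
  set e := x ^ (-β)
  set Θ := Theta T k t
  set E := weight β lam d s Θ x
  have hs0 : 0 < s := by linarith
  have hx0 := hx.1
  rw [div_mul_eq_mul_div, div_le_iff₀ (by positivity), mul_assoc κ _ (2 * c ^ 2 + 2)]
  refine mul_le_mul_of_nonneg_left ?_ hκ.le
  set Zx := E * (p + s * (c * Θ * (e * x)) * u) with hZx
  have hEp : E * p = Zx - s * (c * Θ * (e * x)) * (E * u) := by rw [hZx]; ring
  have h1 : (E * p) ^ 2 ≤ 2 * Zx ^ 2 + 2 * (s * (c * Θ * (e * x)) * (E * u)) ^ 2 := by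
    rw [hEp]; nlinarith [sq_nonneg (Zx + s * (c * Θ * (e * x)) * (E * u))]
  have h2 : s * Θ * (a ^ 2 * e) * (E * p) ^ 2 ≤
      s * Θ * (a ^ 2 * e) * (2 * Zx ^ 2 + 2 * (s * (c * Θ * (e * x)) * (E * u)) ^ 2) := by gcongr
  have h3 : 0 ≤ s * Θ * (a ^ 2 * e) * Zx ^ 2 * c ^ 2 := by positivity
  have h4 : 0 ≤ s ^ 3 * Θ ^ 3 * (x ^ 2 * a ^ 2 * e ^ 3) * (E * u) ^ 2 := by positivity
  calc (s * Θ * (a ^ 2 * e) * p ^ 2 + s ^ 3 * Θ ^ 3 * (x ^ 2 * a ^ 2 * e ^ 3) * u ^ 2) * E ^ 2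
      = s * Θ * (a ^ 2 * e) * (E * p) ^ 2
        + s ^ 3 * Θ ^ 3 * (x ^ 2 * a ^ 2 * e ^ 3) * (E * u) ^ 2 := by ring
    _ ≤ s * Θ * (a ^ 2 * e) * (2 * Zx ^ 2 + 2 * (s * (c * Θ * (e * x)) * (E * u)) ^ 2)
        + s ^ 3 * Θ ^ 3 * (x ^ 2 * a ^ 2 * e ^ 3) * (E * u) ^ 2 := by gcongr
    _ = 2 * (s * Θ * (a ^ 2 * e) * Zx ^ 2)
        + (2 * c ^ 2 + 1) * (s ^ 3 * Θ ^ 3 * (x ^ 2 * a ^ 2 * e ^ 3) * (E * u) ^ 2) := by ring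
    _ ≤ _ := by linarith

/-- With u = u_t = 0 at x = 1 only the square of the flux x^α u_x survives. Its sign is negative
because φ increases in x, so the boundary term moves to the right-hand side of the estimate. -/
theorem carlemanFlux_one (α β lam d m s Θ Θ₁ w : ℝ) :
    carlemanFlux α β lam d m s Θ Θ₁ 1 0 w 0 =
      -(lam * (2 - β) * (s * Θ * w ^ 2 * weight β lam d s Θ 1 ^ 2)) := by
  simp only [carlemanFlux, Real.one_rpow]; ring

theorem exists_theta_le_on_Icc {T k t₀ t₁ : ℝ} (h0 : 0 < t₀) (h1 : t₁ < T) :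
    ∃ B, ∀ t ∈ Icc t₀ t₁, Theta T k t ≤ B := by
  have hsub : Icc t₀ t₁ ⊆ Ioo 0 T := fun t ht => ⟨h0.trans_le ht.1, ht.2.trans_lt h1⟩
  obtain ⟨B, hB⟩ := isCompact_Icc.exists_bound_of_continuousOn (s := Icc t₀ t₁) (f := Theta T k)
    fun t ht => (hasDerivAt_theta (hsub ht)).continuousAt.continuousWithinAt
  exact ⟨B, fun t ht => (le_abs_self _).trans (hB t ht)⟩

theorem measurable_carlemanFlux {α β lam d m s : ℝ} {Θ Θ₁ u w q : ℝ → ℝ} (hΘ : Measurable Θ)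
    (hΘ₁ : Measurable Θ₁) (hu : Measurable u) (hw : Measurable w) (hq : Measurable q) (x : ℝ) :
    Measurable fun t => carlemanFlux α β lam d m s (Θ t) (Θ₁ t) x (u t) (w t) (q t) := by
  unfold carlemanFlux weight; fun_prop

theorem measurable_carlemanDensity {T α β k lam d s : ℝ} {t x u p : ℝ × ℝ → ℝ}
    (ht : Measurable t) (hx : Measurable x) (hu : Measurable u) (hp : Measurable p) :
    Measurable fun z => carlemanDensity T α β k lam d s (t z) (x z) (u z) (p z) := by
  have := (measurable_theta T k).comp ht
  unfold carlemanDensity phi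
  simp only [Function.comp_def] at this
  fun_prop

theorem measurable_weight_theta (T k β lam d s : ℝ) :
    Measurable fun z : ℝ × ℝ => weight β lam d s (Theta T k z.1) z.2 := by
  have h : Measurable fun z : ℝ × ℝ => Theta T k z.1 := (measurable_theta T k).comp measurable_fst
  unfold weight; fun_prop

/-- Closure of L^∞ under products, sums and differences, in a form that can be applied along the
syntax of the long polynomial expressions on strips. -/
theorem memLp_top_mul {μ : Measure (ℝ × ℝ)} {f g : ℝ × ℝ → ℝ} (hf : MemLp f ⊤ μ) (hg : MemLp g ⊤ μ) :
    MemLp (fun z => f z * g z) ⊤ μ := hg.mul hf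

theorem memLp_top_add {μ : Measure (ℝ × ℝ)} {f g : ℝ × ℝ → ℝ} (hf : MemLp f ⊤ μ) (hg : MemLp g ⊤ μ) :
    MemLp (fun z => f z + g z) ⊤ μ := hf.add hg

theorem memLp_top_sub {μ : Measure (ℝ × ℝ)} {f g : ℝ × ℝ → ℝ} (hf : MemLp f ⊤ μ) (hg : MemLp g ⊤ μ) :
    MemLp (fun z => f z - g z) ⊤ μ := hf.sub hg

theorem memLp_top_of_bounded {μ : Measure (ℝ × ℝ)} {f : ℝ × ℝ → ℝ} (hf : Measurable f) {C : ℝ}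
    (h : ∀ᵐ z ∂μ, |f z| ≤ C) : MemLp f ⊤ μ :=
  memLp_top_of_bound hf.aestronglyMeasurable C h

theorem carlemanDensity_nonneg {T α β k lam d s t x u p : ℝ} (hs : 0 ≤ s) (ht : t ∈ Ioo 0 T)
    (hx : 0 ≤ x) : 0 ≤ carlemanDensity T α β k lam d s t x u p := by
  have h1 := (theta_pos (k := k) ht).le
  have h2 := Real.rpow_nonneg hx (2 * α - β)
  have h3 := Real.rpow_nonneg hx (2 + 2 * α - 3 * β)
  unfold carlemanDensity
  positivity

theorem abs_rpow_le_of_strip {η x : ℝ} (hη : 0 < η) (hx : x ∈ Ioo η 1) (γ : ℝ) :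
    |x ^ γ| ≤ 1 + η ^ γ := by
  have hx0 : 0 < x := hη.trans hx.1
  rw [abs_of_pos (Real.rpow_pos_of_pos hx0 γ)]
  have h1 := Real.rpow_pos_of_pos hη γ
  rcases le_total 0 γ with h | h
  · linarith [Real.rpow_le_one hx0.le hx.2.le h]
  · linarith [Real.rpow_le_rpow_of_nonpos hη hx.1.le h]

namespace RegularSolution

variable {α t₀ t₁ : ℝ} {u p q r w F : ℝ → ℝ → ℝ}

/-- All functions entering the Carleman computation are essentially bounded on the strips
`x > η`. -/
theorem memLp_top_strip (h : RegularSolution α t₀ t₁ u p q r w F) (hα : α ∈ Ioo (0 : ℝ) 1)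
    {η : ℝ} (hη : η ∈ Ioo (0 : ℝ) 1) :
    MemLp (fun z : ℝ × ℝ => u z.1 z.2) ⊤ ((volume.restrict (Ioo t₀ t₁)).prod (volume.restrict (Ioo η 1))) ∧
    MemLp (fun z : ℝ × ℝ => p z.1 z.2) ⊤ ((volume.restrict (Ioo t₀ t₁)).prod (volume.restrict (Ioo η 1))) ∧
    MemLp (fun z : ℝ × ℝ => q z.1 z.2) ⊤ ((volume.restrict (Ioo t₀ t₁)).prod (volume.restrict (Ioo η 1))) ∧
    MemLp (fun z : ℝ × ℝ => r z.1 z.2) ⊤ ((volume.restrict (Ioo t₀ t₁)).prod (volume.restrict (Ioo η 1))) ∧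
    ∀ γ : ℝ, MemLp (fun z : ℝ × ℝ => z.2 ^ γ) ⊤
      ((volume.restrict (Ioo t₀ t₁)).prod (volume.restrict (Ioo η 1))) := by
  obtain ⟨M, hM0, hw, hp, hr, hu, hq⟩ := h.exists_bounds hα
  have hle : ∀ x ∈ Icc (0 : ℝ) 1, M * x ^ (1 - α) ≤ M := fun x hx =>
    mul_le_of_le_one_right hM0 (Real.rpow_le_one hx.1 hx.2 (by linarith [hα.2]))
  have bp := ae_strip_bound (t₀ := t₀) (t₁ := t₁) h.meas_p hM0 hα.1 hp hη.1
  have br := ae_strip_bound (t₀ := t₀) (t₁ := t₁) h.meas_r hM0 hα.1 hr hη.1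
  have hI : ∀ z : ℝ × ℝ, z ∈ Ioo t₀ t₁ ×ˢ Ioo η 1 → z.2 ∈ Icc (0 : ℝ) 1 := fun z hz =>
    ⟨(hη.1.trans hz.2.1).le, hz.2.2.le⟩
  refine ⟨memLp_top_of_bounded h.meas_u (C := M) (bp.mono fun z hz => ?_),
    memLp_top_of_bounded h.meas_p (bp.mono fun z hz => hz.2),
    memLp_top_of_bounded h.meas_q (C := M) (bp.mono fun z hz => ?_),
    memLp_top_of_bounded h.meas_r (br.mono fun z hz => hz.2),
    fun γ => memLp_top_of_bounded (measurable_snd.pow_const γ)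
      (bp.mono fun z hz => abs_rpow_le_of_strip hη.1 hz.1.2 γ)⟩
  · exact (hu _ _ (hI z hz.1)).trans (hle _ (hI z hz.1))
  · exact (hq _ _ (hI z hz.1)).trans (hle _ (hI z hz.1))

theorem memLp_top_time {T k β lam d s : ℝ} (hβ : β < 1) (hlam : 0 < lam) (hd : 5 ≤ d) (hs : 0 ≤ s)
    (hT : 0 < T) (hk : 4 ≤ k) (h0 : 0 < t₀) (h1 : t₁ < T) {η : ℝ} (hη : η ∈ Ioo (0 : ℝ) 1) :
    MemLp (fun z : ℝ × ℝ => Theta T k z.1) ⊤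
      ((volume.restrict (Ioo t₀ t₁)).prod (volume.restrict (Ioo η 1))) ∧
    MemLp (fun z : ℝ × ℝ => thetaDeriv T k z.1) ⊤
      ((volume.restrict (Ioo t₀ t₁)).prod (volume.restrict (Ioo η 1))) ∧
    MemLp (fun z : ℝ × ℝ => thetaDeriv₂ T k z.1) ⊤
      ((volume.restrict (Ioo t₀ t₁)).prod (volume.restrict (Ioo η 1))) ∧
    MemLp (fun z : ℝ × ℝ => weight β lam d s (Theta T k z.1) z.2) ⊤
      ((volume.restrict (Ioo t₀ t₁)).prod (volume.restrict (Ioo η 1))) := by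
  obtain ⟨B, hB⟩ := exists_theta_le_on_Icc (k := k) h0 h1
  obtain ⟨C₀, hC₀, hΘ⟩ := exists_theta_bounds hT hk
  have hmem : ∀ᵐ z ∂((volume.restrict (Ioo t₀ t₁)).prod (volume.restrict (Ioo η 1))),
      z ∈ Ioo t₀ t₁ ×ˢ Ioo η 1 := by
    rw [Measure.prod_restrict]
    exact ae_restrict_mem (measurableSet_Ioo.prod measurableSet_Ioo)
  have hb : ∀ z : ℝ × ℝ, z ∈ Ioo t₀ t₁ ×ˢ Ioo η 1 →
      0 < Theta T k z.1 ∧ Theta T k z.1 ≤ B ∧ |thetaDeriv T k z.1| ≤ C₀ * B ^ 2 ∧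
      |thetaDeriv₂ T k z.1| ≤ C₀ * B ^ 2 := fun z hz => by
    have ht : z.1 ∈ Ioo 0 T := ⟨h0.trans hz.1.1, hz.1.2.trans h1⟩
    have hp := theta_pos (k := k) ht
    have hBz := hB z.1 (Ioo_subset_Icc_self hz.1)
    have hsq : C₀ * Theta T k z.1 ^ 2 ≤ C₀ * B ^ 2 := by gcongr
    exact ⟨hp, hBz, (hΘ _ ht).2.1.trans hsq, (hΘ _ ht).2.2.trans hsq⟩
  refine ⟨memLp_top_of_bounded ((measurable_theta T k).comp measurable_fst) (C := B)
      (hmem.mono fun z hz => ?_),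
    memLp_top_of_bounded ((measurable_thetaDeriv T k).comp measurable_fst) (C := C₀ * B ^ 2)
      (hmem.mono fun z hz => (hb z hz).2.2.1),
    memLp_top_of_bounded ((measurable_thetaDeriv₂ T k).comp measurable_fst) (C := C₀ * B ^ 2)
      (hmem.mono fun z hz => (hb z hz).2.2.2),
    memLp_top_of_bounded ?_ (C := 1) (hmem.mono fun z hz => ?_)⟩
  · rw [abs_of_pos (hb z hz).1]; exact (hb z hz).2.1
  · exact measurable_weight_theta T k β lam d s
  · rw [abs_of_pos (show 0 < weight β lam d s (Theta T k z.1) z.2 from Real.exp_pos _)]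
    exact weight_le_one hβ hlam hd hs (hb z hz).1.le ⟨(hη.1.trans hz.2.1).le, hz.2.2.le⟩

theorem integrable_energyDeriv (h : RegularSolution α t₀ t₁ u p q r w F) (hα : α ∈ Ioo (0 : ℝ) 1)
    {T k β lam d s : ℝ} (hβ : β < 1) (hlam : 0 < lam) (hd : 5 ≤ d) (hs : 0 ≤ s)
    (hT : 0 < T) (hk : 4 ≤ k) (h0 : 0 < t₀) (h1 : t₁ < T) {η : ℝ} (hη : η ∈ Ioo (0 : ℝ) 1) :
    Integrable (fun z : ℝ × ℝ => carlemanEnergyDeriv α β lam d s (Theta T k z.1) (thetaDeriv T k z.1)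
      (thetaDeriv₂ T k z.1) z.2 (u z.1 z.2) (p z.1 z.2) (q z.1 z.2) (r z.1 z.2))
      ((volume.restrict (Ioo t₀ t₁)).prod (volume.restrict (Ioo η 1))) := by
  obtain ⟨bu, bp, bq, br, bx⟩ := h.memLp_top_strip hα hη
  obtain ⟨bΘ, bΘ₁, bΘ₂, bE⟩ := RegularSolution.memLp_top_time hβ hlam hd hs hT hk h0 h1 hη
  have b1 := bx 1
  have bc : ∀ a : ℝ, MemLp (fun _ : ℝ × ℝ => a) ⊤
    ((volume.restrict (Ioo t₀ t₁)).prod (volume.restrict (Ioo η 1))) := fun a =>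
    memLp_top_const a
  simp only [Real.rpow_one] at b1
  refine MemLp.integrable (q := ⊤) le_top ?_
  simp only [carlemanEnergyDeriv, pow_succ, pow_zero, one_mul, div_eq_mul_inv]
  repeat' first
    | exact bc _ | exact bx _ | exact b1 | exact bu | exact bp | exact bq | exact br
    | exact bΘ | exact bΘ₁ | exact bΘ₂ | exact bE
    | apply memLp_top_sub | apply memLp_top_add | apply memLp_top_mul

theorem integrable_density (h : RegularSolution α t₀ t₁ u p q r w F) (hα : α ∈ Ioo (0 : ℝ) 1)
    {T k β lam d s : ℝ} (hβ : β < 1) (hlam : 0 < lam) (hd : 5 ≤ d) (hs : 0 ≤ s)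
    (hT : 0 < T) (hk : 4 ≤ k) (h0 : 0 < t₀) (h1 : t₁ < T) {η : ℝ} (hη : η ∈ Ioo (0 : ℝ) 1) :
    Integrable (fun z : ℝ × ℝ => carlemanDensity T α β k lam d s z.1 z.2 (u z.1 z.2) (p z.1 z.2))
      ((volume.restrict (Ioo t₀ t₁)).prod (volume.restrict (Ioo η 1))) := by
  obtain ⟨bu, bp, -, -, bx⟩ := h.memLp_top_strip hα hη
  obtain ⟨bΘ, -, -, bE⟩ := RegularSolution.memLp_top_time hβ hlam hd hs hT hk h0 h1 hη
  have bc : ∀ a : ℝ, MemLp (fun _ : ℝ × ℝ => a) ⊤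
    ((volume.restrict (Ioo t₀ t₁)).prod (volume.restrict (Ioo η 1))) := fun a =>
    memLp_top_const a
  refine MemLp.integrable (q := ⊤) le_top ?_
  simp only [carlemanDensity, ← weight_sq_eq, pow_succ, pow_zero, one_mul]
  repeat' first
    | exact bc _ | exact bx _ | exact bu | exact bp | exact bΘ | exact bE
    | apply memLp_top_add | apply memLp_top_mul

end RegularSolution

set_option maxHeartbeats 400000 in
/-- The Carleman estimate for solutions that are smooth in time. -/
theorem exists_carleman_regular {T α β k lam d : ℝ} (hT : 0 < T) (hα : α ∈ Ioo (0 : ℝ) 1)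
    (hβ : β ∈ Ico α 1) (hk : 4 ≤ k) (hlam : 0 < lam) (hd : 5 ≤ d) :
    ∃ C s₀ : ℝ, 0 < C ∧ 0 < s₀ ∧ ∀ (t₀ t₁ : ℝ) (u p q r w F : ℝ → ℝ → ℝ), 0 < t₀ → t₀ ≤ t₁ →
      t₁ < T → RegularSolution α t₀ t₁ u p q r w F → ∀ s, s₀ ≤ s →
      ∫⁻ z, ENNReal.ofReal (carlemanDensity T α β k lam d s z.1 z.2 (u z.1 z.2) (p z.1 z.2))
          ∂((volume.restrict (Ioo t₀ t₁)).prod unitVol) ≤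
        ENNReal.ofReal (C * ((∫ z, F z.1 z.2 ^ 2 * Real.exp (2 * s * phi T k β lam d z.1 z.2)
            ∂((volume.restrict (Ioo t₀ t₁)).prod unitVol))
          + ∫ t in Ioo t₀ t₁, s * Theta T k t * w t 1 ^ 2
              * Real.exp (2 * s * phi T k β lam d t 1))) := by
  obtain ⟨m, κ, s₀, hκ, hs₀, H⟩ := exists_carlemanDensity_le hT hα hβ hk hlam hd
  set c := lam * (2 - β) with hc
  have hc0 : 0 < c := mul_pos hlam (by linarith [hβ.2])
  -- The factor c comes from the flux at x = 1, the 1 dominates the coefficient 1/4 of the source,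
  -- and κ is the coercivity constant.
  refine ⟨(1 + c) / κ, s₀, by positivity, by linarith, ?_⟩
  intro t₀ t₁ u p q r w F ht₀ ht ht₁ h s hs
  have hs0 : 0 < s := by linarith
  obtain ⟨M, hM0, hw, hp, hr, hu, hq⟩ := h.exists_bounds hα
  obtain ⟨B, hB⟩ := exists_theta_le_on_Icc (k := k) ht₀ ht₁
  obtain ⟨C₀, hC₀, hΘ⟩ := exists_theta_bounds hT hk
  have hsub : ∀ t ∈ Icc t₀ t₁, t ∈ Ioo 0 T := fun t ht => ⟨ht₀.trans_le ht.1, ht.2.trans_lt ht₁⟩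
  -- One bound is needed for both Θ and its derivative, which is at most C₀Θ².
  obtain ⟨CJ, hCJ⟩ := exists_abs_carlemanFlux_le (m := m) (B := max B (C₀ * B ^ 2)) hα hβ hlam hd
    hs0.le hM0
  have hmem : ∀ᵐ z ∂((volume.restrict (Ioo t₀ t₁)).prod unitVol),
      z ∈ Ioo t₀ t₁ ×ˢ Ioo (0 : ℝ) 1 := by
    rw [Measure.prod_restrict]
    exact ae_restrict_mem (measurableSet_Ioo.prod measurableSet_Ioo)
  have hF2 : Integrable (fun z : ℝ × ℝ => F z.1 z.2 ^ 2)
      ((volume.restrict (Ioo t₀ t₁)).prod unitVol) := h.F_memLp.integrable_sq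
  have hwm := measurable_weight_theta T k β lam d s
  have hFE : Integrable (fun z : ℝ × ℝ => F z.1 z.2 ^ 2 * weight β lam d s (Theta T k z.1) z.2 ^ 2)
      ((volume.restrict (Ioo t₀ t₁)).prod unitVol) := by
    refine Integrable.mono' hF2
      (hF2.aestronglyMeasurable.mul (hwm.pow_const 2).aestronglyMeasurable) ?_
    filter_upwards [hmem] with z hz
    rw [Real.norm_of_nonneg (by positivity)]
    refine mul_le_of_le_one_right (sq_nonneg _) (pow_le_one₀ (Real.exp_pos _).le ?_)
    exact weight_le_one hβ.2 hlam hd hs0.le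
      (theta_pos (hsub _ (Ioo_subset_Icc_self hz.1))).le (Ioo_subset_Icc_self hz.2)
  have hJ1m : Measurable fun t => s * Theta T k t * w t 1 ^ 2 * weight β lam d s (Theta T k t) 1 ^ 2 := by
    have h1 := measurable_theta T k
    have h2 : Measurable fun t => w t 1 := h.meas_w.comp measurable_prodMk_right
    unfold weight; fun_prop
  have hJ1 : IntegrableOn
      (fun t => s * Theta T k t * w t 1 ^ 2 * weight β lam d s (Theta T k t) 1 ^ 2) (Ioo t₀ t₁) := by
    refine Integrable.mono' (g := fun _ => s * B * M ^ 2 * 1) (integrable_const _)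
      hJ1m.aestronglyMeasurable ?_
    filter_upwards [ae_restrict_mem measurableSet_Ioo] with t htm
    have hΘ0 := theta_pos (k := k) (hsub t (Ioo_subset_Icc_self htm))
    rw [Real.norm_of_nonneg (by positivity)]
    have h1 := hB t (Ioo_subset_Icc_self htm)
    have h2 : w t 1 ^ 2 ≤ M ^ 2 := by
      rw [← sq_abs]
      have := hw t 1 ⟨zero_le_one, le_rfl⟩
      gcongr
    have h3 : weight β lam d s (Theta T k t) 1 ^ 2 ≤ 1 :=
      pow_le_one₀ (Real.exp_pos _).le
        (weight_le_one hβ.2 hlam hd hs0.le hΘ0.le ⟨zero_le_one, le_rfl⟩)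
    have h4 : 0 ≤ B := hΘ0.le.trans h1
    gcongr
  have key := lintegral_le_of_flux (σ := 1 - β) (C := CJ)
    (J := fun t x => carlemanFlux α β lam d m s (Theta T k t) (thetaDeriv T k t) x (u t x) (w t x)
      (q t x))
    (K := fun t x => carlemanEnergy α β lam d s (Theta T k t) (thetaDeriv T k t) x (u t x) (p t x))
    (Kt := fun t x => carlemanEnergyDeriv α β lam d s (Theta T k t) (thetaDeriv T k t)
      (thetaDeriv₂ T k t) x (u t x) (p t x) (q t x) (r t x))
    (f := fun t x => κ * carlemanDensity T α β k lam d s t x (u t x) (p t x))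
    (g := fun t x => F t x ^ 2 * weight β lam d s (Theta T k t) x ^ 2 / 4)
    ht (by linarith [hβ.2])
    (fun t _ η hη => by
      have hmono : uIcc η 1 ⊆ uIcc 0 1 := by
        rw [uIcc_of_le hη.2.le, uIcc_of_le zero_le_one]; exact Icc_subset_Icc_left hη.1.le
      exact ac_carlemanFlux hη _ _ _ _ _ _ _ _ ((h.ac_u hα t).1.mono hmono)
        ((h.ac_w hα t).1.mono hmono) ((h.ac_q hα t).1.mono hmono))
    (by
      filter_upwards [h.time_deriv] with x hx t htm
      exact hasDerivAt_carlemanEnergy α β lam d s x (hasDerivAt_theta (hsub t htm))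
        (hasDerivAt_thetaDeriv (hsub t htm)) (hx t).1 (hx t).2)
    (fun x => by
      simp [carlemanEnergy, (h.vanish t₀ (Or.inl rfl) x).2, (h.vanish t₁ (Or.inr rfl) x).2,
        (h.vanish t₀ (Or.inl rfl) x).1, (h.vanish t₁ (Or.inr rfl) x).1])
    (fun t htm => by
      filter_upwards [(h.ac_u hα t).2, (h.ac_w hα t).2, (h.ac_q hα t).2, h.w_ae t,
        ae_restrict_mem measurableSet_Ioo] with x hux hwx hqx hwp hx
      obtain ⟨J', hJ', hle⟩ := hasDerivAt_carlemanFlux α β lam d m s (Theta T k t)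
        (thetaDeriv T k t) (thetaDeriv₂ T k t) hx.1 hux hwx hqx hwp
      refine ⟨J', hJ', hle.trans ?_⟩
      rw [sub_sub_cancel]
      exact sub_le_sub_left (H s t x (u t x) (p t x) hs (hsub t htm) hx) _)
    (fun η hη => h.integrable_energyDeriv hα hβ.2 hlam hd hs0.le hT hk ht₀ ht₁ hη)
    (fun η hη => (h.integrable_density hα hβ.2 hlam hd hs0.le hT hk ht₀ ht₁ hη).const_mul κ)
    (fun t htm x hx => mul_nonneg hκ.le
      (carlemanDensity_nonneg hs0.le (hsub t (Ioo_subset_Icc_self htm)) hx.1.le))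
    (fun t x => by positivity) (hFE.div_const 4)
    (fun η => measurable_carlemanFlux (measurable_theta T k) (measurable_thetaDeriv T k)
      (h.meas_u.comp measurable_prodMk_right) (h.meas_w.comp measurable_prodMk_right)
      (h.meas_q.comp measurable_prodMk_right) η)
    (fun t htm η hη => by
      have hI := Ioo_subset_Icc_self hη
      have hΘ0 := theta_pos (k := k) (hsub t htm)
      have hΘB := hB t htm
      refine hCJ η hη _ _ _ _ _ hΘ0.le (hΘB.trans (le_max_left _ _)) ?_ (hw t η hI) (hu t η hI)
        (hq t η hI)
      refine ((hΘ t (hsub t htm)).2.1.trans ?_).trans (le_max_right _ _)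
      gcongr)
    (by
      simp only [h.u_one, h.q_one, carlemanFlux_one]
      exact (hJ1.const_mul _).neg)
  simp only [h.u_one, h.q_one, carlemanFlux_one] at key
  rw [integral_neg, integral_const_mul, sub_neg_eq_add, integral_div] at key
  have hcm : Measurable fun z : ℝ × ℝ =>
      carlemanDensity T α β k lam d s z.1 z.2 (u z.1 z.2) (p z.1 z.2) :=
    measurable_carlemanDensity measurable_fst measurable_snd h.meas_u h.meas_p
  have e1 : ∀ z : ℝ × ℝ,
      ENNReal.ofReal (carlemanDensity T α β k lam d s z.1 z.2 (u z.1 z.2) (p z.1 z.2)) =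
      ENNReal.ofReal κ⁻¹ * ENNReal.ofReal
        (κ * carlemanDensity T α β k lam d s z.1 z.2 (u z.1 z.2) (p z.1 z.2)) := fun z => by
    rw [← ENNReal.ofReal_mul (by positivity)]; congr 1; field_simp
  simp only [e1]
  rw [lintegral_const_mul _ (hcm.const_mul κ).ennreal_ofReal]
  refine (mul_le_mul' le_rfl key).trans ?_
  rw [← ENNReal.ofReal_mul (by positivity)]
  refine ENNReal.ofReal_le_ofReal ?_
  simp only [weight_sq_eq]
  have i1 : 0 ≤ ∫ z, F z.1 z.2 ^ 2 * Real.exp (2 * s * phi T k β lam d z.1 z.2)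
            ∂((volume.restrict (Ioo t₀ t₁)).prod unitVol) := integral_nonneg fun z => by positivity
  have i2 : 0 ≤ ∫ t in Ioo t₀ t₁, s * Theta T k t * w t 1 ^ 2
              * Real.exp (2 * s * phi T k β lam d t 1) := by
    refine setIntegral_nonneg measurableSet_Ioo fun t htm => ?_
    have hΘ0 := theta_pos (k := k) (hsub t (Ioo_subset_Icc_self htm))
    exact mul_nonneg (mul_nonneg (mul_nonneg hs0.le hΘ0.le) (sq_nonneg _)) (Real.exp_pos _).le
  rw [← hc, show (1 + c) / κ = κ⁻¹ * (1 + c) by ring, mul_assoc κ⁻¹ (1 + c)]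
  refine mul_le_mul_of_nonneg_left ?_ (inv_nonneg.2 hκ.le)
  nlinarith [mul_nonneg hc0.le i1]

/-! ### Mollification in time -/

/-- Convolution with the kernel `ρ` in the time variable. -/
def tconv (ρ : ℝ → ℝ) (g : ℝ × ℝ → ℝ) (t x : ℝ) : ℝ := ∫ τ, ρ (t - τ) * g (τ, x)

/-- Cauchy-Schwarz. -/
theorem sq_integral_mul_le {X : Type*} [MeasurableSpace X] {μ : Measure X} {f g : X → ℝ}
    (hf : MemLp f 2 μ) (hg : MemLp g 2 μ) :
    (∫ x, f x * g x ∂μ) ^ 2 ≤ (∫ x, f x ^ 2 ∂μ) * ∫ x, g x ^ 2 ∂μ := by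
  have hfg : Integrable (fun x => f x * g x) μ := hf.integrable_mul hg
  have key : ∀ c : ℝ, 0 ≤ (∫ x, g x ^ 2 ∂μ) * (c * c) + (2 * ∫ x, f x * g x ∂μ) * c
      + ∫ x, f x ^ 2 ∂μ := fun c => by
    have h1 : (∫ x, g x ^ 2 ∂μ) * (c * c) + (2 * ∫ x, f x * g x ∂μ) * c + ∫ x, f x ^ 2 ∂μ
        = ∫ x, (f x + c * g x) ^ 2 ∂μ := by
      have : ∀ x, (f x + c * g x) ^ 2 = (c * c) * g x ^ 2 + (2 * c) * (f x * g x) + f x ^ 2 :=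
        fun x => by ring
      simp only [this]
      have a1 := hg.integrable_sq.const_mul (c * c)
      have a2 := hfg.const_mul (2 * c)
      have e1 := integral_add (a1.add a2) hf.integrable_sq
      have e2 := integral_add a1 a2
      simp only [Pi.add_apply] at e1
      rw [e1, e2, integral_const_mul, integral_const_mul]; ring
    rw [h1]; exact integral_nonneg fun x => sq_nonneg _
  have := discrim_le_zero key
  unfold discrim at this
  nlinarith

theorem measurable_tconv {ρ : ℝ → ℝ} (hρ : Measurable ρ) {g : ℝ × ℝ → ℝ} (hg : Measurable g) :
    Measurable fun z : ℝ × ℝ => tconv ρ g z.1 z.2 := by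
  have h : StronglyMeasurable fun y : (ℝ × ℝ) × ℝ => ρ (y.1.1 - y.2) * g (y.2, y.1.2) := by
    apply Measurable.stronglyMeasurable
    fun_prop
  exact h.integral_prod_right.measurable

theorem ae_memLp_slice {g : ℝ × ℝ → ℝ} (hg : Measurable g) (hg2 : MemLp g 2 (volume.prod unitVol)) :
    ∀ᵐ x ∂unitVol, MemLp (fun τ => g (τ, x)) 2 volume := by
  filter_upwards [hg2.integrable_sq.prod_left_ae] with x hx
  exact (memLp_two_iff_integrable_sq
    (hg.comp measurable_prodMk_right).aestronglyMeasurable).2 hx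

theorem memLp_kernel {ρ : ℝ → ℝ} (hρ : Continuous ρ) (hc : HasCompactSupport ρ) (t : ℝ) :
    MemLp (fun τ => ρ (t - τ)) 2 volume := by
  have h := (hρ.memLp_of_hasCompactSupport (p := 2) (μ := volume) hc)
  exact h.comp_measurePreserving (Measure.measurePreserving_sub_left volume t)

theorem tconv_eq_convolution (ρ : ℝ → ℝ) (g : ℝ × ℝ → ℝ) (x : ℝ) :
    (fun t => tconv ρ g t x) =
      convolution (fun τ => g (τ, x)) ρ (ContinuousLinearMap.mul ℝ ℝ) volume := by
  ext t
  simp only [tconv, convolution_def, ContinuousLinearMap.mul_apply', mul_comm]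

theorem hasDerivAt_tconv {ρ : ℝ → ℝ} (hρ : ContDiff ℝ 1 ρ) (hc : HasCompactSupport ρ)
    {g : ℝ × ℝ → ℝ} {x : ℝ} (hg : MemLp (fun τ => g (τ, x)) 2 volume) (t : ℝ) :
    HasDerivAt (fun t => tconv ρ g t x) (tconv (deriv ρ) g t x) t := by
  have h := hc.hasDerivAt_convolution_right (ContinuousLinearMap.mul ℝ ℝ)
    (hg.locallyIntegrable one_le_two) hρ t
  rw [tconv_eq_convolution]
  exact h.congr_deriv (congrFun (tconv_eq_convolution (deriv ρ) g x) t).symm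

/-- The kernel times a weight `b ∈ L²` times `g` is integrable on the strip. -/
theorem integrable_kernel_mul {ρ : ℝ → ℝ} (hρ : Continuous ρ) (hc : HasCompactSupport ρ)
    {g : ℝ × ℝ → ℝ} (hg2 : MemLp g 2 (volume.prod unitVol)) {b : ℝ → ℝ} (hb : MemLp b 2 unitVol)
    (t : ℝ) : Integrable (fun z : ℝ × ℝ => ρ (t - z.1) * b z.2 * g z) (volume.prod unitVol) := by
  have h1 := memLp_kernel hρ hc t
  have h2 : MemLp (fun z : ℝ × ℝ => ρ (t - z.1) * b z.2) 2 (volume.prod unitVol) := by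
    have hm : AEStronglyMeasurable (fun z : ℝ × ℝ => ρ (t - z.1) * b z.2) (volume.prod unitVol) :=
      (h1.1.comp_fst).mul (hb.1.comp_snd)
    rw [memLp_two_iff_integrable_sq hm]
    simp only [mul_pow]
    exact h1.integrable_sq.mul_prod hb.integrable_sq
  exact h2.integrable_mul hg2

theorem integral_kernel_sq (ρ : ℝ → ℝ) (t : ℝ) : ∫ τ, ρ (t - τ) ^ 2 = ∫ τ, ρ τ ^ 2 :=
  integral_sub_left_eq_self (fun τ => ρ τ ^ 2) volume t

/-- Cauchy-Schwarz in τ. The exceptional null set in x does not depend on t, which yields bounds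
uniform in time. -/
theorem ae_abs_tconv_le {ρ : ℝ → ℝ} (hρ : Continuous ρ) (hc : HasCompactSupport ρ)
    {g : ℝ × ℝ → ℝ} (hg : Measurable g) (hg2 : MemLp g 2 (volume.prod unitVol)) :
    ∀ᵐ x ∂unitVol, ∀ t, tconv ρ g t x ^ 2 ≤ (∫ τ, ρ τ ^ 2) * ∫ τ, g (τ, x) ^ 2 := by
  filter_upwards [ae_memLp_slice hg hg2] with x hx t
  rw [← integral_kernel_sq ρ t]
  exact sq_integral_mul_le (memLp_kernel hρ hc t) hx

theorem memLp_tconv {ρ : ℝ → ℝ} (hρ : Continuous ρ) (hc : HasCompactSupport ρ)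
    {g : ℝ × ℝ → ℝ} (hg : Measurable g) (hg2 : MemLp g 2 (volume.prod unitVol)) (t₀ t₁ : ℝ) :
    MemLp (fun z : ℝ × ℝ => tconv ρ g z.1 z.2) 2 ((volume.restrict (Ioo t₀ t₁)).prod unitVol) := by
  have hm := measurable_tconv hρ.measurable hg
  rw [memLp_two_iff_integrable_sq hm.aestronglyMeasurable]
  have h1 : Integrable (fun z : ℝ × ℝ => (∫ τ, ρ τ ^ 2) * ∫ τ, g (τ, z.2) ^ 2)
      ((volume.restrict (Ioo t₀ t₁)).prod unitVol) :=
    ((hg2.integrable_sq.integral_prod_right).comp_snd (volume.restrict (Ioo t₀ t₁))).const_mul _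
  refine Integrable.mono' h1 (hm.pow_const 2).aestronglyMeasurable ?_
  have h2 := Measure.quasiMeasurePreserving_snd (μ := volume.restrict (Ioo t₀ t₁)) (ν := unitVol)
  filter_upwards [h2.ae (ae_abs_tconv_le hρ hc hg hg2)] with z hz
  rw [Real.norm_of_nonneg (sq_nonneg _)]
  exact hz z.1

/-- Each time slice of a mollified function is square integrable, uniformly in time. -/
theorem memLp_tconv_slice {ρ : ℝ → ℝ} (hρ : Continuous ρ) (hc : HasCompactSupport ρ)
    {g : ℝ × ℝ → ℝ} (hg : Measurable g) (hg2 : MemLp g 2 (volume.prod unitVol)) (t : ℝ) :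
    MemLp (fun x => tconv ρ g t x) 2 unitVol ∧
      ∫ x, tconv ρ g t x ^ 2 ∂unitVol ≤
        (∫ τ, ρ τ ^ 2) * ∫ x, ∫ τ, g (τ, x) ^ 2 ∂volume ∂unitVol := by
  have hm : Measurable fun x => tconv ρ g t x :=
    (measurable_tconv hρ.measurable hg).comp measurable_prodMk_left
  have h1 : Integrable (fun x : ℝ => (∫ τ, ρ τ ^ 2) * ∫ τ, g (τ, x) ^ 2) unitVol :=
    (hg2.integrable_sq.integral_prod_right).const_mul _
  have hle : ∀ᵐ x ∂unitVol, tconv ρ g t x ^ 2 ≤ (∫ τ, ρ τ ^ 2) * ∫ τ, g (τ, x) ^ 2 :=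
    (ae_abs_tconv_le hρ hc hg hg2).mono fun x hx => hx t
  have h2 : Integrable (fun x => tconv ρ g t x ^ 2) unitVol := by
    refine Integrable.mono' h1 (hm.pow_const 2).aestronglyMeasurable ?_
    filter_upwards [hle] with x hx
    rwa [Real.norm_of_nonneg (sq_nonneg _)]
  refine ⟨(memLp_two_iff_integrable_sq hm.aestronglyMeasurable).2 h2, ?_⟩
  rw [← integral_const_mul]
  exact integral_mono_ae h2 h1 hle

theorem exists_integral_abs_tconv_le {ρ : ℝ → ℝ} (hρ : Continuous ρ) (hc : HasCompactSupport ρ)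
    {g : ℝ × ℝ → ℝ} (hg : Measurable g) (hg2 : MemLp g 2 (volume.prod unitVol)) :
    ∃ M, ∀ t, ∫ x, |tconv ρ g t x| ∂unitVol ≤ M := by
  refine ⟨1 + (∫ τ, ρ τ ^ 2) * ∫ x, ∫ τ, g (τ, x) ^ 2 ∂volume ∂unitVol, fun t => ?_⟩
  obtain ⟨h1, h2⟩ := memLp_tconv_slice hρ hc hg hg2 t
  have h3 : ∫ x, |tconv ρ g t x| ∂unitVol ≤ ∫ x, (1 + tconv ρ g t x ^ 2) ∂unitVol := by
    refine integral_mono (h1.integrable one_le_two).abs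
      ((integrable_const _).add h1.integrable_sq) fun x => ?_
    change |tconv ρ g t x| ≤ 1 + tconv ρ g t x ^ 2
    rw [abs_le]; constructor <;> nlinarith [sq_nonneg (tconv ρ g t x - 1), sq_nonneg (tconv ρ g t x + 1)]
  rw [integral_add (integrable_const _) h1.integrable_sq] at h3
  simp only [integral_const, probReal_univ, one_smul] at h3
  linarith

theorem measurable_intervalIntegral {f : ℝ × ℝ → ℝ} (hf : Measurable f) {a b : ℝ × ℝ → ℝ}
    (ha : Measurable a) (hb : Measurable b) :
    Measurable fun z : ℝ × ℝ => ∫ ξ in a z..b z, f (z.1, ξ) := by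
  have key : ∀ {a b : ℝ × ℝ → ℝ}, Measurable a → Measurable b →
      Measurable fun z : ℝ × ℝ => ∫ ξ in Ioc (a z) (b z), f (z.1, ξ) := fun {a b} ha hb => by
    have h : StronglyMeasurable fun y : (ℝ × ℝ) × ℝ =>
        (Ioc (a y.1) (b y.1)).indicator (fun ξ => f (y.1.1, ξ)) y.2 := by
      apply Measurable.stronglyMeasurable
      simp only [indicator, mem_Ioc]
      refine Measurable.ite ?_ (by fun_prop) measurable_const
      exact (measurableSet_lt (ha.comp measurable_fst) measurable_snd).inter
        (measurableSet_le measurable_snd (hb.comp measurable_fst))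
    have h2 := h.integral_prod_right' (ν := volume)
    simp only [integral_indicator measurableSet_Ioc] at h2
    exact h2.measurable
  simp only [intervalIntegral]
  exact (key ha hb).sub (key hb ha)

/-- The function with derivative `x ^ (-α/2) G` in `x` that vanishes at `x = 0`. -/
def prim (α : ℝ) (G : ℝ × ℝ → ℝ) (z : ℝ × ℝ) : ℝ :=
  ∫ ξ in (0 : ℝ)..z.2, ξ ^ (-(α / 2)) * G (z.1, ξ)

theorem measurable_prim (α : ℝ) {G : ℝ × ℝ → ℝ} (hG : Measurable G) : Measurable (prim α G) :=
  measurable_intervalIntegral (f := fun z => z.2 ^ (-(α / 2)) * G z)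
    ((measurable_snd.pow_const _).mul hG) measurable_const measurable_snd

theorem memLp_rpow_neg_half {α : ℝ} (hα : α < 1) :
    MemLp (fun x : ℝ => x ^ (-(α / 2))) 2 unitVol := by
  rw [memLp_two_iff_integrable_sq (by fun_prop : Measurable fun x : ℝ => x ^ (-(α / 2))).aestronglyMeasurable]
  have h1 : IntervalIntegrable (fun x : ℝ => x ^ (-α)) volume 0 1 :=
    intervalIntegral.intervalIntegrable_rpow' (by linarith)
  rw [intervalIntegrable_iff_integrableOn_Ioo_of_le zero_le_one] at h1
  refine Integrable.congr h1 ?_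
  filter_upwards [ae_restrict_mem measurableSet_Ioo] with x hx
  rw [← Real.rpow_natCast, ← Real.rpow_mul hx.1.le]; congr 1; push_cast; ring

theorem intervalIntegral_eq_Ioo {f : ℝ → ℝ} {x : ℝ} (hx : 0 ≤ x) :
    ∫ ξ in (0 : ℝ)..x, f ξ = ∫ ξ in Ioo 0 x, f ξ := by
  rw [intervalIntegral.integral_of_le hx, integral_Ioc_eq_integral_Ioo]

/-- Cauchy-Schwarz on a subinterval of the unit interval. -/
theorem sq_integral_Ioo_le {b g : ℝ → ℝ} (hb : MemLp b 2 unitVol) (hg : MemLp g 2 unitVol)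
    {s : Set ℝ} (hs : s ⊆ Ioo 0 1) :
    (∫ ξ in s, b ξ * g ξ) ^ 2 ≤ (∫ ξ, b ξ ^ 2 ∂unitVol) * ∫ ξ, g ξ ^ 2 ∂unitVol := by
  have hle : volume.restrict s ≤ unitVol := Measure.restrict_mono hs le_rfl
  refine (sq_integral_mul_le (hb.mono_measure hle) (hg.mono_measure hle)).trans ?_
  exact mul_le_mul (integral_mono_measure hle (ae_of_all _ fun x => sq_nonneg _) hb.integrable_sq)
    (integral_mono_measure hle (ae_of_all _ fun x => sq_nonneg _) hg.integrable_sq)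
    (integral_nonneg fun x => sq_nonneg _) (integral_nonneg fun x => sq_nonneg _)

theorem ae_memLp_slice_right {μ : Measure ℝ} [SFinite μ] {g : ℝ × ℝ → ℝ} (hg : Measurable g)
    (hg2 : MemLp g 2 (μ.prod unitVol)) : ∀ᵐ t ∂μ, MemLp (fun x => g (t, x)) 2 unitVol := by
  filter_upwards [hg2.integrable_sq.prod_right_ae] with t ht
  exact (memLp_two_iff_integrable_sq
    (hg.comp measurable_prodMk_left).aestronglyMeasurable).2 ht

theorem ae_prod_mem_unit (μ : Measure ℝ) [SFinite μ] :
    ∀ᵐ z ∂(μ.prod unitVol), z.2 ∈ Ioo (0 : ℝ) 1 :=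
  (Measure.quasiMeasurePreserving_snd (μ := μ) (ν := unitVol)).ae
    (ae_restrict_mem measurableSet_Ioo)

theorem ae_sq_prim_le {μ : Measure ℝ} [SFinite μ] {α : ℝ} (hα : α < 1) {G : ℝ × ℝ → ℝ}
    (hG : Measurable G) (hG2 : MemLp G 2 (μ.prod unitVol)) :
    ∀ᵐ z ∂(μ.prod unitVol), prim α G z ^ 2 ≤
      (∫ ξ, (ξ ^ (-(α / 2))) ^ 2 ∂unitVol) * ∫ ξ, G (z.1, ξ) ^ 2 ∂unitVol := by
  have h1 := (Measure.quasiMeasurePreserving_fst (μ := μ) (ν := unitVol)).ae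
    (ae_memLp_slice_right hG hG2)
  filter_upwards [h1, ae_prod_mem_unit μ] with z hz hz2
  rw [prim, intervalIntegral_eq_Ioo hz2.1.le]
  exact sq_integral_Ioo_le (memLp_rpow_neg_half hα) hz (Ioo_subset_Ioo_right hz2.2.le)

theorem memLp_prim {μ : Measure ℝ} [SFinite μ] {α : ℝ} (hα : α < 1) {G : ℝ × ℝ → ℝ}
    (hG : Measurable G) (hG2 : MemLp G 2 (μ.prod unitVol)) : MemLp (prim α G) 2 (μ.prod unitVol) := by
  rw [memLp_two_iff_integrable_sq (measurable_prim α hG).aestronglyMeasurable]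
  refine Integrable.mono' (g := fun z => (∫ ξ, (ξ ^ (-(α / 2))) ^ 2 ∂unitVol) *
      ∫ ξ, G (z.1, ξ) ^ 2 ∂unitVol)
    (((hG2.integrable_sq.integral_prod_left).comp_fst unitVol).const_mul _)
    ((measurable_prim α hG).pow_const 2).aestronglyMeasurable ?_
  filter_upwards [ae_sq_prim_le hα hG hG2] with z hz
  rw [Real.norm_of_nonneg (sq_nonneg _)]
  exact hz

/-- Fubini: convolution in t commutes with integration in x. It identifies the primitive of the
mollified G with the mollified solution. -/
theorem tconv_prim {ρ : ℝ → ℝ} (hρ : Continuous ρ) (hc : HasCompactSupport ρ) {α : ℝ} (hα : α < 1)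
    {G : ℝ × ℝ → ℝ} (hG2 : MemLp G 2 (volume.prod unitVol)) (t : ℝ) {x : ℝ}
    (hx : x ∈ Icc (0 : ℝ) 1) :
    tconv ρ (prim α G) t x = ∫ ξ in (0 : ℝ)..x, ξ ^ (-(α / 2)) * tconv ρ G t ξ := by
  have hle : volume.restrict (Ioo 0 x) ≤ unitVol :=
    Measure.restrict_mono (Ioo_subset_Ioo_right hx.2) le_rfl
  have h1 : Integrable (fun z : ℝ × ℝ => ρ (t - z.1) * z.2 ^ (-(α / 2)) * G z)
      ((volume : Measure ℝ).prod (volume.restrict (Ioo 0 x))) := by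
    refine (integrable_kernel_mul hρ hc hG2 (memLp_rpow_neg_half hα) t).mono_measure ?_
    rw [prod_unitVol_restrict, prod_unitVol_restrict]
    exact Measure.restrict_mono (prod_mono le_rfl (Ioo_subset_Ioo_right hx.2)) le_rfl
  rw [intervalIntegral_eq_Ioo hx.1]
  simp only [tconv, prim]
  simp only [intervalIntegral_eq_Ioo hx.1, ← integral_const_mul]
  rw [integral_integral_swap (f := fun τ ξ => ρ (t - τ) * (ξ ^ (-(α / 2)) * G (τ, ξ)))]
  · simp only [mul_left_comm]
  · refine h1.congr (ae_of_all _ fun z => ?_)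
    simp only [Function.uncurry, mul_assoc]

/-! ### Weak solutions and the regularity of their mollifications -/

/-- The lemma of du Bois-Reymond in the form needed here. -/
theorem ae_eq_of_weak {w h : ℝ → ℝ} (hw : Integrable w unitVol)
    (hh : IntervalIntegrable h volume 0 1)
    (H : ∀ η : ℝ → ℝ, Measurable η → (∀ x, |η x| ≤ 1) → ∫ ξ in (0 : ℝ)..1, η ξ = 0 →
      ∫ x, (h x * (∫ ξ in (0 : ℝ)..x, η ξ) + w x * η x) ∂unitVol = 0) :
    ∀ᵐ x ∂unitVol, w x = (∫ y, (w y + ∫ ξ in y..1, h ξ) ∂unitVol) - ∫ ξ in x..1, h ξ := by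
  have h01 : (1 : ℝ) ∈ uIcc (0 : ℝ) 1 := right_mem_uIcc
  set S : ℝ → ℝ := fun x => ∫ ξ in x..1, h ξ with hS
  have hS' : S = fun x => -∫ ξ in (1 : ℝ)..x, h ξ := by
    ext x; rw [hS]; exact intervalIntegral.integral_symm _ _
  have hSac : AbsolutelyContinuousOnInterval S 0 1 := by
    rw [hS']; exact (hh.absolutelyContinuousOnInterval_intervalIntegral h01).fun_neg
  have hSi : Integrable S unitVol := by
    have := (hSac.continuousOn).intervalIntegrable (μ := volume)
    rwa [intervalIntegrable_iff_integrableOn_Ioo_of_le zero_le_one] at this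
  have hSd : ∀ᵐ x ∂unitVol, deriv S x = -h x := by
    rw [ae_restrict_iff' measurableSet_Ioo]
    filter_upwards [hh.ae_hasDerivAt_integral] with x hx hxm
    rw [uIcc_of_le zero_le_one] at hx
    have := (hx (Ioo_subset_Icc_self hxm) 1 ⟨zero_le_one, le_rfl⟩).fun_neg
    rw [hS']; exact this.deriv
  -- Since S' = -h, integration by parts turns the hypothesis into ∫ kη = 0 for all bounded η of
  -- mean zero, so k has to be constant.
  set k : ℝ → ℝ := fun x => w x + S x with hk
  have hki : Integrable k unitVol := hw.add hSi
  have key : ∀ η : ℝ → ℝ, Measurable η → (∀ x, |η x| ≤ 1) → ∫ ξ in (0 : ℝ)..1, η ξ = 0 →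
      ∫ x, k x * η x ∂unitVol = 0 := fun η hη hη1 hη0 => by
    have hηi : IntervalIntegrable η volume 0 1 := by
      rw [intervalIntegrable_iff_integrableOn_Ioo_of_le zero_le_one]
      exact Integrable.mono' (integrable_const 1) hη.aestronglyMeasurable (ae_of_all _ hη1)
    set v : ℝ → ℝ := fun x => ∫ ξ in (0 : ℝ)..x, η ξ with hv
    have hvac : AbsolutelyContinuousOnInterval v 0 1 :=
      hηi.absolutelyContinuousOnInterval_intervalIntegral left_mem_uIcc
    have hvd : ∀ᵐ x ∂unitVol, deriv v x = η x := by
      rw [ae_restrict_iff' measurableSet_Ioo]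
      filter_upwards [hηi.ae_hasDerivAt_integral] with x hx hxm
      rw [uIcc_of_le zero_le_one] at hx
      exact (hx (Ioo_subset_Icc_self hxm) 0 ⟨le_rfl, zero_le_one⟩).deriv
    have hv0 : v 0 = 0 := intervalIntegral.integral_same
    have hv1 : v 1 = 0 := hη0
    have ibp := hvac.integral_mul_deriv_eq_deriv_mul hSac
    rw [hv0, hv1, zero_mul, zero_mul, sub_zero, zero_sub, intervalIntegral_eq_Ioo zero_le_one,
      intervalIntegral_eq_Ioo zero_le_one] at ibp
    have e1 : ∫ x, v x * deriv S x ∂unitVol = -∫ x, h x * v x ∂unitVol := by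
      rw [← integral_neg]
      refine integral_congr_ae ?_
      filter_upwards [hSd] with x hx
      rw [hx]; ring
    have e2 : ∫ x, deriv v x * S x ∂unitVol = ∫ x, S x * η x ∂unitVol := by
      refine integral_congr_ae ?_
      filter_upwards [hvd] with x hx
      rw [hx]; ring
    have e3 : ∫ x, h x * v x ∂unitVol = ∫ x, S x * η x ∂unitVol := by
      rw [e1, e2] at ibp; linarith
    have hbdd : ∀ {f : ℝ → ℝ}, Integrable f unitVol → Integrable (fun x => f x * η x) unitVol :=
      fun hf => hf.mul_bdd (c := 1) hη.aestronglyMeasurable (ae_of_all _ hη1)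
    have hhv : Integrable (fun x => h x * v x) unitVol := by
      have := hh.mul_continuousOn hvac.continuousOn
      rwa [intervalIntegrable_iff_integrableOn_Ioo_of_le zero_le_one] at this
    have := H η hη hη1 hη0
    rw [integral_add hhv (hbdd hw), e3] at this
    have e4 : ∀ x, k x * η x = w x * η x + S x * η x := fun x => by rw [hk]; ring
    simp only [e4]
    rw [integral_add (hbdd hw) (hbdd hSi)]
    linarith
  have hz : (fun x => k x - ∫ y, k y ∂unitVol) =ᵐ[unitVol] 0 := by
    refine Integrable.ae_eq_zero_of_forall_setIntegral_eq_zero (hki.sub (integrable_const _))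
      fun A hA _ => ?_
    have hA0 : 0 ≤ unitVol.real A := measureReal_nonneg
    have hA1 : unitVol.real A ≤ 1 := measureReal_le_one
    have hind : Integrable (A.indicator (fun _ => (1 : ℝ))) unitVol :=
      (integrable_const 1).indicator hA
    -- The indicator of A minus its mean: the orthogonality says that the integral of k over A is
    -- |A| times the mean of k.
    have := key (fun x => A.indicator (fun _ => (1 : ℝ)) x - unitVol.real A)
      ((measurable_const.indicator hA).sub_const _)
      (fun x => by
        by_cases hx : x ∈ A
        · simp only [indicator_of_mem hx]; rw [abs_le]; constructor <;> linarith
        · simp only [indicator_of_notMem hx]; rw [abs_le]; constructor <;> linarith)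
      (by
        rw [intervalIntegral_eq_Ioo zero_le_one, integral_sub hind (integrable_const _),
          integral_indicator hA]
        simp)
    have e5 : ∀ x, k x * (A.indicator (fun _ => (1 : ℝ)) x - unitVol.real A) =
        A.indicator k x - unitVol.real A * k x := fun x => by
      by_cases hx : x ∈ A
      · simp only [indicator_of_mem hx]; ring
      · simp only [indicator_of_notMem hx]; ring
    simp only [e5] at this
    rw [integral_sub (hki.indicator hA) (hki.const_mul _), integral_indicator hA,
      integral_const_mul] at this
    rw [integral_sub hki.integrableOn (integrable_const _), setIntegral_const, smul_eq_mul]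
    exact this
  filter_upwards [hz] with x hx
  simp only [Pi.zero_apply, hk] at hx
  linarith

/-- Weak solutions of `U_t - (x ^ α U_x)_x = F` on `ℝ × (0,1)`, in terms of `G = x ^ (α/2) U_x`. -/
structure WeakSolution (α : ℝ) (G F : ℝ × ℝ → ℝ) : Prop where
  meas_G : Measurable G
  meas_F : Measurable F
  memLp_G : MemLp G 2 (volume.prod unitVol)
  memLp_F : MemLp F 2 (volume.prod unitVol)
  boundary : ∀ᵐ t, prim α G (t, 1) = 0
  weak : ∀ ζ : ℝ → ℝ, ContDiff ℝ 1 ζ → HasCompactSupport ζ → ∀ η : ℝ → ℝ, Measurable η →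
    (∀ x, |η x| ≤ 1) → ∫ ξ in (0 : ℝ)..1, η ξ = 0 →
    ∫ z, (deriv ζ z.1 * (∫ ξ in (0 : ℝ)..z.2, η ξ) * prim α G z
        - ζ z.1 * (z.2 ^ (α / 2) * η z.2) * G z
        + ζ z.1 * (∫ ξ in (0 : ℝ)..z.2, η ξ) * F z) ∂(volume.prod unitVol) = 0

theorem integral_kernel_mul {ρ : ℝ → ℝ} (hρ : Continuous ρ) (hc : HasCompactSupport ρ)
    {g : ℝ × ℝ → ℝ} (hg2 : MemLp g 2 (volume.prod unitVol)) {b : ℝ → ℝ} (hb : MemLp b 2 unitVol)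
    (t : ℝ) : ∫ z, ρ (t - z.1) * b z.2 * g z ∂(volume.prod unitVol) =
      ∫ x, b x * tconv ρ g t x ∂unitVol := by
  rw [integral_prod_symm _ (integrable_kernel_mul hρ hc hg2 hb t)]
  simp only [tconv, ← integral_const_mul]
  refine integral_congr_ae (ae_of_all _ fun x => integral_congr_ae (ae_of_all _ fun τ => ?_))
  change _ * _ * _ = _ * (_ * _)
  ring

theorem memLp_of_abs_le_one {b : ℝ → ℝ} (hb : Measurable b) (h : ∀ x ∈ Ioo (0 : ℝ) 1, |b x| ≤ 1) :
    MemLp b 2 unitVol := by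
  refine MemLp.of_bound hb.aestronglyMeasurable 1 ?_
  filter_upwards [ae_restrict_mem measurableSet_Ioo] with x hx
  exact h x hx

theorem intervalIntegrable_of_abs_le_one {η : ℝ → ℝ} (hη : Measurable η) (h : ∀ x, |η x| ≤ 1)
    (a b : ℝ) : IntervalIntegrable η volume a b := by
  rw [intervalIntegrable_iff]
  have : IsFiniteMeasure (volume.restrict (uIoc a b)) := ⟨by simp [uIoc]⟩
  exact Integrable.mono' (integrable_const (1 : ℝ)) hη.aestronglyMeasurable (ae_of_all _ h)

theorem memLp_primitive {η : ℝ → ℝ} (hη : Measurable η) (h : ∀ x, |η x| ≤ 1) :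
    MemLp (fun x => ∫ ξ in (0 : ℝ)..x, η ξ) 2 unitVol := by
  refine memLp_of_abs_le_one
    (intervalIntegral.continuous_primitive (intervalIntegrable_of_abs_le_one hη h) 0).measurable
    fun x hx => ?_
  have := intervalIntegral.norm_integral_le_of_norm_le_const (a := 0) (b := x) (C := 1) (f := η)
    fun y _ => h y
  rw [one_mul, sub_zero, abs_of_pos hx.1] at this
  exact this.trans hx.2.le

theorem rpow_half_mem {α x : ℝ} (hα : 0 < α) (hx : x ∈ Ioo (0 : ℝ) 1) :
    0 ≤ x ^ (α / 2) ∧ x ^ (α / 2) ≤ 1 :=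
  ⟨Real.rpow_nonneg hx.1.le _, Real.rpow_le_one hx.1.le hx.2.le (by linarith)⟩

theorem memLp_tconv_prim_slice {ρ : ℝ → ℝ} (hρ : Continuous ρ) (hc : HasCompactSupport ρ) {α : ℝ}
    (hα : α < 1) {G : ℝ × ℝ → ℝ} (hG : Measurable G) (hG2 : MemLp G 2 (volume.prod unitVol))
    (t : ℝ) : MemLp (fun x => tconv ρ (prim α G) t x) 2 unitVol :=
  (memLp_tconv_slice hρ hc (measurable_prim α hG) (memLp_prim hα hG hG2) t).1

/-- The weak formulation after mollification in time. -/
theorem WeakSolution.mollified_weak {α : ℝ} {G F : ℝ × ℝ → ℝ} (S : WeakSolution α G F)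
    (hα : α ∈ Ioo (0 : ℝ) 1) {ρ : ℝ → ℝ} (hρ : ContDiff ℝ 1 ρ) (hc : HasCompactSupport ρ) (t : ℝ)
    {η : ℝ → ℝ} (hη : Measurable η) (hη1 : ∀ x, |η x| ≤ 1)
    (hη0 : ∫ ξ in (0 : ℝ)..1, η ξ = 0) :
    ∫ x, ((tconv (deriv ρ) (prim α G) t x - tconv ρ F t x) * (∫ ξ in (0 : ℝ)..x, η ξ)
      + x ^ (α / 2) * tconv ρ G t x * η x) ∂unitVol = 0 := by
  set v : ℝ → ℝ := fun x => ∫ ξ in (0 : ℝ)..x, η ξ with hv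
  have hv2 : MemLp v 2 unitVol := memLp_primitive hη hη1
  have hη2 : MemLp (fun x => x ^ (α / 2) * η x) 2 unitVol := by
    refine memLp_of_abs_le_one (by fun_prop) fun x hx => ?_
    obtain ⟨h1, h2⟩ := rpow_half_mem hα.1 hx
    rw [abs_mul, abs_of_nonneg h1]
    exact mul_le_one₀ h2 (abs_nonneg _) (hη1 x)
  have hρ' : Continuous (deriv ρ) := hρ.continuous_deriv le_rfl
  -- The reflected and shifted kernel serves as test function in time, which turns the weak
  -- formulation into the mollified equation at time t.
  have hζ : ContDiff ℝ 1 fun τ => ρ (t - τ) := hρ.comp (contDiff_const.sub contDiff_id)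
  have hζc : HasCompactSupport fun τ => ρ (t - τ) :=
    hc.comp_homeomorph (Homeomorph.subLeft t)
  have hd : ∀ τ, deriv (fun τ => ρ (t - τ)) τ = -deriv ρ (t - τ) := 
    deriv_comp_const_sub _ _
  have hP2 := memLp_prim hα.2 S.meas_G S.memLp_G
  have i1 := integrable_kernel_mul hρ' hc.deriv hP2 hv2 t
  have i2 := integrable_kernel_mul hρ.continuous hc S.memLp_G hη2 t
  have i3 := integrable_kernel_mul hρ.continuous hc S.memLp_F hv2 t
  have e1 := integral_kernel_mul hρ' hc.deriv hP2 hv2 t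
  have e2 := integral_kernel_mul hρ.continuous hc S.memLp_G hη2 t
  have e3 := integral_kernel_mul hρ.continuous hc S.memLp_F hv2 t
  have H := S.weak _ hζ hζc η hη hη1 hη0
  simp only [hd] at H
  have H2 : ∫ z : ℝ × ℝ, (-(deriv ρ (t - z.1) * v z.2 * prim α G z)
      - ρ (t - z.1) * (z.2 ^ (α / 2) * η z.2) * G z + ρ (t - z.1) * v z.2 * F z)
      ∂(volume.prod unitVol) = 0 := by
    rw [← H]; congr 1; ext z; ring
  have a1 := integral_add (i1.neg.sub i2) i3
  have a2 := integral_sub i1.neg i2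
  simp only [Pi.neg_apply, Pi.sub_apply] at a1 a2
  rw [a1, a2, integral_neg, e1, e2, e3] at H2
  have j1 := hv2.integrable_mul (memLp_tconv_prim_slice hρ' hc.deriv hα.2 S.meas_G S.memLp_G t)
  have j2 := hη2.integrable_mul (memLp_tconv_slice hρ.continuous hc S.meas_G S.memLp_G t).1
  have j3 := hv2.integrable_mul (memLp_tconv_slice hρ.continuous hc S.meas_F S.memLp_F t).1
  have b1 := integral_add (j1.sub j3) j2
  have b2 := integral_sub j1 j3
  simp only [Pi.sub_apply, Pi.mul_apply] at b1 b2
  have : ∫ x, ((tconv (deriv ρ) (prim α G) t x - tconv ρ F t x) * v x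
      + x ^ (α / 2) * tconv ρ G t x * η x) ∂unitVol =
      ∫ x, (v x * tconv (deriv ρ) (prim α G) t x - v x * tconv ρ F t x
        + x ^ (α / 2) * η x * tconv ρ G t x) ∂unitVol := by
    congr 1; ext x; ring
  rw [this, b1, b2]
  linarith

/-- `q` for the mollified solution. -/
def mollQ (α : ℝ) (G : ℝ × ℝ → ℝ) (ρ : ℝ → ℝ) (t x : ℝ) : ℝ :=
  ∫ ξ in (0 : ℝ)..x, ξ ^ (-(α / 2)) * tconv (deriv ρ) G t ξ

/-- The trace at `x = 1` of the flux of the mollified solution. -/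
def mollTrace (α : ℝ) (G F : ℝ × ℝ → ℝ) (ρ : ℝ → ℝ) (t : ℝ) : ℝ :=
  ∫ y, (y ^ (α / 2) * tconv ρ G t y + ∫ ξ in y..1, (mollQ α G ρ t ξ - tconv ρ F t ξ)) ∂unitVol

/-- The flux of the mollified solution. -/
def mollW (α : ℝ) (G F : ℝ × ℝ → ℝ) (ρ : ℝ → ℝ) (t x : ℝ) : ℝ :=
  mollTrace α G F ρ t - ∫ ξ in x..1, (mollQ α G ρ t ξ - tconv ρ F t ξ)

theorem measurable_mollQ (α : ℝ) {G : ℝ × ℝ → ℝ} (hG : Measurable G) {ρ : ℝ → ℝ}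
    (hρ : Continuous (deriv ρ)) : Measurable fun z : ℝ × ℝ => mollQ α G ρ z.1 z.2 :=
  measurable_prim α (measurable_tconv hρ.measurable hG)

theorem measurable_mollH (α : ℝ) {G F : ℝ × ℝ → ℝ} (hG : Measurable G) (hF : Measurable F)
    {ρ : ℝ → ℝ} (hρ : ContDiff ℝ 1 ρ) :
    Measurable fun z : ℝ × ℝ => mollQ α G ρ z.1 z.2 - tconv ρ F z.1 z.2 :=
  (measurable_mollQ α hG (hρ.continuous_deriv le_rfl)).sub
    (measurable_tconv hρ.continuous.measurable hF)

theorem measurable_mollTrace (α : ℝ) {G F : ℝ × ℝ → ℝ} (hG : Measurable G) (hF : Measurable F)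
    {ρ : ℝ → ℝ} (hρ : ContDiff ℝ 1 ρ) : Measurable (mollTrace α G F ρ) := by
  have h : StronglyMeasurable fun z : ℝ × ℝ => z.2 ^ (α / 2) * tconv ρ G z.1 z.2
      + ∫ ξ in z.2..1, (mollQ α G ρ z.1 ξ - tconv ρ F z.1 ξ) := by
    refine Measurable.stronglyMeasurable (Measurable.add ?_
      (measurable_intervalIntegral (measurable_mollH α hG hF hρ) measurable_snd measurable_const))
    exact (measurable_snd.pow_const _).mul (measurable_tconv hρ.continuous.measurable hG)
  exact (h.integral_prod_right' (ν := unitVol)).measurable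

theorem measurable_mollW (α : ℝ) {G F : ℝ × ℝ → ℝ} (hG : Measurable G) (hF : Measurable F)
    {ρ : ℝ → ℝ} (hρ : ContDiff ℝ 1 ρ) : Measurable fun z : ℝ × ℝ => mollW α G F ρ z.1 z.2 :=
  ((measurable_mollTrace α hG hF hρ).comp measurable_fst).sub
    (measurable_intervalIntegral (measurable_mollH α hG hF hρ) measurable_snd measurable_const)

theorem mollQ_eq {α : ℝ} (hα : α < 1) {G : ℝ × ℝ → ℝ} (hG2 : MemLp G 2 (volume.prod unitVol))
    {ρ : ℝ → ℝ} (hρ : Continuous (deriv ρ)) (hc : HasCompactSupport ρ) (t : ℝ) {x : ℝ}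
    (hx : x ∈ Icc (0 : ℝ) 1) : mollQ α G ρ t x = tconv (deriv ρ) (prim α G) t x :=
  (tconv_prim hρ hc.deriv hα hG2 t hx).symm

theorem WeakSolution.memLp_mollQ_slice {α : ℝ} {G F : ℝ × ℝ → ℝ} (S : WeakSolution α G F)
    (hα : α ∈ Ioo (0 : ℝ) 1) {ρ : ℝ → ℝ} (hρ : ContDiff ℝ 1 ρ) (hc : HasCompactSupport ρ)
    (t : ℝ) : MemLp (fun x => mollQ α G ρ t x) 2 unitVol := by
  have hρ' : Continuous (deriv ρ) := hρ.continuous_deriv le_rfl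
  refine (memLp_congr_ae ?_).1 (memLp_tconv_prim_slice hρ' hc.deriv hα.2 S.meas_G S.memLp_G t)
  filter_upwards [ae_restrict_mem measurableSet_Ioo] with x hx
  exact (mollQ_eq hα.2 S.memLp_G hρ' hc t (Ioo_subset_Icc_self hx)).symm

theorem WeakSolution.memLp_mollH_slice {α : ℝ} {G F : ℝ × ℝ → ℝ} (S : WeakSolution α G F)
    (hα : α ∈ Ioo (0 : ℝ) 1) {ρ : ℝ → ℝ} (hρ : ContDiff ℝ 1 ρ) (hc : HasCompactSupport ρ)
    (t : ℝ) :
    MemLp (fun x => mollQ α G ρ t x - tconv ρ F t x) 2 unitVol :=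
  (S.memLp_mollQ_slice hα hρ hc t).sub
    (memLp_tconv_slice hρ.continuous hc S.meas_F S.memLp_F t).1

theorem WeakSolution.memLp_rpow_mul_slice {α : ℝ} {G F : ℝ × ℝ → ℝ} (S : WeakSolution α G F)
    (hα : α ∈ Ioo (0 : ℝ) 1) {ρ : ℝ → ℝ} (hρ : ContDiff ℝ 1 ρ) (hc : HasCompactSupport ρ)
    (t : ℝ) :
    MemLp (fun x => x ^ (α / 2) * tconv ρ G t x) 2 unitVol := by
  have h := (memLp_tconv_slice hρ.continuous hc S.meas_G S.memLp_G t).1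
  refine h.mono (AEStronglyMeasurable.mul
    (by fun_prop : Measurable fun x : ℝ => x ^ (α / 2)).aestronglyMeasurable h.1) ?_
  filter_upwards [ae_restrict_mem measurableSet_Ioo] with x hx
  obtain ⟨h1, h2⟩ := rpow_half_mem hα.1 hx
  rw [norm_mul, Real.norm_of_nonneg h1]
  exact mul_le_of_le_one_left (norm_nonneg _) h2

theorem WeakSolution.intervalIntegrable_mollH {α : ℝ} {G F : ℝ × ℝ → ℝ} (S : WeakSolution α G F)
    (hα : α ∈ Ioo (0 : ℝ) 1) {ρ : ℝ → ℝ} (hρ : ContDiff ℝ 1 ρ) (hc : HasCompactSupport ρ)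
    (t : ℝ) :
    IntervalIntegrable (fun x => mollQ α G ρ t x - tconv ρ F t x) volume 0 1 := by
  rw [intervalIntegrable_iff_integrableOn_Ioo_of_le zero_le_one]
  exact (S.memLp_mollH_slice hα hρ hc t).integrable one_le_two

/-- The lemma of du Bois-Reymond on the time slice: the mollified flux has a representative given by
a constant minus an integral of u_t - F over (x, 1). The constant is the trace at x = 1. -/
theorem WeakSolution.mollW_ae {α : ℝ} {G F : ℝ × ℝ → ℝ} (S : WeakSolution α G F)
    (hα : α ∈ Ioo (0 : ℝ) 1) {ρ : ℝ → ℝ} (hρ : ContDiff ℝ 1 ρ) (hc : HasCompactSupport ρ)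
    (t : ℝ) :
    ∀ᵐ x ∂unitVol, mollW α G F ρ t x = x ^ (α / 2) * tconv ρ G t x := by
  have hρ' : Continuous (deriv ρ) := hρ.continuous_deriv le_rfl
  have h := ae_eq_of_weak ((S.memLp_rpow_mul_slice hα hρ hc t).integrable one_le_two)
    (S.intervalIntegrable_mollH hα hρ hc t) fun η hη hη1 hη0 => by
      refine (integral_congr_ae ?_).trans (S.mollified_weak hα hρ hc t hη hη1 hη0)
      filter_upwards [ae_restrict_mem measurableSet_Ioo] with x hx
      rw [mollQ_eq hα.2 S.memLp_G hρ' hc t (Ioo_subset_Icc_self hx)]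
  filter_upwards [h] with x hx
  rw [hx]; rfl

theorem WeakSolution.abs_integral_mollH_le {α : ℝ} {G F : ℝ × ℝ → ℝ} (S : WeakSolution α G F)
    (hα : α ∈ Ioo (0 : ℝ) 1) {ρ : ℝ → ℝ} (hρ : ContDiff ℝ 1 ρ) (hc : HasCompactSupport ρ)
    (t : ℝ) {x : ℝ} (hx : x ∈ Icc (0 : ℝ) 1) :
    |∫ ξ in x..1, (mollQ α G ρ t ξ - tconv ρ F t ξ)| ≤
      ∫ ξ, |tconv (deriv ρ) (prim α G) t ξ| ∂unitVol + ∫ ξ, |tconv ρ F t ξ| ∂unitVol := by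
  have hρ' : Continuous (deriv ρ) := hρ.continuous_deriv le_rfl
  have i1 := ((S.memLp_mollH_slice hα hρ hc t).integrable one_le_two)
  have i2 := (memLp_tconv_prim_slice hρ' hc.deriv hα.2 S.meas_G S.memLp_G t).integrable one_le_two
  have i3 := (memLp_tconv_slice hρ.continuous hc S.meas_F S.memLp_F t).1.integrable one_le_two
  have hle : volume.restrict (Ioo x 1) ≤ unitVol :=
    Measure.restrict_mono (Ioo_subset_Ioo_left hx.1) le_rfl
  rw [intervalIntegral.integral_of_le hx.2, integral_Ioc_eq_integral_Ioo,
    ← integral_add i2.abs i3.abs]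
  refine (abs_integral_le_integral_abs (μ := volume.restrict (Ioo x 1))
    (f := fun ξ => mollQ α G ρ t ξ - tconv ρ F t ξ)).trans ?_
  refine (integral_mono_measure hle (ae_of_all _ fun x => abs_nonneg _) i1.abs).trans ?_
  refine integral_mono_ae i1.abs (i2.abs.add i3.abs) ?_
  filter_upwards [ae_restrict_mem measurableSet_Ioo] with x hx
  rw [mollQ_eq hα.2 S.memLp_G hρ' hc t (Ioo_subset_Icc_self hx)]
  exact abs_sub _ _

/-- Every ingredient of the flux is an integral in x of a mollified function, and the L¹ norms of
these slices are bounded uniformly in t. So L² data yield a pointwise bound, without any smoothing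
in x. -/
theorem WeakSolution.exists_mollW_le {α : ℝ} {G F : ℝ × ℝ → ℝ} (S : WeakSolution α G F)
    (hα : α ∈ Ioo (0 : ℝ) 1) {ρ : ℝ → ℝ} (hρ : ContDiff ℝ 1 ρ) (hc : HasCompactSupport ρ) :
    ∃ M, ∀ t, ∀ x ∈ Icc (0 : ℝ) 1, |mollW α G F ρ t x| ≤ M := by
  have hρ' : Continuous (deriv ρ) := hρ.continuous_deriv le_rfl
  obtain ⟨M₁, h1⟩ := exists_integral_abs_tconv_le hρ' hc.deriv (measurable_prim α S.meas_G)
    (memLp_prim hα.2 S.meas_G S.memLp_G)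
  obtain ⟨M₂, h2⟩ := exists_integral_abs_tconv_le hρ.continuous hc S.meas_F S.memLp_F
  obtain ⟨M₃, h3⟩ := exists_integral_abs_tconv_le hρ.continuous hc S.meas_G S.memLp_G
  have hI : ∀ t, ∀ x ∈ Icc (0 : ℝ) 1,
      |∫ ξ in x..1, (mollQ α G ρ t ξ - tconv ρ F t ξ)| ≤ M₁ + M₂ := fun t x hx =>
    (S.abs_integral_mollH_le hα hρ hc t hx).trans (add_le_add (h1 t) (h2 t))
  refine ⟨M₃ + (M₁ + M₂) + (M₁ + M₂), fun t x hx => ?_⟩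
  refine (abs_sub _ _).trans (add_le_add ?_ (hI t x hx))
  have i3 := (memLp_tconv_slice hρ.continuous hc S.meas_G S.memLp_G t).1.integrable one_le_two
  have hb : |mollTrace α G F ρ t| ≤ ∫ y, (|tconv ρ G t y| + (M₁ + M₂)) ∂unitVol := by
    rw [mollTrace, ← Real.norm_eq_abs]
    refine norm_integral_le_of_norm_le (i3.abs.add (integrable_const _)) ?_
    filter_upwards [ae_restrict_mem measurableSet_Ioo] with y hy
    refine (abs_add_le _ _).trans (add_le_add ?_ (hI t y (Ioo_subset_Icc_self hy)))
    obtain ⟨k1, k2⟩ := rpow_half_mem hα.1 hy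
    rw [abs_mul, abs_of_nonneg k1]
    exact mul_le_of_le_one_left (abs_nonneg _) k2
  refine hb.trans ?_
  rw [integral_add i3.abs (integrable_const _)]
  simp only [integral_const, probReal_univ, one_smul]
  linarith [h3 t]

theorem rpow_mul_rpow_neg_half {α x : ℝ} (hx : 0 < x) (a : ℝ) :
    x ^ α * (x ^ (-(α / 2)) * a) = x ^ (α / 2) * a := by
  rw [← mul_assoc, ← Real.rpow_add hx]; congr 2; ring

/-- Mollification in time makes weak solutions regular. -/
theorem WeakSolution.regular {α : ℝ} {G F : ℝ × ℝ → ℝ} (S : WeakSolution α G F)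
    (hα : α ∈ Ioo (0 : ℝ) 1) {ρ : ℝ → ℝ} (hρ : ContDiff ℝ 2 ρ) (hc : HasCompactSupport ρ)
    {t₀ t₁ : ℝ} (hv : ∀ t, t = t₀ ∨ t = t₁ → ∀ τ x, ρ (t - τ) * G (τ, x) = 0) :
    RegularSolution α t₀ t₁ (fun t x => ∫ ξ in (0 : ℝ)..x, ξ ^ (-(α / 2)) * tconv ρ G t ξ)
      (fun t x => x ^ (-(α / 2)) * tconv ρ G t x) (mollQ α G ρ)
      (fun t x => x ^ (-(α / 2)) * tconv (deriv ρ) G t x) (mollW α G F ρ) (tconv ρ F) := by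
  have hρ1 : ContDiff ℝ 1 ρ := hρ.of_le one_le_two
  have hρ'1 : ContDiff ℝ 1 (deriv ρ) := hρ.deriv'
  have hρ0 : Continuous ρ := hρ.continuous
  have hρ' : Continuous (deriv ρ) := hρ'1.continuous
  have hmr : Measurable fun z : ℝ × ℝ => z.2 ^ (-(α / 2)) := by fun_prop
  have hone : ∀ {κ : ℝ → ℝ}, Continuous κ → HasCompactSupport κ → ∀ t,
      ∫ ξ in (0 : ℝ)..1, ξ ^ (-(α / 2)) * tconv κ G t ξ = 0 := fun {κ} hκ hκc t => by
    rw [← tconv_prim hκ hκc hα.2 S.memLp_G t (right_mem_Icc.2 zero_le_one)]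
    refine integral_eq_zero_of_ae ?_
    filter_upwards [S.boundary] with τ hτ
    rw [hτ, mul_zero]; rfl
  have hz : ∀ t, t = t₀ ∨ t = t₁ → ∀ x, tconv ρ G t x = 0 := fun t ht x => by
    rw [tconv]; simp only [hv t ht]; simp
  constructor
  · exact hmr.mul (measurable_tconv hρ0.measurable S.meas_G)
  · exact hmr.mul (measurable_tconv hρ'.measurable S.meas_G)
  · exact measurable_prim α (measurable_tconv hρ0.measurable S.meas_G)
  · exact measurable_mollQ α S.meas_G hρ'
  · exact measurable_mollW α S.meas_G S.meas_F hρ1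
  · have hP2 := memLp_prim hα.2 S.meas_G S.memLp_G
    filter_upwards [ae_memLp_slice S.meas_G S.memLp_G,
      ae_memLp_slice (measurable_prim α S.meas_G) hP2,
      ae_restrict_mem measurableSet_Ioo] with x hx hx2 hxm t
    have hxm' := Ioo_subset_Icc_self hxm
    refine ⟨?_, (hasDerivAt_tconv hρ1 hc hx t).const_mul _⟩
    have := hasDerivAt_tconv hρ1 hc hx2 t
    rw [mollQ_eq hα.2 S.memLp_G hρ' hc t hxm']
    exact this.congr_of_eventuallyEq (Eventually.of_forall fun t =>
      (tconv_prim hρ0 hc hα.2 S.memLp_G t hxm').symm)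
  · intro t ht x
    simp only [hz t ht]; simp
  · exact fun t x => rfl
  · exact fun t x => rfl
  · exact fun t => hone hρ0 hc t
  · exact fun t => hone hρ' hc.deriv t
  · intro t x
    simp only [mollW, intervalIntegral.integral_same, sub_zero]
  · intro t
    filter_upwards [S.mollW_ae hα hρ1 hc t, ae_restrict_mem measurableSet_Ioo] with x hx hxm
    rw [hx, rpow_mul_rpow_neg_half hxm.1]
  -- x^α u_xt is almost everywhere the flux built with the kernel `deriv ρ`, hence bounded by the
  -- same lemma. This is the reason for requiring ρ to be of class C².
  · obtain ⟨M₁, h1⟩ := S.exists_mollW_le hα hρ1 hc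
    obtain ⟨M₂, h2⟩ := S.exists_mollW_le hα hρ'1 hc.deriv
    refine ⟨max M₁ M₂, fun t => ⟨fun x hx => (h1 t x hx).trans (le_max_left _ _), ?_⟩⟩
    filter_upwards [S.mollW_ae hα hρ'1 hc.deriv t, ae_restrict_mem measurableSet_Ioo] with x hx hxm
    rw [rpow_mul_rpow_neg_half hxm.1, ← hx]
    exact (h2 t x (Ioo_subset_Icc_self hxm)).trans (le_max_right _ _)
  · exact memLp_tconv hρ0 hc S.meas_F S.memLp_F t₀ t₁
  · intro t
    rw [intervalIntegrable_iff_integrableOn_Ioo_of_le zero_le_one]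
    exact (memLp_tconv_slice hρ0 hc S.meas_F S.memLp_F t).1.integrable one_le_two

/-! ### Convergence of mollifications in L² -/

theorem eLpNorm_two_sq {X : Type*} [MeasurableSpace X] (μ : Measure X) (f : X → ℝ) :
    eLpNorm f 2 μ ^ 2 = ∫⁻ x, ‖f x‖ₑ ^ 2 ∂μ := by
  rw [eLpNorm_eq_lintegral_rpow_enorm_toReal two_ne_zero ENNReal.ofNat_ne_top]
  rw [← ENNReal.rpow_natCast, ← ENNReal.rpow_mul]
  simp

theorem enorm_sq_eq (a : ℝ) : ‖a‖ₑ ^ 2 = ENNReal.ofReal (a ^ 2) := by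
  rw [Real.enorm_eq_ofReal_abs, ← ENNReal.ofReal_pow (abs_nonneg _), sq_abs]

theorem measurePreserving_shift (σ : ℝ) :
    MeasurePreserving (fun z : ℝ × ℝ => (z.1 - σ, z.2)) (volume.prod unitVol)
      (volume.prod unitVol) :=
  (measurePreserving_sub_right volume σ).prod (MeasurePreserving.id unitVol)

/-- Translations in time are continuous in `L²`. -/
theorem tendsto_eLpNorm_shift {g : ℝ × ℝ → ℝ} (hg2 : MemLp g 2 (volume.prod unitVol)) :
    Tendsto (fun σ : ℝ => eLpNorm (fun z : ℝ × ℝ => g (z.1 - σ, z.2) - g z) 2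
      (volume.prod unitVol)) (𝓝 0) (𝓝 0) := by
  -- The translations form a continuous curve in the space of continuous maps, and composition of L²
  -- functions with measure-preserving maps is continuous with respect to it.
  let Φ : C(ℝ × (ℝ × ℝ), ℝ × ℝ) := ⟨fun w => (w.2.1 - w.1, w.2.2), by fun_prop⟩
  have hΦ : Continuous fun σ : ℝ => Φ.curry σ := Φ.curry.continuous
  have : (volume.prod unitVol : Measure (ℝ × ℝ)).InnerRegularCompactLTTop := inferInstance
  have h := (tendsto_const_nhds (x := hg2.toLp g) (f := 𝓝 (0 : ℝ))).compMeasurePreservingLp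
    (hΦ.tendsto 0) (fun σ => measurePreserving_shift σ) (measurePreserving_shift 0)
    (by norm_num)
  rw [tendsto_iff_edist_tendsto_0] at h
  refine h.congr fun σ => ?_
  rw [Lp.edist_def]
  refine eLpNorm_congr_ae ?_
  have h0 := hg2.coeFn_toLp
  have h1 := Lp.coeFn_compMeasurePreserving (hg2.toLp g) (measurePreserving_shift σ)
  have h2 := Lp.coeFn_compMeasurePreserving (hg2.toLp g) (measurePreserving_shift 0)
  have h3 := (measurePreserving_shift σ).quasiMeasurePreserving.ae h0
  have h4 := (measurePreserving_shift 0).quasiMeasurePreserving.ae h0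
  filter_upwards [h1, h2, h3, h4] with z a1 a2 a3 a4
  simp only [Pi.sub_apply, Function.comp_apply] at *
  erw [a1, a2]
  rw [a3, a4, sub_zero]

/-- Jensen's inequality for the square. -/
theorem sq_lintegral_mul_le {ρ : ℝ → ENNReal} (hρ : Measurable ρ) (h1 : ∫⁻ σ, ρ σ = 1)
    {X : ℝ → ENNReal} (hX : Measurable X) :
    (∫⁻ σ, ρ σ * X σ) ^ 2 ≤ ∫⁻ σ, ρ σ * X σ ^ 2 := by
  -- Hölder's inequality for 1 and X with respect to the probability measure of density ρ.
  have h := ENNReal.lintegral_mul_le_Lp_mul_Lq (volume.withDensity ρ)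
    (Real.HolderConjugate.two_two) (f := fun _ => 1) (g := X) measurable_const.aemeasurable
    hX.aemeasurable
  simp only [Pi.mul_apply, one_mul, ENNReal.one_rpow, lintegral_const, withDensity_apply _ MeasurableSet.univ,
    Measure.restrict_univ, h1, one_mul] at h
  rw [lintegral_withDensity_eq_lintegral_mul _ hρ hX,
    lintegral_withDensity_eq_lintegral_mul _ hρ (hX.pow_const _)] at h
  simp only [Pi.mul_apply] at h
  calc (∫⁻ σ, ρ σ * X σ) ^ 2 ≤ ((∫⁻ σ, ρ σ * X σ ^ (2 : ℝ)) ^ (1 / (2 : ℝ))) ^ 2 := by gcongr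
    _ = _ := by
      rw [← ENNReal.rpow_natCast, ← ENNReal.rpow_mul]
      simp

theorem enorm_tconv_sub_le {ρ : ℝ → ℝ} (hρ : Continuous ρ) (hc : HasCompactSupport ρ)
    (h0 : ∀ σ, 0 ≤ ρ σ) (h1 : ∫ σ, ρ σ = 1) {g : ℝ × ℝ → ℝ} {x : ℝ}
    (hx : MemLp (fun τ => g (τ, x)) 2 volume) (hg : Measurable g) (t : ℝ) :
    ‖tconv ρ g t x - g (t, x)‖ₑ ^ 2 ≤
      ∫⁻ σ, ENNReal.ofReal (ρ σ) * ‖g (t - σ, x) - g (t, x)‖ₑ ^ 2 := by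
  have hi : Integrable (fun σ => ρ σ * g (t - σ, x)) := by
    have h3 : MemLp (fun σ => g (t - σ, x)) 2 volume :=
      hx.comp_measurePreserving (Measure.measurePreserving_sub_left volume t)
    exact (hρ.memLp_of_hasCompactSupport (p := 2) hc).integrable_mul h3
  have hρi : Integrable ρ := hρ.integrable_of_hasCompactSupport hc
  have e1 : tconv ρ g t x = ∫ σ, ρ σ * g (t - σ, x) := by
    rw [tconv, ← integral_sub_left_eq_self _ volume t]
    simp
  have e2 : tconv ρ g t x - g (t, x) = ∫ σ, ρ σ * (g (t - σ, x) - g (t, x)) := by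
    simp only [mul_sub]
    rw [integral_sub hi (hρi.mul_const _), integral_mul_const, h1, one_mul, e1]
  have e3 : ∫⁻ σ, ENNReal.ofReal (ρ σ) = 1 := by
    rw [← ofReal_integral_eq_lintegral_ofReal hρi (ae_of_all _ h0), h1, ENNReal.ofReal_one]
  rw [e2]
  refine le_trans ?_ (sq_lintegral_mul_le (hρ.measurable.ennreal_ofReal) e3 (by fun_prop))
  gcongr
  refine (enorm_integral_le_lintegral_enorm _).trans_eq (lintegral_congr fun σ => ?_)
  rw [enorm_mul, Real.enorm_of_nonneg (h0 σ)]

/-- By Jensen and Tonelli the squared mollification error is at most the ρ-average of the squared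
translation errors. -/
theorem lintegral_tconv_sub_le {ρ : ℝ → ℝ} (hρ : Continuous ρ) (hc : HasCompactSupport ρ)
    (h0 : ∀ σ, 0 ≤ ρ σ) (h1 : ∫ σ, ρ σ = 1) {g : ℝ × ℝ → ℝ} (hg : Measurable g)
    (hg2 : MemLp g 2 (volume.prod unitVol)) {ε : ENNReal}
    (hε : ∀ σ, ρ σ ≠ 0 → eLpNorm (fun z : ℝ × ℝ => g (z.1 - σ, z.2) - g z) 2
      (volume.prod unitVol) ≤ ε) :
    eLpNorm (fun z : ℝ × ℝ => tconv ρ g z.1 z.2 - g z) 2 (volume.prod unitVol) ≤ ε := by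
  have hρi : Integrable ρ := hρ.integrable_of_hasCompactSupport hc
  have e3 : ∫⁻ σ, ENNReal.ofReal (ρ σ) = 1 := by
    rw [← ofReal_integral_eq_lintegral_ofReal hρi (ae_of_all _ h0), h1, ENNReal.ofReal_one]
  rw [← ENNReal.pow_le_pow_left_iff two_ne_zero, eLpNorm_two_sq]
  calc ∫⁻ z, ‖tconv ρ g z.1 z.2 - g z‖ₑ ^ 2 ∂(volume.prod unitVol)
      ≤ ∫⁻ z, ∫⁻ σ, ENNReal.ofReal (ρ σ) * ‖g (z.1 - σ, z.2) - g z‖ₑ ^ 2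
          ∂volume ∂(volume.prod unitVol) := by
        refine lintegral_mono_ae ?_
        have := (Measure.quasiMeasurePreserving_snd (μ := (volume : Measure ℝ))
          (ν := unitVol)).ae (ae_memLp_slice hg hg2)
        filter_upwards [this] with z hz
        exact enorm_tconv_sub_le hρ hc h0 h1 hz hg z.1
    _ = ∫⁻ σ, ∫⁻ z, ENNReal.ofReal (ρ σ) * ‖g (z.1 - σ, z.2) - g z‖ₑ ^ 2
          ∂(volume.prod unitVol) := by
        rw [lintegral_lintegral_swap]
        have := hρ.measurable
        exact Measurable.aemeasurable (by unfold Function.uncurry; fun_prop)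
    _ ≤ ∫⁻ σ, ENNReal.ofReal (ρ σ) * ε ^ 2 := by
        refine lintegral_mono fun σ => ?_
        rw [lintegral_const_mul _ (by fun_prop)]
        by_cases hσ : ρ σ = 0
        · simp [hσ]
        · gcongr
          rw [← eLpNorm_two_sq]
          gcongr
          exact hε σ hσ
    _ = ε ^ 2 := by
        have := hρ.measurable
        rw [lintegral_mul_const _ (by fun_prop), e3, one_mul]

/-- An approximate identity: smooth kernels concentrating at `0`. -/
structure IsMollifier (ε : ℝ) (ρ : ℕ → ℝ → ℝ) : Prop where
  contDiff : ∀ n, ContDiff ℝ 2 (ρ n)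
  compact : ∀ n, HasCompactSupport (ρ n)
  nonneg : ∀ n σ, 0 ≤ ρ n σ
  integral : ∀ n, ∫ σ, ρ n σ = 1
  support : ∀ n σ, ρ n σ ≠ 0 → |σ| < ε / (n + 1)

theorem exists_isMollifier {ε : ℝ} (hε : 0 < ε) : ∃ ρ, IsMollifier ε ρ := by
  let f : ℕ → ContDiffBump (0 : ℝ) := fun n =>
    ⟨ε / (n + 1) / 2, ε / (n + 1), by positivity, half_lt_self (by positivity)⟩
  refine ⟨fun n => (f n).normed volume, fun n => (f n).contDiff_normed (n := 2),
    fun n => (f n).hasCompactSupport_normed, fun n σ => (f n).nonneg_normed σ,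
    fun n => (f n).integral_normed, fun n σ h => ?_⟩
  have : σ ∈ Function.support ((f n).normed volume) := h
  rw [(f n).support_normed_eq, mem_ball_zero_iff] at this
  exact this

theorem IsMollifier.tendsto {ε : ℝ} {ρ : ℕ → ℝ → ℝ} (h : IsMollifier ε ρ) {g : ℝ × ℝ → ℝ}
    (hg : Measurable g) (hg2 : MemLp g 2 (volume.prod unitVol)) :
    Tendsto (fun n => eLpNorm (fun z : ℝ × ℝ => tconv (ρ n) g z.1 z.2 - g z) 2
      (volume.prod unitVol)) atTop (𝓝 0) := by
  rw [ENNReal.tendsto_atTop_zero]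
  intro δ hδ
  have h1 := (ENNReal.tendsto_nhds_zero.1 (tendsto_eLpNorm_shift hg2)) δ hδ
  obtain ⟨r, hr, hr2⟩ := Metric.eventually_nhds_iff.1 h1
  have h2 : Tendsto (fun n : ℕ => ε / ((n : ℝ) + 1)) atTop (𝓝 0) :=
    ((tendsto_const_div_atTop_nhds_zero_nat ε).comp (tendsto_add_atTop_nat 1)).congr fun n => by
      simp
  obtain ⟨N, hN⟩ := eventually_atTop.1 (h2.eventually_lt_const hr)
  refine ⟨N, fun n hn => lintegral_tconv_sub_le (h.contDiff n).continuous (h.compact n)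
    (h.nonneg n) (h.integral n) hg hg2 fun σ hσ => hr2 ?_⟩
  rw [dist_zero_right]
  exact (h.support n σ hσ).trans (hN n hn)

/-- Completeness of `L²`. -/
theorem exists_tendsto_of_cauchy {X : Type*} [MeasurableSpace X] {μ : Measure X} {f : ℕ → X → ℝ}
    (hf : ∀ n, MemLp (f n) 2 μ)
    (hc : ∀ δ : ENNReal, 0 < δ → ∃ N, ∀ n m, N ≤ n → N ≤ m → eLpNorm (f n - f m) 2 μ < δ) :
    ∃ g, Measurable g ∧ MemLp g 2 μ ∧ Tendsto (fun n => eLpNorm (f n - g) 2 μ) atTop (𝓝 0) := by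
  have : CauchySeq fun n => (hf n).toLp (f n) := by
    rw [EMetric.cauchySeq_iff]
    intro δ hδ
    obtain ⟨N, hN⟩ := hc δ hδ
    exact ⟨N, fun n hn m hm => by rw [Lp.edist_toLp_toLp]; exact hN n m hn hm⟩
  obtain ⟨L, hL⟩ := cauchySeq_tendsto_of_complete this
  have hLm := Lp.aestronglyMeasurable L
  refine ⟨hLm.mk L, hLm.stronglyMeasurable_mk.measurable,
    (Lp.memLp L).ae_eq hLm.ae_eq_mk, ?_⟩
  rw [tendsto_iff_edist_tendsto_0] at hL
  refine hL.congr fun n => ?_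
  rw [Lp.edist_def]
  refine eLpNorm_congr_ae ?_
  filter_upwards [(hf n).coeFn_toLp, hLm.ae_eq_mk] with x h1 h2
  simp only [Pi.sub_apply, h1, h2]

/-! ### Time derivatives and the trace of the flux at x = 1 -/

/-- Lebesgue measure on the strip `(t₀, t₁) × (0, 1)`. -/
abbrev stripVol (t₀ t₁ : ℝ) : Measure (ℝ × ℝ) := (volume.restrict (Ioo t₀ t₁)).prod unitVol

theorem stripVol_le (t₀ t₁ : ℝ) : stripVol t₀ t₁ ≤ volume.prod unitVol :=
  Measure.prod_mono Measure.restrict_le_self le_rfl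

theorem ae_stripVol_of_ae {P : ℝ → Prop} (h : ∀ᵐ x ∂unitVol, P x) (t₀ t₁ : ℝ) :
    ∀ᵐ z ∂(stripVol t₀ t₁), P z.2 :=
  (Measure.quasiMeasurePreserving_snd (μ := volume.restrict (Ioo t₀ t₁)) (ν := unitVol)).ae h

theorem tconv_sub_ae {ρ ρ' : ℝ → ℝ} (hρ : Continuous ρ) (hc : HasCompactSupport ρ)
    (hρ' : Continuous ρ') (hc' : HasCompactSupport ρ') {g : ℝ × ℝ → ℝ} (hg : Measurable g)
    (hg2 : MemLp g 2 (volume.prod unitVol)) :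
    ∀ᵐ x ∂unitVol, ∀ t, tconv (ρ - ρ') g t x = tconv ρ g t x - tconv ρ' g t x := by
  filter_upwards [ae_memLp_slice hg hg2] with x hx t
  have i1 := (memLp_kernel hρ hc t).integrable_mul hx
  have i2 := (memLp_kernel hρ' hc' t).integrable_mul hx
  simp only [tconv, Pi.sub_apply, sub_mul]
  exact integral_sub i1 i2

theorem memLp_mollQ {α : ℝ} (hα : α < 1) {G : ℝ × ℝ → ℝ} (hG : Measurable G)
    (hG2 : MemLp G 2 (volume.prod unitVol)) {ρ : ℝ → ℝ} (hρ : ContDiff ℝ 1 ρ)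
    (hc : HasCompactSupport ρ) (t₀ t₁ : ℝ) :
    MemLp (fun z : ℝ × ℝ => mollQ α G ρ z.1 z.2) 2 (stripVol t₀ t₁) := by
  have hρ' : Continuous (deriv ρ) := hρ.continuous_deriv le_rfl
  refine (memLp_congr_ae ?_).1
    (memLp_tconv hρ' hc.deriv (measurable_prim α hG) (memLp_prim hα hG hG2) t₀ t₁)
  filter_upwards [ae_prod_mem_unit _] with z hz
  exact (mollQ_eq hα hG2 hρ' hc z.1 (Ioo_subset_Icc_self hz)).symm

theorem mollQ_sub_ae {α : ℝ} (hα : α < 1) {G : ℝ × ℝ → ℝ} (hG : Measurable G)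
    (hG2 : MemLp G 2 (volume.prod unitVol)) {ρ ρ' : ℝ → ℝ} (hρ : ContDiff ℝ 1 ρ)
    (hc : HasCompactSupport ρ) (hρ' : ContDiff ℝ 1 ρ') (hc' : HasCompactSupport ρ') :
    ∀ᵐ x ∂unitVol, ∀ t, mollQ α G (ρ - ρ') t x = mollQ α G ρ t x - mollQ α G ρ' t x := by
  have h1 : Continuous (deriv ρ) := hρ.continuous_deriv le_rfl
  have h2 : Continuous (deriv ρ') := hρ'.continuous_deriv le_rfl
  have hd : deriv (ρ - ρ') = deriv ρ - deriv ρ' := by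
    ext x
    exact deriv_sub (hρ.differentiable one_ne_zero x) (hρ'.differentiable one_ne_zero x)
  filter_upwards [tconv_sub_ae h1 hc.deriv h2 hc'.deriv (measurable_prim α hG)
    (memLp_prim hα hG hG2), ae_restrict_mem measurableSet_Ioo] with x hx hxm t
  have hxm' := Ioo_subset_Icc_self hxm
  rw [mollQ_eq hα hG2 (by rw [hd]; exact h1.sub h2) (hc.sub hc') t hxm',
    mollQ_eq hα hG2 h1 hc t hxm', mollQ_eq hα hG2 h2 hc' t hxm', hd, hx t]

theorem eLpNorm_two_le_iff {X : Type*} [MeasurableSpace X] {μ : Measure X} {f g : X → ℝ} :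
    eLpNorm f 2 μ ≤ eLpNorm g 2 μ ↔ ∫⁻ x, ‖f x‖ₑ ^ 2 ∂μ ≤ ∫⁻ x, ‖g x‖ₑ ^ 2 ∂μ := by
  rw [← ENNReal.pow_le_pow_left_iff two_ne_zero, eLpNorm_two_sq, eLpNorm_two_sq]

/-- The energy estimate for differences of mollified solutions. -/
theorem WeakSolution.eLpNorm_mollQ_sub_le {α : ℝ} {G F : ℝ × ℝ → ℝ} (S : WeakSolution α G F)
    (hα : α ∈ Ioo (0 : ℝ) 1) {ρ ρ' : ℝ → ℝ} (hρ : ContDiff ℝ 2 ρ) (hc : HasCompactSupport ρ)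
    (hρ' : ContDiff ℝ 2 ρ') (hc' : HasCompactSupport ρ') {t₀ t₁ : ℝ} (ht : t₀ ≤ t₁)
    (hv : ∀ t, t = t₀ ∨ t = t₁ → ∀ τ x, ρ (t - τ) * G (τ, x) = 0)
    (hv' : ∀ t, t = t₀ ∨ t = t₁ → ∀ τ x, ρ' (t - τ) * G (τ, x) = 0) :
    eLpNorm (fun z : ℝ × ℝ => mollQ α G ρ z.1 z.2 - mollQ α G ρ' z.1 z.2) 2 (stripVol t₀ t₁) ≤
      eLpNorm (fun z : ℝ × ℝ => tconv ρ F z.1 z.2 - tconv ρ' F z.1 z.2) 2 (stripVol t₀ t₁) := by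
  -- Everything is linear in the kernel and regularity needs neither sign nor mass, so the
  -- difference of two mollifications is again a regular solution.
  have R := S.regular hα (ρ := ρ - ρ') (hρ.sub hρ') (hc.sub hc') (t₀ := t₀) (t₁ := t₁) fun t ht τ x => by
    rw [Pi.sub_apply, sub_mul, hv t ht, hv' t ht, sub_zero]
  have hE := R.energy hα ht
  rw [ofReal_integral_eq_lintegral_ofReal R.F_memLp.integrable_sq
    (ae_of_all _ fun _ => sq_nonneg _)] at hE
  simp only [← enorm_sq_eq] at hE
  rw [← eLpNorm_two_le_iff] at hE
  have e1 := ae_stripVol_of_ae (mollQ_sub_ae hα.2 S.meas_G S.memLp_G (hρ.of_le one_le_two) hc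
    (hρ'.of_le one_le_two) hc') t₀ t₁
  have e2 := ae_stripVol_of_ae (tconv_sub_ae hρ.continuous hc hρ'.continuous hc' S.meas_F
    S.memLp_F) t₀ t₁
  refine (eLpNorm_congr_ae ?_).trans_le (hE.trans_eq (eLpNorm_congr_ae ?_))
  · filter_upwards [e1] with z hz
    exact (hz z.1).symm
  · filter_upwards [e2] with z hz
    exact hz z.1

/-- G keeps a distance ε from the end times and the kernels live in (-ε, ε). So mollified solutions
vanish at t₀ and t₁, as `RegularSolution` requires. -/
theorem IsMollifier.vanish {ε : ℝ} {ρ : ℕ → ℝ → ℝ} (h : IsMollifier ε ρ) {t₀ t₁ : ℝ}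
    {G : ℝ × ℝ → ℝ} (hG : ∀ τ x, τ ∉ Ioo (t₀ + ε) (t₁ - ε) → G (τ, x) = 0) (hε : 0 < ε) (n : ℕ)
    (t : ℝ) (ht : t = t₀ ∨ t = t₁) (τ x : ℝ) : ρ n (t - τ) * G (τ, x) = 0 := by
  by_cases h0 : ρ n (t - τ) = 0
  · rw [h0, zero_mul]
  · have h1 := (h.support n _ h0).trans_le (div_le_self hε.le (by
      have : (0 : ℝ) ≤ n := n.cast_nonneg
      linarith))
    rw [abs_lt] at h1
    rw [hG τ x, mul_zero]
    rintro ⟨h2, h3⟩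
    rcases ht with rfl | rfl <;> linarith

theorem tendsto_eLpNorm_mono {X : Type*} [MeasurableSpace X] {μ ν : Measure X} (h : μ ≤ ν)
    {f : ℕ → X → ℝ} (hf : Tendsto (fun n => eLpNorm (f n) 2 ν) atTop (𝓝 0)) :
    Tendsto (fun n => eLpNorm (f n) 2 μ) atTop (𝓝 0) :=
  tendsto_of_tendsto_of_tendsto_of_le_of_le tendsto_const_nhds hf (fun _ => bot_le)
    fun n => eLpNorm_mono_measure (f n) h

theorem cauchy_of_tendsto {X : Type*} [MeasurableSpace X] {μ : Measure X} {f : ℕ → X → ℝ}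
    {g : X → ℝ} (hf : ∀ n, AEStronglyMeasurable (f n) μ) (hg : AEStronglyMeasurable g μ)
    (h : Tendsto (fun n => eLpNorm (f n - g) 2 μ) atTop (𝓝 0)) {δ : ENNReal} (hδ : 0 < δ) :
    ∃ N, ∀ n m, N ≤ n → N ≤ m → eLpNorm (f n - f m) 2 μ < δ := by
  obtain ⟨δ', hδ', hlt⟩ := exists_between (ENNReal.half_pos hδ.ne')
  obtain ⟨N, hN⟩ := (ENNReal.tendsto_atTop_zero.1 h) δ' hδ'
  refine ⟨N, fun n m hn hm => ?_⟩
  have e : f n - f m = (f n - g) - (f m - g) := by abel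
  calc eLpNorm (f n - f m) 2 μ ≤ eLpNorm (f n - g) 2 μ + eLpNorm (f m - g) 2 μ := by
        rw [e]; exact eLpNorm_sub_le ((hf n).sub hg) ((hf m).sub hg) one_le_two
    _ ≤ δ' + δ' := add_le_add (hN n hn) (hN m hm)
    _ < δ / 2 + δ / 2 := ENNReal.add_lt_add hlt hlt
    _ = δ := ENNReal.add_halves δ

/-- The time derivatives of the mollified solutions converge. -/
theorem WeakSolution.exists_timeDeriv {α : ℝ} {G F : ℝ × ℝ → ℝ} (S : WeakSolution α G F)
    (hα : α ∈ Ioo (0 : ℝ) 1) {ε : ℝ} (hε : 0 < ε) {ρ : ℕ → ℝ → ℝ} (hρ : IsMollifier ε ρ)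
    {t₀ t₁ : ℝ} (ht : t₀ ≤ t₁) (hG : ∀ τ x, τ ∉ Ioo (t₀ + ε) (t₁ - ε) → G (τ, x) = 0) :
    ∃ g : ℝ × ℝ → ℝ, Measurable g ∧ MemLp g 2 (stripVol t₀ t₁) ∧
      Tendsto (fun n => eLpNorm ((fun z : ℝ × ℝ => mollQ α G (ρ n) z.1 z.2) - g) 2
        (stripVol t₀ t₁)) atTop (𝓝 0) := by
  have h1 := tendsto_eLpNorm_mono (stripVol_le t₀ t₁) (hρ.tendsto S.meas_F S.memLp_F)
  have h2 := fun n m => S.eLpNorm_mollQ_sub_le hα (hρ.contDiff n) (hρ.compact n)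
    (hρ.contDiff m) (hρ.compact m) ht (hρ.vanish hG hε n) (hρ.vanish hG hε m)
  have hm : ∀ n, AEStronglyMeasurable (fun z : ℝ × ℝ => tconv (ρ n) F z.1 z.2)
      (stripVol t₀ t₁) := fun n =>
    (measurable_tconv (hρ.contDiff n).continuous.measurable S.meas_F).aestronglyMeasurable
  refine exists_tendsto_of_cauchy (f := fun n (z : ℝ × ℝ) => mollQ α G (ρ n) z.1 z.2)
    (fun n => memLp_mollQ hα.2 S.meas_G S.memLp_G
    ((hρ.contDiff n).of_le one_le_two) (hρ.compact n) t₀ t₁) fun δ hδ => ?_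
  obtain ⟨N, hN⟩ := cauchy_of_tendsto hm S.meas_F.aestronglyMeasurable h1 hδ
  exact ⟨N, fun n m hn hm => lt_of_le_of_lt (h2 n m) (hN n m hn hm)⟩

/-- Operators acting in `x` that are bounded from `L²(0,1)` to `L^∞(0,1)`. -/
theorem eLpNorm_le_of_slice {μ : Measure ℝ} [SFinite μ] {K H : ℝ × ℝ → ℝ} (hH : Measurable H)
    {c : ENNReal}
    (h : ∀ᵐ z ∂(μ.prod unitVol), ‖K z‖ₑ ^ 2 ≤ c ^ 2 * ∫⁻ ξ, ‖H (z.1, ξ)‖ₑ ^ 2 ∂unitVol) :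
    eLpNorm K 2 (μ.prod unitVol) ≤ c * eLpNorm H 2 (μ.prod unitVol) := by
  rw [← ENNReal.pow_le_pow_left_iff two_ne_zero, mul_pow, eLpNorm_two_sq, eLpNorm_two_sq]
  have hm : Measurable fun t : ℝ => ∫⁻ ξ, ‖H (t, ξ)‖ₑ ^ 2 ∂unitVol :=
    (show Measurable fun z => ‖H z‖ₑ ^ 2 by fun_prop).lintegral_prod_right'
  calc ∫⁻ z, ‖K z‖ₑ ^ 2 ∂(μ.prod unitVol)
      ≤ ∫⁻ z, c ^ 2 * ∫⁻ ξ, ‖H (z.1, ξ)‖ₑ ^ 2 ∂unitVol ∂(μ.prod unitVol) := lintegral_mono_ae h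
    _ = c ^ 2 * ∫⁻ z : ℝ × ℝ, ∫⁻ ξ, ‖H (z.1, ξ)‖ₑ ^ 2 ∂unitVol ∂(μ.prod unitVol) :=
        lintegral_const_mul _ (hm.comp measurable_fst)
    _ = c ^ 2 * ∫⁻ z, ‖H z‖ₑ ^ 2 ∂(μ.prod unitVol) := by
        rw [lintegral_prod (fun z : ℝ × ℝ => ∫⁻ ξ, ‖H (z.1, ξ)‖ₑ ^ 2 ∂unitVol)
          (hm.comp measurable_fst).aemeasurable, lintegral_prod _ (by fun_prop : Measurable fun z => ‖H z‖ₑ ^ 2).aemeasurable]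
        simp

theorem lintegral_enorm_sq_eq {g : ℝ → ℝ} (hg : MemLp g 2 unitVol) :
    ∫⁻ ξ, ‖g ξ‖ₑ ^ 2 ∂unitVol = ENNReal.ofReal (∫ ξ, g ξ ^ 2 ∂unitVol) := by
  rw [ofReal_integral_eq_lintegral_ofReal hg.integrable_sq (ae_of_all _ fun _ => sq_nonneg _)]
  simp only [enorm_sq_eq]

theorem enorm_sq_integral_le {g : ℝ → ℝ} (hg : MemLp g 2 unitVol) {s : Set ℝ}
    (hs : s ⊆ Ioo 0 1) : ‖∫ ξ in s, g ξ‖ₑ ^ 2 ≤ ∫⁻ ξ, ‖g ξ‖ₑ ^ 2 ∂unitVol := by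
  rw [lintegral_enorm_sq_eq hg, enorm_sq_eq]
  have := sq_integral_Ioo_le (memLp_const (1 : ℝ)) hg hs
  simp only [one_mul, one_pow, integral_const, probReal_univ, smul_eq_mul] at this
  exact ENNReal.ofReal_le_ofReal this

/-- Integration over `(x, 1)`. -/
def tailInt (H : ℝ × ℝ → ℝ) (z : ℝ × ℝ) : ℝ := ∫ ξ in z.2..1, H (z.1, ξ)

theorem tailInt_eq {H : ℝ × ℝ → ℝ} {z : ℝ × ℝ} (hz : z.2 ≤ 1) :
    tailInt H z = ∫ ξ in Ioo z.2 1, H (z.1, ξ) := by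
  rw [tailInt, intervalIntegral.integral_of_le hz, integral_Ioc_eq_integral_Ioo]

theorem measurable_tailInt {H : ℝ × ℝ → ℝ} (hH : Measurable H) : Measurable (tailInt H) :=
  measurable_intervalIntegral hH measurable_snd measurable_const

theorem ae_slice_prod {μ : Measure ℝ} [SFinite μ] {H : ℝ × ℝ → ℝ} (hH : Measurable H)
    (hH2 : MemLp H 2 (μ.prod unitVol)) :
    ∀ᵐ z ∂(μ.prod unitVol), MemLp (fun ξ => H (z.1, ξ)) 2 unitVol :=
  (Measure.quasiMeasurePreserving_fst (μ := μ) (ν := unitVol)).ae (ae_memLp_slice_right hH hH2)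

theorem eLpNorm_tailInt_sub_le {μ : Measure ℝ} [SFinite μ] {H K : ℝ × ℝ → ℝ} (hH : Measurable H)
    (hH2 : MemLp H 2 (μ.prod unitVol)) (hK : Measurable K) (hK2 : MemLp K 2 (μ.prod unitVol)) :
    eLpNorm (tailInt H - tailInt K) 2 (μ.prod unitVol) ≤ eLpNorm (H - K) 2 (μ.prod unitVol) := by
  rw [← one_mul (eLpNorm (H - K) 2 (μ.prod unitVol))]
  refine eLpNorm_le_of_slice (hH.sub hK) ?_
  filter_upwards [ae_slice_prod hH hH2, ae_slice_prod hK hK2, ae_prod_mem_unit μ] with z h1 h2 hz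
  have hsub : Ioo z.2 1 ⊆ Ioo 0 1 := Ioo_subset_Ioo_left hz.1.le
  have hle : volume.restrict (Ioo z.2 1) ≤ unitVol := Measure.restrict_mono hsub le_rfl
  rw [one_pow, one_mul, Pi.sub_apply, tailInt_eq hz.2.le, tailInt_eq hz.2.le, ← integral_sub
    ((h1.integrable one_le_two).mono_measure hle) ((h2.integrable one_le_two).mono_measure hle)]
  exact enorm_sq_integral_le (h1.sub h2) hsub

theorem eLpNorm_fst {t₀ t₁ : ℝ} {b : ℝ → ℝ} (hb : Measurable b) :
    eLpNorm (fun z : ℝ × ℝ => b z.1) 2 (stripVol t₀ t₁) =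
      eLpNorm b 2 (volume.restrict (Ioo t₀ t₁)) :=
  eLpNorm_comp_measurePreserving hb.aestronglyMeasurable measurePreserving_fst

/-- `b` is the trace at `x = 1` of the flux `x ^ (α/2) G` on the time interval `(t₀, t₁)`. -/
def HasTrace (α t₀ t₁ : ℝ) (G : ℝ × ℝ → ℝ) (b : ℝ → ℝ) : Prop :=
  ∃ h : ℝ × ℝ → ℝ, Measurable h ∧ MemLp h 2 (stripVol t₀ t₁) ∧
    ∀ᵐ t ∂(volume.restrict (Ioo t₀ t₁)), ∀ᵐ x ∂unitVol,
      x ^ (α / 2) * G (t, x) = b t - tailInt h (t, x)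

theorem memLp_rpow_half_mul {μ : Measure ℝ} [SFinite μ] {α : ℝ} (hα : 0 < α) {g : ℝ × ℝ → ℝ}
    (hg2 : MemLp g 2 (μ.prod unitVol)) :
    MemLp (fun z => z.2 ^ (α / 2) * g z) 2 (μ.prod unitVol) ∧
      eLpNorm (fun z => z.2 ^ (α / 2) * g z) 2 (μ.prod unitVol) ≤ eLpNorm g 2 (μ.prod unitVol) := by
  have hle : ∀ᵐ z ∂(μ.prod unitVol), ‖z.2 ^ (α / 2) * g z‖ ≤ ‖g z‖ := by
    filter_upwards [ae_prod_mem_unit μ] with z hz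
    obtain ⟨h1, h2⟩ := rpow_half_mem hα hz
    rw [norm_mul, Real.norm_of_nonneg h1]
    exact mul_le_of_le_one_left (norm_nonneg _) h2
  exact ⟨hg2.mono (AEStronglyMeasurable.mul
    (by fun_prop : Measurable fun z : ℝ × ℝ => z.2 ^ (α / 2)).aestronglyMeasurable hg2.1) hle,
    eLpNorm_mono_ae hle⟩

theorem memLp_tailInt {μ : Measure ℝ} [SFinite μ] {H : ℝ × ℝ → ℝ} (hH : Measurable H)
    (hH2 : MemLp H 2 (μ.prod unitVol)) : MemLp (tailInt H) 2 (μ.prod unitVol) := by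
  refine ⟨(measurable_tailInt hH).aestronglyMeasurable, ?_⟩
  have h := eLpNorm_tailInt_sub_le (μ := μ) hH hH2 measurable_const (K := fun _ => 0) MemLp.zero'
  have e1 : tailInt H - tailInt (fun _ => 0) = tailInt H := by
    ext z; simp [tailInt]
  have e2 : (H - fun _ => 0) = H := by ext z; simp
  rw [e1, e2] at h
  exact h.trans_lt hH2.2

theorem tendsto_eLpNorm_add {X : Type*} [MeasurableSpace X] {μ : Measure X} {f g k : ℕ → X → ℝ}
    (hf : Tendsto (fun n => eLpNorm (f n) 2 μ) atTop (𝓝 0))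
    (hg : Tendsto (fun n => eLpNorm (g n) 2 μ) atTop (𝓝 0))
    (h : ∀ n, eLpNorm (k n) 2 μ ≤ eLpNorm (f n) 2 μ + eLpNorm (g n) 2 μ) :
    Tendsto (fun n => eLpNorm (k n) 2 μ) atTop (𝓝 0) := by
  have := hf.add hg
  rw [add_zero] at this
  exact tendsto_of_tendsto_of_tendsto_of_le_of_le tendsto_const_nhds this (fun _ => bot_le) h

theorem WeakSolution.mollTrace_ae {α : ℝ} {G F : ℝ × ℝ → ℝ} (S : WeakSolution α G F)
    (hα : α ∈ Ioo (0 : ℝ) 1) {ρ : ℝ → ℝ} (hρ : ContDiff ℝ 1 ρ) (hc : HasCompactSupport ρ)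
    (t₀ t₁ : ℝ) : ∀ᵐ z ∂(stripVol t₀ t₁), mollTrace α G F ρ z.1 = z.2 ^ (α / 2) * tconv ρ G z.1 z.2
      + tailInt (fun z => mollQ α G ρ z.1 z.2 - tconv ρ F z.1 z.2) z := by
  have hm : MeasurableSet {z : ℝ × ℝ | mollTrace α G F ρ z.1 = z.2 ^ (α / 2) * tconv ρ G z.1 z.2
      + tailInt (fun z => mollQ α G ρ z.1 z.2 - tconv ρ F z.1 z.2) z} :=
    measurableSet_eq_fun ((measurable_mollTrace α S.meas_G S.meas_F hρ).comp measurable_fst)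
      (((measurable_snd.pow_const _).mul (measurable_tconv hρ.continuous.measurable S.meas_G)).add
        (measurable_tailInt (measurable_mollH α S.meas_G S.meas_F hρ)))
  refine (Measure.ae_prod_iff_ae_ae hm).2 (ae_of_all _ fun t => ?_)
  filter_upwards [S.mollW_ae hα hρ hc t] with x hx
  rw [mollW] at hx
  change _ = _ + ∫ ξ in x..1, _
  linarith

/-- Existence of the trace of the flux at `x = 1`, as limit of the mollified traces. -/
theorem WeakSolution.exists_trace {α : ℝ} {G F : ℝ × ℝ → ℝ} (S : WeakSolution α G F)
    (hα : α ∈ Ioo (0 : ℝ) 1) {ε : ℝ} (hε : 0 < ε) {ρ : ℕ → ℝ → ℝ} (hρ : IsMollifier ε ρ)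
    {t₀ t₁ : ℝ} (ht : t₀ ≤ t₁) (hG : ∀ τ x, τ ∉ Ioo (t₀ + ε) (t₁ - ε) → G (τ, x) = 0) :
    ∃ b : ℝ → ℝ, Measurable b ∧ MemLp b 2 (volume.restrict (Ioo t₀ t₁)) ∧ HasTrace α t₀ t₁ G b ∧
      Tendsto (fun n => eLpNorm (mollTrace α G F (ρ n) - b) 2 (volume.restrict (Ioo t₀ t₁)))
        atTop (𝓝 0) := by
  obtain ⟨g, hg, hg2, hgt⟩ := S.exists_timeDeriv hα hε hρ ht hG
  have hle := stripVol_le t₀ t₁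
  have hρ1 : ∀ n, ContDiff ℝ 1 (ρ n) := fun n => (hρ.contDiff n).of_le one_le_two
  have hF2 : MemLp F 2 (stripVol t₀ t₁) := S.memLp_F.mono_measure hle
  have hG2 : MemLp G 2 (stripVol t₀ t₁) := S.memLp_G.mono_measure hle
  set h : ℝ × ℝ → ℝ := g - F with hh
  have hhm : Measurable h := hg.sub S.meas_F
  have hh2 : MemLp h 2 (stripVol t₀ t₁) := hg2.sub hF2
  set H : ℕ → ℝ × ℝ → ℝ := fun n z => mollQ α G (ρ n) z.1 z.2 - tconv (ρ n) F z.1 z.2 with hH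
  have hHm : ∀ n, Measurable (H n) := fun n => measurable_mollH α S.meas_G S.meas_F (hρ1 n)
  have hQ2 : ∀ n, MemLp (fun z : ℝ × ℝ => mollQ α G (ρ n) z.1 z.2) 2 (stripVol t₀ t₁) := fun n =>
    memLp_mollQ hα.2 S.meas_G S.memLp_G (hρ1 n) (hρ.compact n) t₀ t₁
  have hF2n : ∀ n, MemLp (fun z : ℝ × ℝ => tconv (ρ n) F z.1 z.2) 2 (stripVol t₀ t₁) := fun n =>
    memLp_tconv (hρ1 n).continuous (hρ.compact n) S.meas_F S.memLp_F t₀ t₁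
  have hG2n : ∀ n, MemLp (fun z : ℝ × ℝ => tconv (ρ n) G z.1 z.2) 2 (stripVol t₀ t₁) := fun n =>
    memLp_tconv (hρ1 n).continuous (hρ.compact n) S.meas_G S.memLp_G t₀ t₁
  have hH2 : ∀ n, MemLp (H n) 2 (stripVol t₀ t₁) := fun n => (hQ2 n).sub (hF2n n)
  have hFt := tendsto_eLpNorm_mono hle (hρ.tendsto S.meas_F S.memLp_F)
  have hGt := tendsto_eLpNorm_mono hle (hρ.tendsto S.meas_G S.memLp_G)
  have hHt : Tendsto (fun n => eLpNorm (H n - h) 2 (stripVol t₀ t₁)) atTop (𝓝 0) := by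
    refine tendsto_eLpNorm_add hgt hFt fun n => ?_
    have e : H n - h = ((fun z : ℝ × ℝ => mollQ α G (ρ n) z.1 z.2) - g) -
        (fun z : ℝ × ℝ => tconv (ρ n) F z.1 z.2 - F z) := by
      ext z; simp only [hH, hh, Pi.sub_apply]; ring
    rw [e]
    exact eLpNorm_sub_le ((hQ2 n).sub hg2).1 ((hF2n n).sub hF2).1 one_le_two
  -- The limit of the mollified traces, viewed at first as a function of t and x.
  set B : ℝ × ℝ → ℝ := fun z => z.2 ^ (α / 2) * G z + tailInt h z with hB
  have hBm : Measurable B :=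
    ((measurable_snd.pow_const _).mul S.meas_G).add (measurable_tailInt hhm)
  have hB2 : MemLp B 2 (stripVol t₀ t₁) :=
    (memLp_rpow_half_mul hα.1 hG2).1.add (memLp_tailInt hhm hh2)
  have hbnm : ∀ n, Measurable (mollTrace α G F (ρ n)) := fun n =>
    measurable_mollTrace α S.meas_G S.meas_F (hρ1 n)
  have hBt : Tendsto (fun n => eLpNorm (fun z : ℝ × ℝ => mollTrace α G F (ρ n) z.1 - B z) 2
      (stripVol t₀ t₁)) atTop (𝓝 0) := by
    refine tendsto_eLpNorm_add hGt hHt fun n => ?_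
    have m1 := memLp_rpow_half_mul hα.1 ((hG2n n).sub hG2)
    have m2 := eLpNorm_tailInt_sub_le (hHm n) (hH2 n) hhm hh2
    refine le_trans ?_ (add_le_add m1.2 m2)
    refine le_trans (le_of_eq (eLpNorm_congr_ae ?_)) (eLpNorm_add_le m1.1.1
      ((memLp_tailInt (hHm n) (hH2 n)).sub (memLp_tailInt hhm hh2)).1 one_le_two)
    filter_upwards [S.mollTrace_ae hα (hρ1 n) (hρ.compact n) t₀ t₁] with z hz
    rw [hz]
    simp only [hB, Pi.add_apply, Pi.sub_apply, hH]
    ring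
  -- The mollified traces do not depend on x, so averaging in x does not increase their distance to
  -- B. They converge to b as well as to B, which forces B to be independent of x almost everywhere.
  set b : ℝ → ℝ := fun t => ∫ y, B (t, y) ∂unitVol with hb
  have hbm : Measurable b := (hBm.stronglyMeasurable.integral_prod_right' (ν := unitVol)).measurable
  have hbB : ∀ n, eLpNorm (fun z : ℝ × ℝ => mollTrace α G F (ρ n) z.1 - b z.1) 2 (stripVol t₀ t₁)
      ≤ eLpNorm (fun z : ℝ × ℝ => mollTrace α G F (ρ n) z.1 - B z) 2 (stripVol t₀ t₁) := fun n => by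
    rw [← one_mul (eLpNorm (fun z : ℝ × ℝ => mollTrace α G F (ρ n) z.1 - B z) 2 _)]
    refine eLpNorm_le_of_slice (((hbnm n).comp measurable_fst).sub hBm) ?_
    filter_upwards [ae_slice_prod hBm hB2] with z hz
    have e : mollTrace α G F (ρ n) z.1 - b z.1 =
        ∫ y in Ioo 0 1, (mollTrace α G F (ρ n) z.1 - B (z.1, y)) := by
      rw [integral_sub (integrable_const _) (hz.integrable one_le_two)]
      simp [hb]
    rw [one_pow, one_mul, e]
    exact enorm_sq_integral_le ((memLp_const _).sub hz) subset_rfl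
  have hbt : Tendsto (fun n => eLpNorm (fun z : ℝ × ℝ => mollTrace α G F (ρ n) z.1 - b z.1) 2
      (stripVol t₀ t₁)) atTop (𝓝 0) :=
    tendsto_of_tendsto_of_tendsto_of_le_of_le tendsto_const_nhds hBt (fun _ => bot_le) hbB
  have hae : (fun z : ℝ × ℝ => b z.1) =ᵐ[stripVol t₀ t₁] B := by
    have h0 : eLpNorm (fun z : ℝ × ℝ => b z.1 - B z) 2 (stripVol t₀ t₁) = 0 := by
      have h2 := tendsto_eLpNorm_add (k := fun _ (z : ℝ × ℝ) => b z.1 - B z) hBt hbt fun n => by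
        have e : (fun z : ℝ × ℝ => b z.1 - B z) =
            (fun z : ℝ × ℝ => mollTrace α G F (ρ n) z.1 - B z) -
              fun z : ℝ × ℝ => mollTrace α G F (ρ n) z.1 - b z.1 := by
          ext z; simp only [Pi.sub_apply]; ring
        rw [e]
        exact eLpNorm_sub_le (((hbnm n).comp measurable_fst).sub hBm).aestronglyMeasurable
          (((hbnm n).comp measurable_fst).sub (hbm.comp measurable_fst)).aestronglyMeasurable
          one_le_two
      exact tendsto_nhds_unique tendsto_const_nhds h2
    filter_upwards [(eLpNorm_eq_zero_iff ((hbm.comp measurable_fst).sub hBm).aestronglyMeasurable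
      two_ne_zero).1 h0] with z hz
    exact sub_eq_zero.1 hz
  refine ⟨b, hbm, ⟨hbm.aestronglyMeasurable, ?_⟩, ⟨h, hhm, hh2, ?_⟩, ?_⟩
  · rw [← eLpNorm_fst hbm, eLpNorm_congr_ae hae]
    exact hB2.2
  · filter_upwards [Measure.ae_ae_of_ae_prod hae] with t hta
    filter_upwards [hta] with x hx
    simp only [hB] at hx
    linarith
  · refine hbt.congr fun n => ?_
    rw [← eLpNorm_fst ((hbnm n).sub hbm)]
    rfl

/-! ### The Carleman estimate for weak solutions, by passage to the limit -/

theorem integral_sq_eq_toReal {X : Type*} [MeasurableSpace X] {μ : Measure X} {f : X → ℝ}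
    (hf : AEStronglyMeasurable f μ) : ∫ x, f x ^ 2 ∂μ = (eLpNorm f 2 μ ^ 2).toReal := by
  rw [eLpNorm_two_sq, integral_eq_lintegral_of_nonneg_ae (ae_of_all _ fun _ => sq_nonneg _)
    (hf.pow 2)]
  simp only [enorm_sq_eq]

theorem tendsto_integral_sq {X : Type*} [MeasurableSpace X] {μ : Measure X} {f : ℕ → X → ℝ}
    {g : X → ℝ} (hf : ∀ n, MemLp (f n) 2 μ) (hg : MemLp g 2 μ)
    (h : Tendsto (fun n => eLpNorm (f n - g) 2 μ) atTop (𝓝 0)) :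
    Tendsto (fun n => ∫ x, f n x ^ 2 ∂μ) atTop (𝓝 (∫ x, g x ^ 2 ∂μ)) := by
  have h1 : Tendsto (fun n => (hf n).toLp (f n)) atTop (𝓝 (hg.toLp g)) := by
    rw [tendsto_iff_edist_tendsto_0]
    simpa only [Lp.edist_toLp_toLp] using h
  have h2 := (h1.norm).pow 2
  simp only [Lp.norm_toLp] at h2
  simp only [integral_sq_eq_toReal (hf _).1, integral_sq_eq_toReal hg.1, ENNReal.toReal_pow]
  exact h2

theorem tendsto_integral_sq_mul {X : Type*} [MeasurableSpace X] {μ : Measure X} {f : ℕ → X → ℝ}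
    {g a : X → ℝ} (hf : ∀ n, MemLp (f n) 2 μ) (hg : MemLp g 2 μ) (ha : Measurable a) {M : ℝ}
    (hM : ∀ᵐ x ∂μ, |a x| ≤ M)
    (h : Tendsto (fun n => eLpNorm (f n - g) 2 μ) atTop (𝓝 0)) :
    Tendsto (fun n => ∫ x, (a x * f n x) ^ 2 ∂μ) atTop (𝓝 (∫ x, (a x * g x) ^ 2 ∂μ)) := by
  have hmul : ∀ {k : X → ℝ}, MemLp k 2 μ → MemLp (fun x => a x * k x) 2 μ ∧
      eLpNorm (fun x => a x * k x) 2 μ ≤ ENNReal.ofReal M * eLpNorm k 2 μ := fun {k} hk => by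
    have hle : ∀ᵐ x ∂μ, ‖a x * k x‖ ≤ M * ‖k x‖ := by
      filter_upwards [hM] with x hx
      rw [norm_mul]
      exact mul_le_mul_of_nonneg_right hx (norm_nonneg _)
    exact ⟨hk.of_le_mul (ha.aestronglyMeasurable.mul hk.1) hle,
      eLpNorm_le_mul_eLpNorm_of_ae_le_mul hle 2⟩
  refine tendsto_integral_sq (fun n => (hmul (hf n)).1) (hmul hg).1 ?_
  have h0 := ENNReal.Tendsto.const_mul h (Or.inr (ENNReal.ofReal_ne_top (r := M)))
  rw [mul_zero] at h0
  refine tendsto_of_tendsto_of_tendsto_of_le_of_le tendsto_const_nhds h0 (fun _ => bot_le)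
    fun n => ?_
  refine le_trans (le_of_eq ?_) (hmul ((hf n).sub hg)).2
  congr 1; ext x; simp only [Pi.sub_apply]; ring

theorem exists_subseq_ae {X : Type*} [MeasurableSpace X] {μ : Measure X} {f : ℕ → X → ℝ}
    {g : X → ℝ} (hf : ∀ n, AEStronglyMeasurable (f n) μ) (hg : AEStronglyMeasurable g μ)
    (h : Tendsto (fun n => eLpNorm (f n - g) 2 μ) atTop (𝓝 0)) :
    ∃ ns : ℕ → ℕ, StrictMono ns ∧
      ∀ᵐ x ∂μ, Tendsto (fun i => f (ns i) x) atTop (𝓝 (g x)) :=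
  (tendstoInMeasure_of_tendsto_eLpNorm two_ne_zero hf hg h).exists_seq_tendsto_ae

/-- Cauchy-Schwarz in x, with constant the L² norm of x^{-α/2}, finite since α < 1. It turns L²
convergence of G into that of the solution. -/
theorem exists_eLpNorm_prim_sub_le {α : ℝ} (hα : α < 1) : ∃ c : ENNReal, c ≠ ⊤ ∧
    ∀ (μ : Measure ℝ) [SFinite μ] (G G' : ℝ × ℝ → ℝ), Measurable G → Measurable G' →
      MemLp G 2 (μ.prod unitVol) → MemLp G' 2 (μ.prod unitVol) →
      eLpNorm (prim α G - prim α G') 2 (μ.prod unitVol) ≤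
        c * eLpNorm (G - G') 2 (μ.prod unitVol) := by
  set A := ∫ ξ, (ξ ^ (-(α / 2))) ^ 2 ∂unitVol with hA
  have hA0 : 0 ≤ A := integral_nonneg fun _ => sq_nonneg _
  refine ⟨ENNReal.ofReal (Real.sqrt A), ENNReal.ofReal_ne_top, ?_⟩
  intro μ _ G G' hG hG' hG2 hG2'
  refine eLpNorm_le_of_slice (hG.sub hG') ?_
  filter_upwards [ae_slice_prod hG hG2, ae_slice_prod hG' hG2', ae_prod_mem_unit μ]
    with z h1 h2 hz
  have hsub : Ioo 0 z.2 ⊆ Ioo 0 1 := Ioo_subset_Ioo_right hz.2.le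
  have hle : volume.restrict (Ioo 0 z.2) ≤ unitVol := Measure.restrict_mono hsub le_rfl
  have hb := memLp_rpow_neg_half hα
  have e : prim α G z - prim α G' z =
      ∫ ξ in Ioo 0 z.2, ξ ^ (-(α / 2)) * (G (z.1, ξ) - G' (z.1, ξ)) := by
    rw [prim, prim, intervalIntegral_eq_Ioo hz.1.le, intervalIntegral_eq_Ioo hz.1.le]
    simp only [mul_sub]
    exact (integral_sub ((hb.integrable_mul h1).mono_measure hle)
      ((hb.integrable_mul h2).mono_measure hle)).symm
  have h3 := h1.sub h2
  rw [Pi.sub_apply, e, ← ENNReal.ofReal_pow (Real.sqrt_nonneg _), Real.sq_sqrt hA0]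
  have h4 := lintegral_enorm_sq_eq h3
  simp only [Pi.sub_apply] at h4 ⊢
  rw [h4, ← ENNReal.ofReal_mul hA0, enorm_sq_eq]
  exact ENNReal.ofReal_le_ofReal (sq_integral_Ioo_le hb h3 hsub)

theorem continuous_carlemanDensity (T α β k lam d s t x : ℝ) :
    Continuous fun y : ℝ × ℝ => carlemanDensity T α β k lam d s t x y.1 y.2 := by
  unfold carlemanDensity; fun_prop

theorem exp_phi_le_one {T k β lam d s t x : ℝ} (hβ : β < 1) (hlam : 0 < lam) (hd : 5 ≤ d)
    (hs : 0 ≤ s) (ht : t ∈ Ioo 0 T) (hx : x ∈ Icc (0 : ℝ) 1) :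
    Real.exp (2 * s * phi T k β lam d t x) ≤ 1 := by
  rw [Real.exp_le_one_iff, phi]
  have h1 := (psi_bounds hβ hlam hd hx).1
  have h2 := theta_pos (k := k) ht
  have : Theta T k t * (lam * (x ^ (2 - β) - d)) ≤ 0 :=
    mul_nonpos_of_nonneg_of_nonpos h2.le (by linarith)
  exact mul_nonpos_of_nonneg_of_nonpos (by linarith) this

theorem tendsto_integral_source {T β k lam d s t₀ t₁ : ℝ} (hβ : β < 1) (hlam : 0 < lam)
    (hd : 5 ≤ d) (hsub : Ioo t₀ t₁ ⊆ Ioo 0 T) (hs : 0 ≤ s) {f : ℕ → ℝ × ℝ → ℝ} {F : ℝ × ℝ → ℝ}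
    (hf : ∀ n, MemLp (f n) 2 (stripVol t₀ t₁)) (hF : MemLp F 2 (stripVol t₀ t₁))
    (h : Tendsto (fun n => eLpNorm (f n - F) 2 (stripVol t₀ t₁)) atTop (𝓝 0)) :
    Tendsto (fun n => ∫ z, f n z ^ 2 * Real.exp (2 * s * phi T k β lam d z.1 z.2)
        ∂(stripVol t₀ t₁)) atTop
      (𝓝 (∫ z, F z ^ 2 * Real.exp (2 * s * phi T k β lam d z.1 z.2) ∂(stripVol t₀ t₁))) := by
  have htm : ∀ᵐ z ∂(stripVol t₀ t₁), z.1 ∈ Ioo t₀ t₁ :=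
    (Measure.quasiMeasurePreserving_fst (μ := volume.restrict (Ioo t₀ t₁)) (ν := unitVol)).ae
      (ae_restrict_mem measurableSet_Ioo)
  have h2 := tendsto_integral_sq_mul hf hF (measurable_weight_theta T k β lam d s) (M := 1)
    (by
      filter_upwards [htm, ae_prod_mem_unit (volume.restrict (Ioo t₀ t₁))] with z hz hz2
      rw [weight, abs_of_pos (Real.exp_pos _)]
      exact weight_le_one hβ hlam hd hs (theta_pos (hsub hz)).le (Ioo_subset_Icc_self hz2)) h
  simp only [mul_pow, weight_sq_eq] at h2
  simpa only [mul_comm] using h2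

theorem tendsto_integral_boundary {T β k lam d s t₀ t₁ B : ℝ} (hβ : β < 1) (hlam : 0 < lam)
    (hd : 5 ≤ d) (hsub : Ioo t₀ t₁ ⊆ Ioo 0 T) (hs : 0 ≤ s)
    (hB : ∀ t ∈ Icc t₀ t₁, Theta T k t ≤ B) {c : ℕ → ℝ → ℝ} {b : ℝ → ℝ}
    (hc : ∀ n, MemLp (c n) 2 (volume.restrict (Ioo t₀ t₁)))
    (hb : MemLp b 2 (volume.restrict (Ioo t₀ t₁)))
    (h : Tendsto (fun n => eLpNorm (c n - b) 2 (volume.restrict (Ioo t₀ t₁))) atTop (𝓝 0)) :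
    Tendsto (fun n => ∫ t in Ioo t₀ t₁, s * Theta T k t * c n t ^ 2
        * Real.exp (2 * s * phi T k β lam d t 1)) atTop
      (𝓝 (∫ t in Ioo t₀ t₁, s * Theta T k t * b t ^ 2
        * Real.exp (2 * s * phi T k β lam d t 1))) := by
  have hΘm := measurable_theta T k
  have hwm : Measurable fun t => weight β lam d s (Theta T k t) 1 := by
    unfold weight; fun_prop
  have ham : Measurable fun t => Real.sqrt (s * Theta T k t) * weight β lam d s (Theta T k t) 1 := by
    fun_prop
  have h2 := tendsto_integral_sq_mul hc hb ham (M := Real.sqrt (s * B))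
    (by
      filter_upwards [ae_restrict_mem measurableSet_Ioo] with t ht
      have hw0 : 0 ≤ weight β lam d s (Theta T k t) 1 := (Real.exp_pos _).le
      rw [abs_of_nonneg (mul_nonneg (Real.sqrt_nonneg _) hw0)]
      refine (mul_le_of_le_one_right (Real.sqrt_nonneg _) (weight_le_one hβ hlam hd hs
        (theta_pos (hsub ht)).le ⟨zero_le_one, le_rfl⟩)).trans (Real.sqrt_le_sqrt ?_)
      exact mul_le_mul_of_nonneg_left (hB t (Ioo_subset_Icc_self ht)) hs) h
  have e : ∀ c : ℝ → ℝ, ∫ t in Ioo t₀ t₁,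
      (Real.sqrt (s * Theta T k t) * weight β lam d s (Theta T k t) 1 * c t) ^ 2 =
      ∫ t in Ioo t₀ t₁, s * Theta T k t * c t ^ 2
        * Real.exp (2 * s * phi T k β lam d t 1) := fun c => by
    refine setIntegral_congr_fun measurableSet_Ioo fun t ht => ?_
    have h3 : 0 ≤ s * Theta T k t := mul_nonneg hs (theta_pos (hsub ht)).le
    simp only [mul_pow, Real.sq_sqrt h3, weight_sq_eq]
    ring
  simpa only [e] using h2

/-- Fatou's lemma. Convergence almost everywhere suffices on the left, so the weights, singular at x
= 0, need no uniform control; only the right-hand sides have to converge. -/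
theorem lintegral_carlemanDensity_le_of_tendsto {T α β k lam d s : ℝ} {μ : Measure (ℝ × ℝ)}
    {u p : ℕ → ℝ × ℝ → ℝ} {u' p' : ℝ × ℝ → ℝ} (hu : ∀ n, Measurable (u n))
    (hp : ∀ n, Measurable (p n)) (hut : ∀ᵐ z ∂μ, Tendsto (fun n => u n z) atTop (𝓝 (u' z)))
    (hpt : ∀ᵐ z ∂μ, Tendsto (fun n => p n z) atTop (𝓝 (p' z))) {R : ℕ → ℝ} {R' : ℝ}
    (hR : Tendsto R atTop (𝓝 R'))
    (h : ∀ n, ∫⁻ z, ENNReal.ofReal (carlemanDensity T α β k lam d s z.1 z.2 (u n z) (p n z)) ∂μ ≤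
      ENNReal.ofReal (R n)) :
    ∫⁻ z, ENNReal.ofReal (carlemanDensity T α β k lam d s z.1 z.2 (u' z) (p' z)) ∂μ ≤
      ENNReal.ofReal R' := by
  calc ∫⁻ z, ENNReal.ofReal (carlemanDensity T α β k lam d s z.1 z.2 (u' z) (p' z)) ∂μ
      ≤ ∫⁻ z, liminf (fun n => ENNReal.ofReal
          (carlemanDensity T α β k lam d s z.1 z.2 (u n z) (p n z))) atTop ∂μ := by
        refine lintegral_mono_ae ?_
        filter_upwards [hut, hpt] with z hz1 hz2
        have h2 := ((continuous_carlemanDensity T α β k lam d s z.1 z.2).tendsto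
          (u' z, p' z)).comp (hz1.prodMk_nhds hz2)
        exact (ENNReal.tendsto_ofReal h2).liminf_eq.ge
    _ ≤ liminf (fun n => ∫⁻ z, ENNReal.ofReal
          (carlemanDensity T α β k lam d s z.1 z.2 (u n z) (p n z)) ∂μ) atTop :=
        lintegral_liminf_le fun n => (measurable_carlemanDensity measurable_fst measurable_snd
          (hu n) (hp n)).ennreal_ofReal
    _ ≤ _ := by
        rw [← (ENNReal.tendsto_ofReal hR).liminf_eq]
        exact liminf_le_liminf (Eventually.of_forall h)

/-- The Carleman estimate for weak solutions supported away from the ends of the time interval. -/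
theorem exists_carleman_weak {T α β k lam d : ℝ} (hT : 0 < T) (hα : α ∈ Ioo (0 : ℝ) 1)
    (hβ : β ∈ Ico α 1) (hk : 4 ≤ k) (hlam : 0 < lam) (hd : 5 ≤ d) :
    ∃ C s₀ : ℝ, 0 < C ∧ 0 < s₀ ∧ ∀ (t₀ t₁ ε : ℝ) (G F : ℝ × ℝ → ℝ), 0 < t₀ → t₀ ≤ t₁ →
      t₁ < T → 0 < ε → WeakSolution α G F →
      (∀ τ x, τ ∉ Ioo (t₀ + ε) (t₁ - ε) → G (τ, x) = 0) →
      ∃ b, HasTrace α t₀ t₁ G b ∧ ∀ s, s₀ ≤ s →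
      ∫⁻ z, ENNReal.ofReal (carlemanDensity T α β k lam d s z.1 z.2 (prim α G z)
          (z.2 ^ (-(α / 2)) * G z)) ∂(stripVol t₀ t₁) ≤
        ENNReal.ofReal (C * ((∫ z, F z ^ 2 * Real.exp (2 * s * phi T k β lam d z.1 z.2)
            ∂(stripVol t₀ t₁))
          + ∫ t in Ioo t₀ t₁, s * Theta T k t * b t ^ 2
              * Real.exp (2 * s * phi T k β lam d t 1))) := by
  obtain ⟨C, s₀, hC, hs₀, H⟩ := exists_carleman_regular hT hα hβ hk hlam hd
  refine ⟨C, s₀, hC, hs₀, fun t₀ t₁ ε G F h0 h01 h1 hε S hG => ?_⟩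
  obtain ⟨ρ, hρ⟩ := exists_isMollifier hε
  -- The trace is constructed before s is chosen, so one and the same b serves for all s.
  obtain ⟨b, hbm, hb2, htr, hbt⟩ := S.exists_trace hα hε hρ h01 hG
  refine ⟨b, htr, fun s hs => ?_⟩
  have hs0 : 0 ≤ s := hs₀.le.trans hs
  have hle := stripVol_le t₀ t₁
  have hρ1 : ∀ n, ContDiff ℝ 1 (ρ n) := fun n => (hρ.contDiff n).of_le one_le_two
  have hsub : Ioo t₀ t₁ ⊆ Ioo 0 T := Ioo_subset_Ioo h0.le h1.le
  have hF2 : MemLp F 2 (stripVol t₀ t₁) := S.memLp_F.mono_measure hle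
  have hG2 : MemLp G 2 (stripVol t₀ t₁) := S.memLp_G.mono_measure hle
  have hF2n : ∀ n, MemLp (fun z : ℝ × ℝ => tconv (ρ n) F z.1 z.2) 2 (stripVol t₀ t₁) := fun n =>
    memLp_tconv (hρ1 n).continuous (hρ.compact n) S.meas_F S.memLp_F t₀ t₁
  have hG2n : ∀ n, MemLp (fun z : ℝ × ℝ => tconv (ρ n) G z.1 z.2) 2 (stripVol t₀ t₁) := fun n =>
    memLp_tconv (hρ1 n).continuous (hρ.compact n) S.meas_G S.memLp_G t₀ t₁
  have hGm : ∀ n, Measurable (fun z : ℝ × ℝ => tconv (ρ n) G z.1 z.2) := fun n =>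
    measurable_tconv (hρ1 n).continuous.measurable S.meas_G
  have hFt := tendsto_eLpNorm_mono hle (hρ.tendsto S.meas_F S.memLp_F)
  have hGt := tendsto_eLpNorm_mono hle (hρ.tendsto S.meas_G S.memLp_G)
  obtain ⟨c, hc, hprim⟩ := exists_eLpNorm_prim_sub_le hα.2
  have hPt : Tendsto (fun n => eLpNorm (prim α (fun z : ℝ × ℝ => tconv (ρ n) G z.1 z.2) - prim α G)
      2 (stripVol t₀ t₁)) atTop (𝓝 0) := by
    have h2 := ENNReal.Tendsto.const_mul hGt (Or.inr hc)
    rw [mul_zero] at h2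
    exact tendsto_of_tendsto_of_tendsto_of_le_of_le tendsto_const_nhds h2 (fun _ => bot_le)
      fun n => hprim _ _ _ (hGm n) S.meas_G (hG2n n) hG2
  have hGt' : Tendsto (fun n => eLpNorm ((fun z : ℝ × ℝ => tconv (ρ n) G z.1 z.2) - G) 2
      (stripVol t₀ t₁)) atTop (𝓝 0) := hGt
  have hsubG := exists_subseq_ae (fun n => (hGm n).aestronglyMeasurable)
    S.meas_G.aestronglyMeasurable hGt'
  obtain ⟨ns, hns, hGae⟩ := hsubG
  -- A second extraction from the first subsequence, so that G and its primitive converge almost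
  -- everywhere along the same indices.
  obtain ⟨ms, hms, hPae⟩ := exists_subseq_ae
    (f := fun i => prim α (fun z : ℝ × ℝ => tconv (ρ (ns i)) G z.1 z.2))
    (fun i => (measurable_prim α (hGm (ns i))).aestronglyMeasurable)
    (measurable_prim α S.meas_G).aestronglyMeasurable (hPt.comp hns.tendsto_atTop)
  set js : ℕ → ℕ := fun i => ns (ms i) with hjs
  have hjt : Tendsto js atTop atTop := hns.tendsto_atTop.comp hms.tendsto_atTop
  have hRF : Tendsto (fun n => ∫ z, tconv (ρ n) F z.1 z.2 ^ 2
      * Real.exp (2 * s * phi T k β lam d z.1 z.2) ∂(stripVol t₀ t₁)) atTop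
      (𝓝 (∫ z, F z ^ 2 * Real.exp (2 * s * phi T k β lam d z.1 z.2) ∂(stripVol t₀ t₁))) := by
    exact tendsto_integral_source hβ.2 hlam hd hsub hs0 hF2n hF2 hFt
  have hRb : Tendsto (fun n => ∫ t in Ioo t₀ t₁, s * Theta T k t * mollW α G F (ρ n) t 1 ^ 2
      * Real.exp (2 * s * phi T k β lam d t 1)) atTop
      (𝓝 (∫ t in Ioo t₀ t₁, s * Theta T k t * b t ^ 2
      * Real.exp (2 * s * phi T k β lam d t 1))) := by
    obtain ⟨B, hB⟩ := exists_theta_le_on_Icc (k := k) h0 h1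
    have hbn2 : ∀ n, MemLp (mollTrace α G F (ρ n)) 2 (volume.restrict (Ioo t₀ t₁)) := fun n => by
      obtain ⟨M, hM⟩ := S.exists_mollW_le hα (hρ1 n) (hρ.compact n)
      refine MemLp.of_bound
        (measurable_mollTrace α S.meas_G S.meas_F (hρ1 n)).aestronglyMeasurable M
        (ae_of_all _ fun t => ?_)
      have := hM t 1 ⟨zero_le_one, le_rfl⟩
      rwa [mollW, intervalIntegral.integral_same, sub_zero] at this
    have h2 := tendsto_integral_boundary hβ.2 hlam hd hsub hs0 hB hbn2 hb2 hbt
    refine h2.congr fun n => ?_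
    simp only [mollW, intervalIntegral.integral_same, sub_zero]
  have hR := ((hRF.add hRb).const_mul C).comp hjt
  have hmr : Measurable fun z : ℝ × ℝ => z.2 ^ (-(α / 2)) := by fun_prop
  have hGae' : ∀ᵐ z ∂(stripVol t₀ t₁), Tendsto
      (fun i => z.2 ^ (-(α / 2)) * tconv (ρ (js i)) G z.1 z.2) atTop
      (𝓝 (z.2 ^ (-(α / 2)) * G z)) := by
    filter_upwards [hGae] with z hz
    exact (hz.comp hms.tendsto_atTop).const_mul _
  refine lintegral_carlemanDensity_le_of_tendsto
    (u := fun i => prim α (fun z : ℝ × ℝ => tconv (ρ (js i)) G z.1 z.2))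
    (p := fun i z => z.2 ^ (-(α / 2)) * tconv (ρ (js i)) G z.1 z.2)
    (p' := fun z => z.2 ^ (-(α / 2)) * G z)
    (fun i => measurable_prim α (hGm _)) (fun i => hmr.mul (hGm _)) hPae hGae' hR fun i => ?_
  exact H t₀ t₁ _ _ _ _ _ _ h0 h01 h1 (S.regular hα (hρ.contDiff (js i)) (hρ.compact (js i))
      (hρ.vanish hG hε (js i))) s hs

/-! ### From solutions to weak solutions by a cut-off in time -/

theorem restrict_domain (t : ℝ) : (volume : Measure (ℝ × ℝ)).restrict (domain t) = stripVol 0 t := by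
  rw [domain, Measure.volume_eq_prod, ← Measure.prod_restrict]

theorem ae_stripVol_fst {t₀ t₁ : ℝ} {P : ℝ → Prop}
    (h : ∀ᵐ t ∂(volume.restrict (Ioo t₀ t₁)), P t) : ∀ᵐ z ∂(stripVol t₀ t₁), P z.1 :=
  (Measure.quasiMeasurePreserving_fst (μ := volume.restrict (Ioo t₀ t₁)) (ν := unitVol)).ae h

theorem stripVol_eq_restrict (t₀ t₁ : ℝ) :
    stripVol t₀ t₁ = ((volume : Measure ℝ).prod unitVol).restrict (Ioo t₀ t₁ ×ˢ univ) := by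
  rw [← Measure.prod_restrict, Measure.restrict_univ]

/-- Measurable versions `G` of `x ^ (α/2) y_x` and `F` of `f`, extended by zero in time. -/
structure SolutionRep (T α : ℝ) (f y : ℝ → ℝ → ℝ) (G F : ℝ × ℝ → ℝ) : Prop where
  meas_G : Measurable G
  meas_F : Measurable F
  memLp_G : MemLp G 2 (volume.prod unitVol)
  memLp_F : MemLp F 2 (volume.prod unitVol)
  zero_G : ∀ t x, t ∉ Ioo 0 T → G (t, x) = 0
  zero_F : ∀ t x, t ∉ Ioo 0 T → F (t, x) = 0
  ae_G : ∀ᵐ z ∂(stripVol 0 T), G z = z.2 ^ (α / 2) * deriv (y z.1) z.2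
  ae_F : ∀ᵐ z ∂(stripVol 0 T), F z = f z.1 z.2
  ae_y : ∀ᵐ t ∂(volume.restrict (Ioo 0 T)), MemH1 α (y t) ∧
    ∀ x ∈ Icc (0 : ℝ) 1, prim α G (t, x) = y t x
  test : ∀ η : ℝ → ℝ, Measurable η → (∀ x, |η x| ≤ 1) → ∫ ξ in (0 : ℝ)..1, η ξ = 0 →
    ∃ c, ∀ t ∈ Icc 0 T, ∫ x, y t x * (∫ ξ in (0 : ℝ)..x, η ξ) ∂unitVol =
      c + ∫ τ in (0 : ℝ)..t, ∫ x, ((∫ ξ in (0 : ℝ)..x, η ξ) * F (τ, x)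
        - x ^ (α / 2) * η x * G (τ, x)) ∂unitVol

theorem exists_measurable_rep {T : ℝ} {g : ℝ → ℝ → ℝ} (hg : MemL2 T g) :
    ∃ G : ℝ × ℝ → ℝ, Measurable G ∧ MemLp G 2 (volume.prod unitVol) ∧
      (∀ t x, t ∉ Ioo 0 T → G (t, x) = 0) ∧ ∀ᵐ z ∂(stripVol 0 T), G z = g z.1 z.2 := by
  rw [MemL2, restrict_domain] at hg
  have hms : MeasurableSet (Ioo 0 T ×ˢ (univ : Set ℝ)) := measurableSet_Ioo.prod .univ
  set k := hg.1.mk _ with hk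
  have hkm : Measurable k := hg.1.stronglyMeasurable_mk.measurable
  have hk2 : MemLp k 2 (stripVol 0 T) := hg.ae_eq hg.1.ae_eq_mk
  refine ⟨(Ioo 0 T ×ˢ univ).indicator k, hkm.indicator hms, ?_, fun t x ht => ?_, ?_⟩
  · rw [memLp_indicator_iff_restrict hms, ← stripVol_eq_restrict]
    exact hk2
  · exact indicator_of_notMem (fun h => ht h.1) _
  · filter_upwards [hg.1.ae_eq_mk, ae_stripVol_fst (ae_restrict_mem measurableSet_Ioo)]
      with z hz hzm
    rw [indicator_of_mem (show z ∈ Ioo 0 T ×ˢ (univ : Set ℝ) from ⟨hzm, mem_univ _⟩), hk, ← hz]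

theorem MemH1.eq_integral {α : ℝ} {u : ℝ → ℝ} (hu : MemH1 α u) {x : ℝ} (hx : x ∈ Icc (0 : ℝ) 1) :
    u x = ∫ ξ in (0 : ℝ)..x, deriv u ξ := by
  have h := hu.absCont.mono (c := 0) (d := x) (by
    rw [uIcc_of_le hx.1, uIcc_of_le zero_le_one]; exact Icc_subset_Icc_right hx.2)
  rw [h.integral_deriv_eq_sub, hu.left_zero, sub_zero]

/-- Primitives of bounded functions of mean zero are admissible in the weak formulation. They are
the only test functions used, and they suffice for the lemma of du Bois-Reymond. -/
theorem memH1_primitive {α : ℝ} (hα : 0 < α) {η : ℝ → ℝ} (hη : Measurable η)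
    (hη1 : ∀ x, |η x| ≤ 1) (hη0 : ∫ ξ in (0 : ℝ)..1, η ξ = 0) :
    MemH1 α (fun x => ∫ ξ in (0 : ℝ)..x, η ξ) ∧
      ∀ᵐ x ∂unitVol, deriv (fun x => ∫ ξ in (0 : ℝ)..x, η ξ) x = η x := by
  have hi := intervalIntegrable_of_abs_le_one hη hη1 0 1
  have hd : ∀ᵐ x ∂unitVol, deriv (fun x => ∫ ξ in (0 : ℝ)..x, η ξ) x = η x := by
    rw [ae_restrict_iff' measurableSet_Ioo]
    filter_upwards [hi.ae_hasDerivAt_integral] with x hx hxm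
    rw [uIcc_of_le zero_le_one] at hx
    exact (hx (Ioo_subset_Icc_self hxm) 0 ⟨le_rfl, zero_le_one⟩).deriv
  refine ⟨⟨memLp_primitive hη hη1, hi.absolutelyContinuousOnInterval_intervalIntegral
    left_mem_uIcc, ?_, intervalIntegral.integral_same, hη0⟩, hd⟩
  have h1 : MemLp (fun x => x ^ (α / 2) * η x) 2 unitVol := by
    refine memLp_of_abs_le_one (by fun_prop) fun x hx => ?_
    obtain ⟨h1, h2⟩ := rpow_half_mem hα hx
    rw [abs_mul, abs_of_nonneg h1]
    exact mul_le_one₀ h2 (abs_nonneg _) (hη1 x)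
  refine (memLp_congr_ae ?_).1 h1
  filter_upwards [hd] with x hx
  rw [hx]

theorem abs_primitive_le {η : ℝ → ℝ} (hη1 : ∀ x, |η x| ≤ 1) {x : ℝ} (hx : x ∈ Ioo (0 : ℝ) 1) :
    |∫ ξ in (0 : ℝ)..x, η ξ| ≤ 1 := by
  have := intervalIntegral.norm_integral_le_of_norm_le_const (a := 0) (b := x) (C := 1) (f := η)
    fun y _ => hη1 y
  rw [one_mul, sub_zero, abs_of_pos hx.1] at this
  exact this.trans hx.2.le

theorem integrable_mul_of_abs_le_one {t₀ t₁ : ℝ} {g : ℝ × ℝ → ℝ} (hg : MemLp g 2 (stripVol t₀ t₁))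
    {b : ℝ → ℝ} (hb : Measurable b) (hb1 : ∀ x ∈ Ioo (0 : ℝ) 1, |b x| ≤ 1) :
    Integrable (fun z => b z.2 * g z) (stripVol t₀ t₁) := by
  refine (hg.integrable one_le_two).bdd_mul (c := 1) (hb.comp measurable_snd).aestronglyMeasurable ?_
  filter_upwards [ae_prod_mem_unit _] with z hz
  exact hb1 _ hz

theorem measurable_primitive {η : ℝ → ℝ} (hη : Measurable η) (hη1 : ∀ x, |η x| ≤ 1) :
    Measurable fun x => ∫ ξ in (0 : ℝ)..x, η ξ :=
  (intervalIntegral.continuous_primitive (intervalIntegrable_of_abs_le_one hη hη1) 0).measurable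

/-- The pairing of the data with a test function. -/
theorem integrable_test {α : ℝ} (hα : 0 < α) {t₀ t₁ : ℝ} {G F : ℝ × ℝ → ℝ}
    (hG : MemLp G 2 (stripVol t₀ t₁)) (hF : MemLp F 2 (stripVol t₀ t₁)) {η : ℝ → ℝ}
    (hη : Measurable η) (hη1 : ∀ x, |η x| ≤ 1) :
    Integrable (fun z : ℝ × ℝ => (∫ ξ in (0 : ℝ)..z.2, η ξ) * F z) (stripVol t₀ t₁) ∧
    Integrable (fun z : ℝ × ℝ => z.2 ^ (α / 2) * η z.2 * G z) (stripVol t₀ t₁) := by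
  refine ⟨integrable_mul_of_abs_le_one hF (measurable_primitive hη hη1)
    fun x hx => abs_primitive_le hη1 hx,
    integrable_mul_of_abs_le_one (b := fun x => x ^ (α / 2) * η x) hG (by fun_prop) fun x hx => ?_⟩
  obtain ⟨h1, h2⟩ := rpow_half_mem hα hx
  rw [abs_mul, abs_of_nonneg h1]
  exact mul_le_one₀ h2 (abs_nonneg _) (hη1 x)

/-- Splitting x^α as x^{α/2}·x^{α/2} expresses the equation through the square integrable G. The
initial value survives only in the constant c of the field `test`, which no longer matters once the
solution is cut off in time. -/
theorem IsSolution.exists_rep {T α : ℝ} (hα : α ∈ Ioo (0 : ℝ) 1) {y₀ : ℝ → ℝ} {f y : ℝ → ℝ → ℝ}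
    (hf : MemL2 T f) (h : IsSolution T α y₀ f y) : ∃ G F, SolutionRep T α f y G F := by
  obtain ⟨G, hG, hG2, hG0, hGae⟩ := exists_measurable_rep h.memL2_deriv
  obtain ⟨F, hF, hF2, hF0, hFae⟩ := exists_measurable_rep hf
  refine ⟨G, F, hG, hF, hG2, hF2, hG0, hF0, hGae, hFae, ?_, fun η hη hη1 hη0 => ?_⟩
  · filter_upwards [h.memH1, Measure.ae_ae_of_ae_prod hGae] with t ht hta
    refine ⟨ht, fun x hx => ?_⟩
    rw [ht.eq_integral hx, prim, intervalIntegral_eq_Ioo hx.1, intervalIntegral_eq_Ioo hx.1]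
    have h2 : ∀ᵐ ξ ∂unitVol, ξ ^ (-(α / 2)) * G (t, ξ) = deriv (y t) ξ := by
      filter_upwards [hta, ae_restrict_mem measurableSet_Ioo] with ξ h3 hξ
      rw [h3, ← mul_assoc, ← Real.rpow_add hξ.1, neg_add_cancel, Real.rpow_zero, one_mul]
    exact integral_congr_ae (ae_mono (Measure.restrict_mono (Ioo_subset_Ioo_right hx.2) le_rfl) h2)
  · obtain ⟨hv, hvd⟩ := memH1_primitive hα.1 hη hη1 hη0
    refine ⟨∫ x in Ioo 0 1, y₀ x * ∫ ξ in (0 : ℝ)..x, η ξ, fun t ht => ?_⟩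
    have hle : stripVol 0 t ≤ stripVol 0 T :=
      Measure.prod_mono (Measure.restrict_mono (Ioo_subset_Ioo_right ht.2) le_rfl) le_rfl
    have hle2 := stripVol_le 0 t
    obtain ⟨i1, i2⟩ := integrable_test hα.1 (hG2.mono_measure hle2) (hF2.mono_measure hle2) hη hη1
    have e := h.equation t ht _ hv
    rw [restrict_domain] at e
    have e1 : ∫ p, p.2 ^ α * deriv (y p.1) p.2 * deriv (fun x => ∫ ξ in (0 : ℝ)..x, η ξ) p.2
        ∂(stripVol 0 t) = ∫ z, z.2 ^ (α / 2) * η z.2 * G z ∂(stripVol 0 t) := by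
      refine integral_congr_ae ?_
      filter_upwards [ae_mono hle hGae, ae_stripVol_of_ae hvd 0 t, ae_prod_mem_unit _]
        with z h1 h2 h3
      rw [h1, h2]
      have : z.2 ^ α = z.2 ^ (α / 2) * z.2 ^ (α / 2) := by
        rw [← Real.rpow_add h3.1]; congr 1; ring
      rw [this]; ring
    have e2 : ∫ p, f p.1 p.2 * (∫ ξ in (0 : ℝ)..p.2, η ξ) ∂(stripVol 0 t) =
        ∫ z, (∫ ξ in (0 : ℝ)..z.2, η ξ) * F z ∂(stripVol 0 t) := by
      refine integral_congr_ae ?_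
      filter_upwards [ae_mono hle hFae] with z h1
      rw [h1, mul_comm]
    rw [e1, e2] at e
    have e3 := integral_prod _ (i1.sub i2)
    have e4 := integral_sub i1 i2
    simp only [Pi.sub_apply] at e3
    rw [intervalIntegral_eq_Ioo ht.1, ← e3, e4]
    linarith

theorem prim_mul (α : ℝ) (χ : ℝ → ℝ) (G : ℝ × ℝ → ℝ) (z : ℝ × ℝ) :
    prim α (fun z => χ z.1 * G z) z = χ z.1 * prim α G z := by
  simp only [prim, ← intervalIntegral.integral_const_mul]
  congr 1; ext ξ; ring

theorem SolutionRep.prim_eq_zero {T α : ℝ} {f y : ℝ → ℝ → ℝ} {G F : ℝ × ℝ → ℝ}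
    (S : SolutionRep T α f y G F) {z : ℝ × ℝ} (hz : z.1 ∉ Ioo 0 T) : prim α G z = 0 := by
  simp [prim, S.zero_G _ _ hz]

theorem memLp_mul_of_continuous {T : ℝ} {χ : ℝ → ℝ} (hχ : Continuous χ) {g : ℝ × ℝ → ℝ}
    (hg : Measurable g) (hg2 : MemLp g 2 (volume.prod unitVol))
    (h0 : ∀ z : ℝ × ℝ, z.1 ∉ Ioo 0 T → g z = 0) :
    MemLp (fun z => χ z.1 * g z) 2 (volume.prod unitVol) := by
  obtain ⟨M, hM⟩ := isCompact_Icc.exists_bound_of_continuousOn (s := Icc 0 T) hχ.continuousOn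
  refine hg2.of_le_mul (c := M)
    ((hχ.measurable.comp measurable_fst).mul hg).aestronglyMeasurable (ae_of_all _ fun z => ?_)
  by_cases hz : z.1 ∈ Ioo 0 T
  · rw [norm_mul]
    exact mul_le_mul_of_nonneg_right (hM _ (Ioo_subset_Icc_self hz)) (norm_nonneg _)
  · simp [h0 z hz]

/-- Multiplication of a solution with a cut-off function in time. -/
theorem SolutionRep.weakSolution {T α : ℝ} (hT : 0 < T) (hα : α ∈ Ioo (0 : ℝ) 1)
    {f y : ℝ → ℝ → ℝ} {G F : ℝ × ℝ → ℝ} (S : SolutionRep T α f y G F) {χ : ℝ → ℝ}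
    (hχ : ContDiff ℝ 1 χ) (h0 : χ 0 = 0) (h1 : χ T = 0) :
    WeakSolution α (fun z => χ z.1 * G z)
      (fun z => χ z.1 * F z + deriv χ z.1 * prim α G z) := by
  have hχ' : Continuous (deriv χ) := hχ.continuous_deriv le_rfl
  have hPm := measurable_prim α S.meas_G
  have hP2 := memLp_prim hα.2 S.meas_G S.memLp_G
  have hχm : Measurable fun z : ℝ × ℝ => χ z.1 := hχ.continuous.measurable.comp measurable_fst
  have hχm' : Measurable fun z : ℝ × ℝ => deriv χ z.1 := hχ'.measurable.comp measurable_fst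
  have hb : ∀ᵐ t, prim α G (t, 1) = 0 := by
    have h := (ae_restrict_iff' measurableSet_Ioo).1 S.ae_y
    filter_upwards [h] with t ht
    by_cases htm : t ∈ Ioo 0 T
    · obtain ⟨h2, h3⟩ := ht htm
      rw [h3 1 ⟨zero_le_one, le_rfl⟩, h2.right_zero]
    · exact S.prim_eq_zero htm
  refine ⟨hχm.mul S.meas_G, (hχm.mul S.meas_F).add (hχm'.mul hPm),
    memLp_mul_of_continuous hχ.continuous S.meas_G S.memLp_G fun z hz => S.zero_G _ _ hz,
    (memLp_mul_of_continuous hχ.continuous S.meas_F S.memLp_F fun z hz => S.zero_F _ _ hz).add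
      (memLp_mul_of_continuous hχ' hPm hP2 fun z hz => S.prim_eq_zero hz), ?_, ?_⟩
  · filter_upwards [hb] with t ht
    rw [prim_mul, ht, mul_zero]
  intro ζ hζ hζc η hη hη1 hη0
  obtain ⟨c, hc⟩ := S.test η hη hη1 hη0
  set v : ℝ → ℝ := fun x => ∫ ξ in (0 : ℝ)..x, η ξ with hv
  -- The cut-off is merged into the test function; the product rule for ψ produces the extra source
  -- χ'y. As ψ vanishes at 0 and T, no boundary values occur in time.
  set ψ : ℝ → ℝ := fun t => ζ t * χ t with hψ
  have hψ1 : ContDiff ℝ 1 ψ := hζ.mul hχ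
  have hψd : ∀ t, deriv ψ t = deriv ζ t * χ t + ζ t * deriv χ t := fun t =>
    deriv_fun_mul (hζ.differentiable one_ne_zero t) (hχ.differentiable one_ne_zero t)
  have hle := stripVol_le 0 T
  have hG2 := S.memLp_G.mono_measure hle
  have hF2 := S.memLp_F.mono_measure hle
  obtain ⟨i1, i2⟩ := integrable_test hα.1 hG2 hF2 hη hη1
  have i3 : Integrable (fun z => v z.2 * prim α G z) (stripVol 0 T) :=
    (integrable_test hα.1 hG2 (hP2.mono_measure hle) hη hη1).1
  have hbd : ∀ {κ : ℝ → ℝ} {g : ℝ × ℝ → ℝ}, Continuous κ → Integrable g (stripVol 0 T) →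
      Integrable (fun z => κ z.1 * g z) (stripVol 0 T) := fun {κ g} hκ hg => by
    obtain ⟨M, hM⟩ := isCompact_Icc.exists_bound_of_continuousOn (s := Icc 0 T) hκ.continuousOn
    refine hg.bdd_mul (c := M) (hκ.measurable.comp measurable_fst).aestronglyMeasurable ?_
    filter_upwards [ae_stripVol_fst (ae_restrict_mem measurableSet_Ioo)] with z hz
    exact hM _ (Ioo_subset_Icc_self hz)
  set m : ℝ → ℝ := fun t => ∫ x, v x * prim α G (t, x) ∂unitVol with hm
  set a : ℝ → ℝ := fun t => ∫ x, (v x * F (t, x) - x ^ (α / 2) * η x * G (t, x)) ∂unitVol with ha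
  -- The absolutely continuous version of the pairing m, with derivative a. The weak formulation is
  -- integration by parts of ψ against N on (0, T).
  set N : ℝ → ℝ := fun t => c + ∫ τ in (0 : ℝ)..t, a τ with hN
  have i12 := i1.sub i2
  have hai : IntervalIntegrable a volume 0 T := by
    rw [intervalIntegrable_iff_integrableOn_Ioo_of_le hT.le]
    exact i12.integral_prod_left
  have hmN : ∀ᵐ t ∂(volume.restrict (Ioo 0 T)), m t = N t := by
    filter_upwards [S.ae_y, ae_restrict_mem measurableSet_Ioo] with t ht htm
    refine Eq.trans ?_ (hc t (Ioo_subset_Icc_self htm))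
    refine integral_congr_ae ?_
    filter_upwards [ae_restrict_mem measurableSet_Ioo] with x hx
    rw [ht.2 x (Ioo_subset_Icc_self hx), mul_comm]
  have hNac : AbsolutelyContinuousOnInterval N 0 T := by
    have h2 := hai.absolutelyContinuousOnInterval_intervalIntegral (c := 0) left_mem_uIcc
    have h3 : AbsolutelyContinuousOnInterval (fun _ : ℝ => c) 0 T :=
      contDiffOn_const.absolutelyContinuousOnInterval
    exact h3.fun_add h2
  have hNd : ∀ᵐ t ∂(volume.restrict (Ioo 0 T)), deriv N t = a t := by
    rw [ae_restrict_iff' measurableSet_Ioo]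
    filter_upwards [hai.ae_hasDerivAt_integral] with t ht htm
    rw [uIcc_of_le hT.le] at ht
    exact ((ht (Ioo_subset_Icc_self htm) 0 ⟨le_rfl, hT.le⟩).const_add c).deriv
  have ibp := (hψ1.contDiffOn.absolutelyContinuousOnInterval).integral_deriv_mul_eq_sub hNac
    (a := 0) (b := T)
  have hψ0 : ψ 0 = 0 := by rw [hψ]; simp [h0]
  have hψT : ψ T = 0 := by rw [hψ]; simp [h1]
  rw [hψ0, hψT, zero_mul, zero_mul, sub_zero, intervalIntegral.integral_of_le hT.le,
    integral_Ioc_eq_integral_Ioo] at ibp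
  have j1 := hbd hψ1.continuous_deriv_one i3
  have j2 := hbd hψ1.continuous i12
  calc ∫ z, (deriv ζ z.1 * v z.2 * prim α (fun z => χ z.1 * G z) z
        - ζ z.1 * (z.2 ^ (α / 2) * η z.2) * (χ z.1 * G z)
        + ζ z.1 * v z.2 * (χ z.1 * F z + deriv χ z.1 * prim α G z)) ∂(volume.prod unitVol)
      = ∫ z, (deriv ψ z.1 * (v z.2 * prim α G z)
          + ψ z.1 * (v z.2 * F z - z.2 ^ (α / 2) * η z.2 * G z)) ∂(volume.prod unitVol) := by
        congr 1; ext z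
        rw [prim_mul, hψd]
        simp only [hψ]
        ring
    _ = ∫ z, (deriv ψ z.1 * (v z.2 * prim α G z)
          + ψ z.1 * (v z.2 * F z - z.2 ^ (α / 2) * η z.2 * G z)) ∂(stripVol 0 T) := by
        rw [stripVol_eq_restrict]
        refine (setIntegral_eq_integral_of_forall_compl_eq_zero fun z hz => ?_).symm
        have hz' : z.1 ∉ Ioo 0 T := fun h => hz ⟨h, mem_univ _⟩
        have e1 : F z = 0 := S.zero_F z.1 z.2 hz'
        have e2 : G z = 0 := S.zero_G z.1 z.2 hz'
        rw [S.prim_eq_zero hz', e1, e2]; ring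
    _ = ∫ t in Ioo 0 T, (deriv ψ t * m t + ψ t * a t) := by
        have e := integral_prod _ (j1.add j2)
        simp only [Pi.add_apply, Pi.sub_apply] at e
        rw [e]
        refine integral_congr_ae ?_
        filter_upwards [j1.prod_right_ae, j2.prod_right_ae] with t k1 k2
        have e2 := integral_add k1 k2
        simp only [Pi.sub_apply] at e2
        rw [e2, integral_const_mul, integral_const_mul]
    _ = ∫ t in Ioo 0 T, (deriv ψ t * N t + ψ t * deriv N t) := by
        refine integral_congr_ae ?_
        filter_upwards [hmN, hNd] with t k1 k2
        rw [k1, k2]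
    _ = 0 := ibp

/-! ### The normal derivative at x = 1 -/

/-- The trace of the flux is the one-sided derivative at `x = 1`. -/
theorem SolutionRep.hasDerivWithinAt {T α : ℝ} (hα : α ∈ Ioo (0 : ℝ) 1)
    {f y : ℝ → ℝ → ℝ} {G F : ℝ × ℝ → ℝ} (S : SolutionRep T α f y G F) {χ : ℝ → ℝ} {t₀ t₁ : ℝ}
    {b : ℝ → ℝ} (hb : HasTrace α t₀ t₁ (fun z => χ z.1 * G z) b) :
    ∀ᵐ t ∂(volume.restrict (Ioo 0 T)), t ∈ Ioo t₀ t₁ →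
      HasDerivWithinAt (fun x => χ t * y t x) (b t) (Icc 0 1) 1 := by
  obtain ⟨h, hm, h2, hae⟩ := hb
  have a1 := (ae_restrict_iff' measurableSet_Ioo).1 hae
  have a2 := (ae_restrict_iff' measurableSet_Ioo).1 (ae_memLp_slice_right hm h2)
  have a3 : ∀ᵐ t, MemLp (fun x => G (t, x)) 2 unitVol :=
    ae_memLp_slice_right S.meas_G S.memLp_G
  filter_upwards [S.ae_y, ae_restrict_of_ae a1, ae_restrict_of_ae a2, ae_restrict_of_ae a3]
    with t hy h1 h2 h3 ht
  have h1 := h1 ht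
  have h2 := (h2 ht).integrable one_le_two
  -- A version of χ(t) y_x(t, ·) that is continuous from the left at x = 1 with value b(t). The
  -- fundamental theorem of calculus then yields the one-sided derivative.
  set κ : ℝ → ℝ := fun x => x ^ (-α) * (b t - tailInt h (t, x)) with hκ
  have hκm : Measurable κ := by
    have := (measurable_tailInt hm).comp (measurable_prodMk_left (x := t))
    have h5 : Measurable fun x : ℝ => x ^ (-α) := by fun_prop
    exact h5.mul (this.const_sub _)
  have hκae : ∀ᵐ x ∂unitVol, x ^ (-(α / 2)) * (χ t * G (t, x)) = κ x := by
    filter_upwards [h1, ae_restrict_mem measurableSet_Ioo] with x hx hxm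
    rw [hκ]
    simp only
    rw [← hx, ← mul_assoc (x ^ (-α)), ← Real.rpow_add hxm.1]
    congr 2; ring
  have hκi : IntervalIntegrable κ volume 0 1 := by
    rw [intervalIntegrable_iff_integrableOn_Ioo_of_le zero_le_one]
    exact ((memLp_rpow_neg_half hα.2).integrable_mul (h3.const_mul (χ t))).congr hκae
  have hhi : IntervalIntegrable (fun x => h (t, x)) volume 0 1 := by
    rw [intervalIntegrable_iff_integrableOn_Ioo_of_le zero_le_one]
    exact h2
  have htc : ContinuousOn (fun x => tailInt h (t, x)) (Icc 0 1) := by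
    have h5 := (hhi.absolutelyContinuousOnInterval_intervalIntegral (c := 1)
      right_mem_uIcc).fun_neg.continuousOn
    rw [uIcc_of_le zero_le_one] at h5
    refine h5.congr fun x _ => ?_
    exact intervalIntegral.integral_symm _ _
  have hcont : ContinuousWithinAt κ (Iic 1) 1 := by
    rw [ContinuousWithinAt, ← nhdsWithin_Icc_eq_nhdsLE (zero_lt_one' ℝ)]
    refine ContinuousWithinAt.mul ?_ (continuousWithinAt_const.sub
      (htc 1 ⟨zero_le_one, le_rfl⟩))
    exact (Real.continuousAt_rpow_const _ _ (Or.inl one_ne_zero)).continuousWithinAt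
  have hd := intervalIntegral.integral_hasDerivWithinAt_right hκi (s := Iic 1) (t := Iic 1)
    (hκm.stronglyMeasurable.stronglyMeasurableAtFilter) hcont
  have hκ1 : κ 1 = b t := by
    simp [hκ, tailInt]
  rw [hκ1] at hd
  have heq : ∀ x ∈ Icc (0 : ℝ) 1, χ t * y t x = ∫ ξ in (0 : ℝ)..x, κ ξ := fun x hx => by
    rw [← hy.2 x hx, ← prim_mul α χ G (t, x), prim, intervalIntegral_eq_Ioo hx.1,
      intervalIntegral_eq_Ioo hx.1]
    exact integral_congr_ae
      (ae_mono (Measure.restrict_mono (Ioo_subset_Ioo_right hx.2) le_rfl) hκae)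
  exact (hd.mono Icc_subset_Iic_self).congr heq (heq 1 ⟨zero_le_one, le_rfl⟩)

theorem uniqueDiffWithinAt_one : UniqueDiffWithinAt ℝ (Icc (0 : ℝ) 1) 1 :=
  uniqueDiffOn_Icc zero_lt_one 1 ⟨zero_le_one, le_rfl⟩

/-- The normal derivative at `x = 1` exists, and is square integrable with the weight
`t (T - t)`. -/
theorem SolutionRep.exists_normalDeriv {T α : ℝ} (hT : 0 < T) (hα : α ∈ Ioo (0 : ℝ) 1)
    {f y : ℝ → ℝ → ℝ} {G F : ℝ × ℝ → ℝ} (S : SolutionRep T α f y G F) :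
    ∃ b : ℝ → ℝ, Measurable b ∧ MemLp b 2 (volume.restrict (Ioo 0 T)) ∧
      ∀ᵐ t ∂(volume.restrict (Ioo 0 T)), DifferentiableWithinAt ℝ (y t) (Icc 0 1) 1 ∧
        derivAtOne y t = b t / (t * (T - t)) := by
  -- This cut-off vanishes at 0 and T but nowhere in between, so a single trace covers the whole of
  -- (0, T) after division.
  obtain ⟨χ, hχt⟩ : ∃ χ : ℝ → ℝ, ∀ t, χ t = t * (T - t) := ⟨fun t => t * (T - t), fun _ => rfl⟩
  have hχ : ContDiff ℝ 1 χ := by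
    rw [funext hχt]
    exact contDiff_id.mul (contDiff_const.sub contDiff_id)
  have W := S.weakSolution hT hα hχ (by simp [hχt]) (by simp [hχt])
  obtain ⟨ρ, hρ⟩ := exists_isMollifier (zero_lt_one' ℝ)
  -- The extension by zero is supported in (0, T) = (-1 + ε, T + 1 - ε) with ε = 1, which gives the
  -- room required for mollification.
  obtain ⟨b, hbm, hb2, htr, -⟩ := W.exists_trace hα zero_lt_one hρ (t₀ := -1) (t₁ := T + 1)
    (by linarith) fun τ x hτ => by
      rw [neg_add_cancel, add_sub_cancel_right] at hτ
      rw [S.zero_G τ x hτ, mul_zero]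
  refine ⟨b, hbm, hb2.mono_measure (Measure.restrict_mono (Ioo_subset_Ioo (by linarith)
    (by linarith)) le_rfl), ?_⟩
  filter_upwards [S.hasDerivWithinAt hα htr, ae_restrict_mem measurableSet_Ioo] with t ht htm
  have h0 : t * (T - t) ≠ 0 := (mul_pos htm.1 (sub_pos.2 htm.2)).ne'
  have h1 := (ht ⟨by linarith [htm.1], by linarith [htm.2]⟩).const_mul (t * (T - t))⁻¹
  simp only [hχt, inv_mul_cancel_left₀ h0] at h1
  have h2 : HasDerivWithinAt (y t) ((t * (T - t))⁻¹ * b t) (Icc 0 1) 1 := h1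
  refine ⟨h2.differentiableWithinAt, ?_⟩
  rw [derivAtOne, h2.derivWithin uniqueDiffWithinAt_one, div_eq_inv_mul]

/-! ### Decay of the weight at the end times, and cut-off functions -/

theorem exp_phi_le {T k β lam d s t x : ℝ} (hβ : β < 1) (hlam : 0 < lam) (hd : 5 ≤ d)
    (hs : 0 ≤ s) (ht : t ∈ Ioo 0 T) (hx : x ∈ Icc (0 : ℝ) 1) :
    Real.exp (2 * s * phi T k β lam d t x) ≤ Real.exp (-(8 * s * lam * Theta T k t)) := by
  rw [Real.exp_le_exp, phi]
  have h1 := (psi_bounds hβ hlam hd hx).1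
  have h2 := mul_nonneg hs (theta_pos (k := k) ht).le
  nlinarith [mul_le_mul_of_nonneg_left h1 h2]

/-- The first bound is y + 1 ≤ e^y at y = cx; the second is its square with c/2 in place of c. -/
theorem mul_exp_neg_le {c x : ℝ} (hc : 0 < c) (hx : 0 ≤ x) :
    x * Real.exp (-(c * x)) ≤ 1 / c ∧ x ^ 2 * Real.exp (-(c * x)) ≤ 4 / c ^ 2 := by
  have key : ∀ a : ℝ, 0 < a → x * Real.exp (-(a * x)) ≤ 1 / a := fun a ha => by
    have h := Real.add_one_le_exp (a * x)
    rw [Real.exp_neg, ← div_eq_mul_inv, div_le_div_iff₀ (Real.exp_pos _) ha]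
    linarith
  refine ⟨key c hc, ?_⟩
  have h := key (c / 2) (by linarith)
  have h0 : 0 ≤ x * Real.exp (-(c / 2 * x)) := mul_nonneg hx (Real.exp_pos _).le
  calc x ^ 2 * Real.exp (-(c * x)) = (x * Real.exp (-(c / 2 * x))) ^ 2 := by
        rw [mul_pow, ← Real.exp_nat_mul]; congr 2; push_cast; ring
    _ ≤ (1 / (c / 2)) ^ 2 := pow_le_pow_left₀ h0 h 2
    _ = 4 / c ^ 2 := by field_simp; norm_num

/-- The Carleman weight beats the singularities in time. -/
theorem exists_weight_bound {T k β lam d s : ℝ} (hT : 0 < T) (hk : 4 ≤ k) (hβ : β < 1)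
    (hlam : 0 < lam) (hd : 5 ≤ d) (hs : 0 < s) : ∃ M, 0 ≤ M ∧ ∀ t ∈ Ioo 0 T,
      ∀ x ∈ Icc (0 : ℝ) 1,
      1 / (t * (T - t)) ^ 2 * Real.exp (2 * s * phi T k β lam d t x) ≤ M ∧
      Theta T k t * (1 / (t * (T - t)) ^ 2) * Real.exp (2 * s * phi T k β lam d t x) ≤ M := by
  obtain ⟨C₀, hC₀, hC⟩ := exists_theta_bounds hT hk
  set c := 8 * s * lam with hc
  have hc0 : 0 < c := by positivity
  refine ⟨C₀ * (1 / c) + C₀ * (4 / c ^ 2), by positivity, fun t ht x hx => ?_⟩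
  have h1 := (hC t ht).1
  have h2 := theta_pos (k := k) ht
  obtain ⟨h3, h4⟩ := mul_exp_neg_le hc0 h2.le
  have h5 := exp_phi_le (k := k) hβ hlam hd hs.le ht hx
  have e1 : 0 ≤ C₀ * (1 / c) := by positivity
  have e2 : 0 ≤ C₀ * (4 / c ^ 2) := by positivity
  have e3 : 1 / (t * (T - t)) ^ 2 * Real.exp (2 * s * phi T k β lam d t x) ≤
      C₀ * (Theta T k t * Real.exp (-(c * Theta T k t))) := by
    rw [← mul_assoc]
    exact mul_le_mul h1 h5 (Real.exp_pos _).le (mul_nonneg hC₀ h2.le)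
  constructor
  · nlinarith [mul_le_mul_of_nonneg_left h3 hC₀]
  · have := mul_le_mul_of_nonneg_left e3 h2.le
    nlinarith [mul_le_mul_of_nonneg_left h4 hC₀]

theorem boundaryTerm_nonneg {T β k lam d s t : ℝ} {y : ℝ → ℝ → ℝ} (hs : 0 ≤ s)
    (ht : t ∈ Ioo 0 T) : 0 ≤ boundaryTerm T β k lam d s y t := by
  have h := theta_pos (k := k) ht
  unfold boundaryTerm
  positivity

/-- The normal derivative is b/(t(T - t)) with b in L². The factor Θ/(t(T - t))² is at most C₀Θ²,
which the exponential weight keeps bounded. -/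
theorem SolutionRep.integrable_boundaryTerm {T α β k lam d s : ℝ} (hT : 0 < T)
    (hα : α ∈ Ioo (0 : ℝ) 1) (hβ : β < 1) (hk : 4 ≤ k) (hlam : 0 < lam) (hd : 5 ≤ d) (hs : 0 < s)
    {f y : ℝ → ℝ → ℝ} {G F : ℝ × ℝ → ℝ} (S : SolutionRep T α f y G F) :
    IntegrableOn (boundaryTerm T β k lam d s y) (Ioo 0 T) := by
  obtain ⟨b, hbm, hb2, hae⟩ := S.exists_normalDeriv hT hα
  obtain ⟨M, hM0, hM⟩ := exists_weight_bound (k := k) hT hk hβ hlam hd hs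
  have hΘm := measurable_theta T k
  have hm : Measurable fun t => s * Theta T k t * (b t / (t * (T - t))) ^ 2
      * Real.exp (2 * s * phi T k β lam d t 1) := by
    unfold phi; fun_prop
  have h1 : Integrable (fun t => s * Theta T k t * (b t / (t * (T - t))) ^ 2
      * Real.exp (2 * s * phi T k β lam d t 1)) (volume.restrict (Ioo 0 T)) := by
    refine Integrable.mono' (hb2.integrable_sq.const_mul (s * M)) hm.aestronglyMeasurable ?_
    filter_upwards [ae_restrict_mem measurableSet_Ioo] with t ht
    have h2 := theta_pos (k := k) ht
    have h3 := (hM t ht 1 ⟨zero_le_one, le_rfl⟩).2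
    rw [Real.norm_of_nonneg (by positivity), div_pow, div_eq_mul_one_div (b t ^ 2)]
    have h4 := mul_le_mul_of_nonneg_left h3 (mul_nonneg hs.le (sq_nonneg (b t)))
    linarith
  refine h1.congr ?_
  filter_upwards [hae] with t ht
  rw [boundaryTerm, ht.2]

theorem integrable_sourceTerm {T β k lam d s : ℝ} (hβ : β < 1) (hlam : 0 < lam) (hd : 5 ≤ d)
    (hs : 0 ≤ s) {f : ℝ → ℝ → ℝ} (hf : MemL2 T f) :
    Integrable (fun p : ℝ × ℝ => sourceTerm T β k lam d s f p.1 p.2) (stripVol 0 T) := by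
  rw [MemL2, restrict_domain] at hf
  unfold sourceTerm
  refine hf.integrable_sq.mul_bdd (c := 1) ?_ ?_
  · have := (measurable_weight_theta T k β lam d s).pow_const 2
    simp only [weight_sq_eq] at this
    exact this.aestronglyMeasurable
  · filter_upwards [ae_prod_mem_unit _, ae_stripVol_fst (ae_restrict_mem measurableSet_Ioo)]
      with z h1 h2
    rw [Real.norm_of_nonneg (Real.exp_pos _).le]
    exact exp_phi_le_one hβ hlam hd hs h2 (Ioo_subset_Icc_self h1)

theorem deriv_smoothTransition_of_one_lt {x : ℝ} (hx : 1 < x) : deriv Real.smoothTransition x = 0 := by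
  have h : Real.smoothTransition =ᶠ[𝓝 x] fun _ => 1 := by
    filter_upwards [lt_mem_nhds hx] with y hy
    exact Real.smoothTransition.one_of_one_le hy.le
  rw [h.deriv_eq, deriv_const]

theorem exists_deriv_smoothTransition_le :
    ∃ K, 0 ≤ K ∧ ∀ x, |deriv Real.smoothTransition x| ≤ K := by
  have hc : Continuous (deriv Real.smoothTransition) :=
    (Real.smoothTransition.contDiff (n := 1)).continuous_deriv le_rfl
  obtain ⟨K, hK⟩ := (isCompact_Icc (a := (0 : ℝ)) (b := 1)).exists_bound_of_continuousOn
    hc.continuousOn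
  have hK0 : 0 ≤ K := (norm_nonneg _).trans (hK 0 ⟨le_rfl, zero_le_one⟩)
  refine ⟨K, hK0, fun x => ?_⟩
  by_cases h1 : 1 < x
  · rw [deriv_smoothTransition_of_one_lt h1, abs_zero]; exact hK0
  by_cases h0 : x < 0
  · have h : Real.smoothTransition =ᶠ[𝓝 x] fun _ => 0 := by
      filter_upwards [gt_mem_nhds h0] with y hy
      exact Real.smoothTransition.zero_of_nonpos hy.le
    rw [h.deriv_eq, deriv_const, abs_zero]; exact hK0
  · exact hK x ⟨not_lt.1 h0, not_lt.1 h1⟩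

/-- Cut-off functions that vanish near the ends of `(0, T)`. -/
structure IsCutoff (T K : ℝ) (χ : ℕ → ℝ → ℝ) : Prop where
  contDiff : ∀ n, ContDiff ℝ 1 (χ n)
  mem_Icc : ∀ n t, χ n t ∈ Icc (0 : ℝ) 1
  support : ∀ n, ∃ ε, 0 < ε ∧ ε ≤ T - ε ∧ ∀ t ∉ Ioo (ε + ε) (T - ε - ε), χ n t = 0
  deriv_le : ∀ n, ∀ t ∈ Ioo 0 T, |deriv (χ n) t| ≤ K / (t * (T - t))
  eventually : ∀ t ∈ Ioo 0 T, ∀ᶠ n in atTop, χ n t = 1 ∧ deriv (χ n) t = 0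

/-- χ_n is a smooth step in t(T - t)/δ_n - 1 with δ_n tending to 0: it is 0 where t(T - t) ≤ δ_n and
1 where t(T - t) ≥ 2δ_n. Its derivative is O(1/δ_n), and is nonzero only where δ_n is comparable to
t(T - t). -/
theorem exists_isCutoff {T : ℝ} (hT : 0 < T) : ∃ K χ, IsCutoff T K χ := by
  obtain ⟨K, hK0, hK⟩ := exists_deriv_smoothTransition_le
  set δ : ℕ → ℝ := fun n => T ^ 2 / (n + 1) with hδ
  have hδ0 : ∀ n, 0 < δ n := fun n => by rw [hδ]; positivity
  have hδT : ∀ n, δ n ≤ T ^ 2 := fun n =>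
    div_le_self (sq_nonneg T) (by linarith [(Nat.cast_nonneg n : (0 : ℝ) ≤ n)])
  have hδt : Tendsto δ atTop (𝓝 0) :=
    ((tendsto_const_div_atTop_nhds_zero_nat (T ^ 2)).comp (tendsto_add_atTop_nat 1)).congr
      fun n => by simp [hδ]
  have hd : ∀ n t, HasDerivAt (fun t => Real.smoothTransition (t * (T - t) / δ n - 1))
      (deriv Real.smoothTransition (t * (T - t) / δ n - 1) * ((T - 2 * t) / δ n)) t := fun n t => by
    have h1 : HasDerivAt (fun t => t * (T - t) / δ n - 1) ((T - 2 * t) / δ n) t := by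
      have h2 := (((hasDerivAt_id t).fun_mul ((hasDerivAt_id t).const_sub T)).div_const
        (δ n)).sub_const 1
      refine h2.congr_deriv ?_
      simp only [id]; ring
    exact ((Real.smoothTransition.contDiff (n := 1)).differentiable one_ne_zero
      _).hasDerivAt.comp t h1
  refine ⟨2 * K * T, fun n t => Real.smoothTransition (t * (T - t) / δ n - 1),
    fun n => ?_, fun n t => ⟨Real.smoothTransition.nonneg _, Real.smoothTransition.le_one _⟩,
    fun n => ?_, fun n t ht => ?_, fun t ht => ?_⟩
  · exact Real.smoothTransition.contDiff.comp
      (((contDiff_id.mul (contDiff_const.sub contDiff_id)).div_const _).sub contDiff_const)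
  -- With ε = δ_n/(2T), at distance at most 2ε from an end one has t(T - t) ≤ 2εT = δ_n, where the
  -- step is still 0.
  · have hε : 0 < δ n / (2 * T) := div_pos (hδ0 n) (by linarith)
    have e : δ n / (2 * T) * (2 * T) = δ n := div_mul_cancel₀ _ (by positivity)
    refine ⟨δ n / (2 * T), hε, ?_, fun t ht => Real.smoothTransition.zero_of_nonpos ?_⟩
    · have := hδT n
      nlinarith
    · rw [sub_nonpos, div_le_one (hδ0 n)]
      rw [mem_Ioo, not_and_or, not_lt, not_lt] at ht
      rcases ht with ht | ht
      · nlinarith [sq_nonneg t]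
      · nlinarith [sq_nonneg (T - t)]
  · rw [(hd n t).deriv]
    have h0 : 0 < t * (T - t) := mul_pos ht.1 (sub_pos.2 ht.2)
    by_cases h1 : 1 < t * (T - t) / δ n - 1
    · rw [deriv_smoothTransition_of_one_lt h1, zero_mul, abs_zero]
      positivity
    -- Here 1/δ_n ≤ 2/(t(T - t)), the source of the constant 2KT.
    · have h2 : t * (T - t) / δ n ≤ 2 := by linarith
      rw [div_le_iff₀ (hδ0 n)] at h2
      have h3 : |T - 2 * t| ≤ T := by rw [abs_le]; constructor <;> linarith [ht.1, ht.2]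
      rw [abs_mul, abs_div, abs_of_pos (hδ0 n), le_div_iff₀ h0]
      have h4 : |T - 2 * t| / δ n * (t * (T - t)) ≤ T * 2 := by
        rw [div_mul_eq_mul_div, div_le_iff₀ (hδ0 n)]
        calc |T - 2 * t| * (t * (T - t)) ≤ T * (2 * δ n) :=
              mul_le_mul h3 h2 h0.le hT.le
          _ = T * 2 * δ n := by ring
      have h5 : 0 ≤ |T - 2 * t| / δ n * (t * (T - t)) :=
        mul_nonneg (div_nonneg (abs_nonneg _) (hδ0 n).le) h0.le
      rw [mul_assoc]
      calc _ ≤ K * (T * 2) := mul_le_mul (hK _) h4 h5 hK0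
        _ = 2 * K * T := by ring
  · have h0 : 0 < t * (T - t) := mul_pos ht.1 (sub_pos.2 ht.2)
    filter_upwards [hδt.eventually_lt_const (show (0 : ℝ) < t * (T - t) / 2 by linarith)] with n hn
    have h1 : 1 < t * (T - t) / δ n - 1 := by
      rw [lt_sub_iff_add_lt, lt_div_iff₀ (hδ0 n)]; linarith
    rw [(hd n t).deriv, deriv_smoothTransition_of_one_lt h1, zero_mul]
    exact ⟨Real.smoothTransition.one_of_one_le h1.le, rfl⟩

theorem lintegral_stripVol_eq {t₀ t₁ a b : ℝ} {f : ℝ × ℝ → ENNReal}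
    (hf : ∀ z, z.1 ∉ Ioo t₀ t₁ → f z = 0) (hsub : Ioo t₀ t₁ ⊆ Ioo a b) :
    ∫⁻ z, f z ∂(stripVol a b) = ∫⁻ z, f z ∂(stripVol t₀ t₁) := by
  rw [stripVol_eq_restrict, stripVol_eq_restrict,
    ← lintegral_indicator (measurableSet_Ioo.prod .univ),
    ← lintegral_indicator (measurableSet_Ioo.prod .univ)]
  refine lintegral_congr fun z => ?_
  by_cases hz : z.1 ∈ Ioo t₀ t₁
  · rw [indicator_of_mem (show z ∈ Ioo a b ×ˢ (univ : Set ℝ) from ⟨hsub hz, mem_univ _⟩),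
      indicator_of_mem (show z ∈ Ioo t₀ t₁ ×ˢ (univ : Set ℝ) from ⟨hz, mem_univ _⟩)]
  · rw [indicator_apply_eq_zero.2 fun _ => hf z hz, indicator_apply_eq_zero.2 fun _ => hf z hz]

theorem measurable_exp_phi (T k β lam d s : ℝ) :
    Measurable fun z : ℝ × ℝ => Real.exp (2 * s * phi T k β lam d z.1 z.2) := by
  have := (measurable_weight_theta T k β lam d s).pow_const 2
  simpa only [weight_sq_eq] using this

section

variable {T α k β lam d s K : ℝ} {f y : ℝ → ℝ → ℝ} {G F : ℝ × ℝ → ℝ} {χ : ℕ → ℝ → ℝ}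

/-- Bound for the commutator with the cut-off. -/
theorem IsCutoff.exists_commutator_le (hχ : IsCutoff T K χ) (hT : 0 < T) (hk : 4 ≤ k)
    (hβ : β < 1) (hlam : 0 < lam) (hd : 5 ≤ d) (hs : 0 < s) :
    ∃ M, ∀ n, ∀ t ∈ Ioo 0 T, ∀ x ∈ Ioo (0 : ℝ) 1, ∀ p : ℝ,
      (deriv (χ n) t * p) ^ 2 * Real.exp (2 * s * phi T k β lam d t x) ≤ M * p ^ 2 := by
  obtain ⟨M, hM0, hM⟩ := exists_weight_bound (k := k) hT hk hβ hlam hd hs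
  refine ⟨K ^ 2 * M, fun n t ht x hx p => ?_⟩
  have h1 := (hM t ht x (Ioo_subset_Icc_self hx)).1
  have h2 := hχ.deriv_le n t ht
  have h3 : deriv (χ n) t ^ 2 ≤ K ^ 2 * (1 / (t * (T - t)) ^ 2) := by
    rw [← sq_abs]
    refine (pow_le_pow_left₀ (abs_nonneg _) h2 2).trans_eq ?_
    rw [div_pow, div_eq_mul_one_div]
  calc (deriv (χ n) t * p) ^ 2 * Real.exp (2 * s * phi T k β lam d t x)
      = deriv (χ n) t ^ 2 * (Real.exp (2 * s * phi T k β lam d t x) * p ^ 2) := by ring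
    _ ≤ K ^ 2 * (1 / (t * (T - t)) ^ 2) * (Real.exp (2 * s * phi T k β lam d t x) * p ^ 2) :=
        mul_le_mul_of_nonneg_right h3 (by positivity)
    _ = K ^ 2 * (1 / (t * (T - t)) ^ 2 * Real.exp (2 * s * phi T k β lam d t x)) * p ^ 2 := by ring
    _ ≤ K ^ 2 * M * p ^ 2 :=
        mul_le_mul_of_nonneg_right (mul_le_mul_of_nonneg_left h1 (sq_nonneg K)) (sq_nonneg p)

/-- Dominated convergence: at each t the derivative of the cut-off is eventually 0, and
`exists_commutator_le` dominates the integrands by a multiple of P². -/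
theorem IsCutoff.integral_commutator (hχ : IsCutoff T K χ) (hT : 0 < T) (hk : 4 ≤ k)
    (hβ : β < 1) (hlam : 0 < lam) (hd : 5 ≤ d) (hs : 0 < s) {P : ℝ × ℝ → ℝ}
    (hP : Measurable P) (hP2 : MemLp P 2 (stripVol 0 T)) :
    (∀ n, Integrable (fun z => (deriv (χ n) z.1 * P z) ^ 2
      * Real.exp (2 * s * phi T k β lam d z.1 z.2)) (stripVol 0 T)) ∧
    Tendsto (fun n => ∫ z, (deriv (χ n) z.1 * P z) ^ 2
      * Real.exp (2 * s * phi T k β lam d z.1 z.2) ∂(stripVol 0 T)) atTop (𝓝 0) := by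
  obtain ⟨M, hM⟩ := hχ.exists_commutator_le (k := k) hT hk hβ hlam hd hs
  have hm : ∀ n, AEStronglyMeasurable (fun z : ℝ × ℝ => (deriv (χ n) z.1 * P z) ^ 2
      * Real.exp (2 * s * phi T k β lam d z.1 z.2)) (stripVol 0 T) := fun n => by
    have h1 := ((hχ.contDiff n).continuous_deriv le_rfl).measurable
    have h2 := measurable_exp_phi T k β lam d s
    exact Measurable.aestronglyMeasurable (by fun_prop)
  have hb : ∀ n, ∀ᵐ z ∂(stripVol 0 T), ‖(deriv (χ n) z.1 * P z) ^ 2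
      * Real.exp (2 * s * phi T k β lam d z.1 z.2)‖ ≤ M * P z ^ 2 := fun n => by
    filter_upwards [ae_prod_mem_unit _, ae_stripVol_fst (ae_restrict_mem measurableSet_Ioo)]
      with z h1 h2
    rw [Real.norm_of_nonneg (by positivity)]
    exact hM n z.1 h2 z.2 h1 _
  have hi : Integrable (fun z => M * P z ^ 2) (stripVol 0 T) := hP2.integrable_sq.const_mul M
  refine ⟨fun n => hi.mono' (hm n) (hb n), ?_⟩
  have h0 : ∫ _ : ℝ × ℝ, (0 : ℝ) ∂(stripVol 0 T) = 0 := integral_zero _ _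
  refine Tendsto.mono_right (tendsto_integral_of_dominated_convergence (f := fun _ => 0) _ hm hi hb ?_)
    (congrArg 𝓝 h0).le
  filter_upwards [ae_stripVol_fst (ae_restrict_mem measurableSet_Ioo)] with z hz
  refine tendsto_const_nhds.congr' ?_
  filter_upwards [hχ.eventually z.1 hz] with n hn
  rw [hn.2]; simp

theorem SolutionRep.sourceTerm_ae (S : SolutionRep T α f y G F) :
    ∀ᵐ z ∂(stripVol 0 T), F z ^ 2 * Real.exp (2 * s * phi T k β lam d z.1 z.2) =
      sourceTerm T β k lam d s f z.1 z.2 := by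
  filter_upwards [S.ae_F] with z hz
  rw [sourceTerm, hz]

theorem SolutionRep.interiorTerm_ae (S : SolutionRep T α f y G F) :
    ∀ᵐ z ∂(stripVol 0 T), carlemanDensity T α β k lam d s z.1 z.2 (prim α G z)
      (z.2 ^ (-(α / 2)) * G z) = interiorTerm T α β k lam d s y z.1 z.2 := by
  filter_upwards [S.ae_G, ae_stripVol_fst S.ae_y, ae_prod_mem_unit _] with z h1 h2 h3
  have e : z.2 ^ (-(α / 2)) * G z = deriv (y z.1) z.2 := by
    rw [h1, ← mul_assoc, ← Real.rpow_add h3.1, neg_add_cancel, Real.rpow_zero, one_mul]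
  rw [e, show prim α G z = y z.1 z.2 from h2.2 z.2 (Ioo_subset_Icc_self h3)]
  rfl

/-- The boundary term of the truncated solution. -/
theorem SolutionRep.integral_boundary_le (S : SolutionRep T α f y G F) (hT : 0 < T)
    (hα : α ∈ Ioo (0 : ℝ) 1) (hβ : β < 1) (hk : 4 ≤ k) (hlam : 0 < lam) (hd : 5 ≤ d) (hs : 0 < s)
    {κ b : ℝ → ℝ} (hκ : ∀ t, κ t ∈ Icc (0 : ℝ) 1) {t₀ t₁ : ℝ} (hsub : Ioo t₀ t₁ ⊆ Ioo 0 T)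
    (hb : HasTrace α t₀ t₁ (fun z => κ z.1 * G z) b) :
    ∫ t in Ioo t₀ t₁, s * Theta T k t * b t ^ 2 * Real.exp (2 * s * phi T k β lam d t 1) ≤
      ∫ t in Ioo 0 T, boundaryTerm T β k lam d s y t := by
  have hi : Integrable (boundaryTerm T β k lam d s y) (volume.restrict (Ioo 0 T)) :=
    S.integrable_boundaryTerm hT hα hβ hk hlam hd hs
  obtain ⟨b₀, -, -, h0⟩ := S.exists_normalDeriv hT hα
  have hle := Measure.restrict_mono (μ := volume) hsub le_rfl
  have h1 : ∀ᵐ t ∂(volume.restrict (Ioo t₀ t₁)), s * Theta T k t * b t ^ 2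
      * Real.exp (2 * s * phi T k β lam d t 1) ≤ boundaryTerm T β k lam d s y t := by
    filter_upwards [ae_mono hle (S.hasDerivWithinAt hα hb), ae_mono hle h0,
      ae_restrict_mem measurableSet_Ioo] with t k1 k2 ht
    -- The trace of the truncated solution and κ(t) y_x(t,1) are both derivatives of κ(t) y(t, ·) at
    -- x = 1, hence equal; 0 ≤ κ ≤ 1 then gives the comparison.
    have k3 := (k2.1.hasDerivWithinAt.const_mul (κ t))
    have k4 : b t = κ t * derivAtOne y t :=
      uniqueDiffWithinAt_one.eq_deriv _ (k1 ht) k3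
    have k5 := theta_pos (k := k) (hsub ht)
    have k6 : b t ^ 2 ≤ derivAtOne y t ^ 2 := by
      rw [k4, mul_pow]
      exact mul_le_of_le_one_left (sq_nonneg _) (pow_le_one₀ (hκ t).1 (hκ t).2)
    rw [boundaryTerm]
    exact mul_le_mul_of_nonneg_right (mul_le_mul_of_nonneg_left k6 (by positivity))
      (Real.exp_pos _).le
  refine (integral_mono_of_nonneg ?_ (hi.mono_measure hle) h1).trans
    (integral_mono_measure hle ?_ hi)
  · filter_upwards [ae_restrict_mem measurableSet_Ioo] with t ht
    have := theta_pos (k := k) (hsub ht)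
    rw [Pi.zero_apply]
    positivity
  · filter_upwards [ae_restrict_mem measurableSet_Ioo] with t ht
    exact boundaryTerm_nonneg hs.le ht

/-- The source term of the truncated solution. -/
theorem SolutionRep.integral_source_le (S : SolutionRep T α f y G F) (hf : MemL2 T f)
    (hβ : β < 1) (hlam : 0 < lam) (hd : 5 ≤ d) (hs : 0 < s)
    {κ : ℝ → ℝ} (hκ : ∀ t, κ t ∈ Icc (0 : ℝ) 1) {t₀ t₁ : ℝ} (hsub : Ioo t₀ t₁ ⊆ Ioo 0 T)
    (hi : Integrable (fun z => (deriv κ z.1 * prim α G z) ^ 2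
      * Real.exp (2 * s * phi T k β lam d z.1 z.2)) (stripVol 0 T)) :
    ∫ z, (κ z.1 * F z + deriv κ z.1 * prim α G z) ^ 2
        * Real.exp (2 * s * phi T k β lam d z.1 z.2) ∂(stripVol t₀ t₁) ≤
      2 * (∫ z, sourceTerm T β k lam d s f z.1 z.2 ∂(stripVol 0 T)) +
      2 * ∫ z, (deriv κ z.1 * prim α G z) ^ 2
        * Real.exp (2 * s * phi T k β lam d z.1 z.2) ∂(stripVol 0 T) := by
  have hle : stripVol t₀ t₁ ≤ stripVol 0 T :=
    Measure.prod_mono (Measure.restrict_mono hsub le_rfl) le_rfl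
  have hF : Integrable (fun z => F z ^ 2 * Real.exp (2 * s * phi T k β lam d z.1 z.2))
      (stripVol 0 T) :=
    (integrable_sourceTerm hβ hlam hd hs.le hf).congr (S.sourceTerm_ae.mono fun z h => h.symm)
  rw [← integral_congr_ae S.sourceTerm_ae, ← integral_const_mul, ← integral_const_mul,
    ← integral_add (hF.const_mul 2) (hi.const_mul 2)]
  have hsum := (hF.const_mul 2).add (hi.const_mul 2)
  refine (integral_mono_of_nonneg (ae_of_all _ fun z => ?_) (hsum.mono_measure hle)
    (ae_of_all _ fun z => ?_)).trans (integral_mono_measure hle (ae_of_all _ fun z => ?_) hsum)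
  · exact mul_nonneg (sq_nonneg _) (Real.exp_pos _).le
  · have h1 : (κ z.1 * F z + deriv κ z.1 * prim α G z) ^ 2 ≤
        2 * F z ^ 2 + 2 * (deriv κ z.1 * prim α G z) ^ 2 := by
      have h2 : (κ z.1 * F z) ^ 2 ≤ F z ^ 2 := by
        rw [mul_pow]
        exact mul_le_of_le_one_left (sq_nonneg _) (pow_le_one₀ (hκ _).1 (hκ _).2)
      nlinarith [sq_nonneg (κ z.1 * F z - deriv κ z.1 * prim α G z)]
    have h3 := mul_le_mul_of_nonneg_right h1
      (Real.exp_pos (2 * s * phi T k β lam d z.1 z.2)).le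
    simp only [Pi.add_apply]
    linarith
  · have h4 := (Real.exp_pos (2 * s * phi T k β lam d z.1 z.2)).le
    simp only [Pi.zero_apply, Pi.add_apply]
    positivity

end

/-! ### Removal of the cut-off, and the theorem -/

/-- The estimate for χ_n y has a right-hand side independent of n up to the commutator, which tends
to 0; Fatou's lemma removes the cut-off on the left. The constant doubles because of (a + b)² ≤ 2a²
+ 2b² in the source. -/
theorem exists_carleman_lintegral {T α β k lam d : ℝ} (hT : 0 < T) (hα : α ∈ Ioo (0 : ℝ) 1)
    (hβ : β ∈ Ico α 1) (hk : 4 ≤ k) (hlam : 0 < lam) (hd : 5 ≤ d) :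
    ∃ C s₀ : ℝ, 0 < C ∧ 0 < s₀ ∧ ∀ (f y : ℝ → ℝ → ℝ) (G F : ℝ × ℝ → ℝ),
      SolutionRep T α f y G F → MemL2 T f → ∀ s, s₀ ≤ s →
      ∫⁻ z, ENNReal.ofReal (carlemanDensity T α β k lam d s z.1 z.2 (prim α G z)
          (z.2 ^ (-(α / 2)) * G z)) ∂(stripVol 0 T) ≤
        ENNReal.ofReal (C * ((∫ z, sourceTerm T β k lam d s f z.1 z.2 ∂(stripVol 0 T))
          + ∫ t in Ioo 0 T, boundaryTerm T β k lam d s y t)) := by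
  obtain ⟨C, s₀, hC, hs₀, H⟩ := exists_carleman_weak hT hα hβ hk hlam hd
  obtain ⟨K, χ, hχ⟩ := exists_isCutoff hT
  refine ⟨2 * C, s₀, by positivity, hs₀, fun f y G F S hf s hs => ?_⟩
  have hs0 : 0 < s := hs₀.trans_le hs
  have hPm := measurable_prim α S.meas_G
  have hP2 : MemLp (prim α G) 2 (stripVol 0 T) :=
    (memLp_prim hα.2 S.meas_G S.memLp_G).mono_measure (stripVol_le 0 T)
  obtain ⟨hEi, hEt⟩ := hχ.integral_commutator (k := k) hT hk hβ.2 hlam hd hs0 hPm hP2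
  set Src := ∫ z, sourceTerm T β k lam d s f z.1 z.2 ∂(stripVol 0 T) with hSrc
  set Bd := ∫ t in Ioo 0 T, boundaryTerm T β k lam d s y t with hBd
  have hBd0 : 0 ≤ Bd := setIntegral_nonneg measurableSet_Ioo fun t ht =>
    boundaryTerm_nonneg hs0.le ht
  have hmr : Measurable fun z : ℝ × ℝ => z.2 ^ (-(α / 2)) := by fun_prop
  have hGm : ∀ n, Measurable fun z : ℝ × ℝ => χ n z.1 * G z := fun n =>
    ((hχ.contDiff n).continuous.measurable.comp measurable_fst).mul S.meas_G
  have hlim : ∀ᵐ z ∂(stripVol 0 T), Tendsto (fun n => χ n z.1) atTop (𝓝 1) := by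
    filter_upwards [ae_stripVol_fst (ae_restrict_mem measurableSet_Ioo)] with z hz
    exact tendsto_const_nhds.congr' ((hχ.eventually z.1 hz).mono fun n h => h.1.symm)
  have hR := (((hEt.const_mul 2).const_add (2 * Src)).add_const Bd).const_mul C
  rw [mul_zero, add_zero] at hR
  refine (lintegral_carlemanDensity_le_of_tendsto
    (u := fun n => prim α (fun z : ℝ × ℝ => χ n z.1 * G z))
    (p := fun n z => z.2 ^ (-(α / 2)) * (χ n z.1 * G z)) (u' := prim α G)
    (p' := fun z => z.2 ^ (-(α / 2)) * G z)
    (fun n => measurable_prim α (hGm n)) (fun n => hmr.mul (hGm n)) ?_ ?_ hR fun n => ?_).trans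
    (ENNReal.ofReal_le_ofReal ?_)
  · filter_upwards [hlim] with z hz
    simp only [prim_mul]
    simpa only [one_mul] using hz.mul_const (prim α G z)
  · filter_upwards [hlim] with z hz
    simpa only [one_mul] using (hz.mul_const (G z)).const_mul (z.2 ^ (-(α / 2)))
  -- The cut-off lives in (2ε, T - 2ε): one ε separates the strip (ε, T - ε) from the singularities
  -- of Θ, the other is the margin for mollification.
  · obtain ⟨ε, hε, hεT, hsupp⟩ := hχ.support n
    have hsub : Ioo ε (T - ε) ⊆ Ioo 0 T := Ioo_subset_Ioo hε.le (by linarith)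
    have hz0 : ∀ t, t ∉ Ioo ε (T - ε) → χ n t = 0 := fun t ht =>
      hsupp t fun h => ht ⟨by linarith [h.1], by linarith [h.2]⟩
    have W := S.weakSolution hT hα (hχ.contDiff n) (hz0 0 fun h => by linarith [h.1])
      (hz0 T fun h => by linarith [h.2])
    obtain ⟨b, hb, hle⟩ := H ε (T - ε) ε _ _ hε hεT (by linarith) hε W
      fun τ x hτ => by rw [hsupp τ hτ, zero_mul]
    rw [lintegral_stripVol_eq (t₀ := ε) (t₁ := T - ε) (fun z hz => ?_) hsub]
    · refine (hle s hs).trans (ENNReal.ofReal_le_ofReal (mul_le_mul_of_nonneg_left ?_ hC.le))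
      exact add_le_add (S.integral_source_le hf hβ.2 hlam hd hs0 (hχ.mem_Icc n) hsub (hEi n))
        (S.integral_boundary_le hT hα hβ.2 hk hlam hd hs0 (hχ.mem_Icc n) hsub hb)
    · rw [prim_mul, hz0 _ hz]
      simp [carlemanDensity]
  · nlinarith [mul_nonneg hC.le hBd0]

end DegenerateParabolic

end

theorem mainTheorem6 (T α β k lam d : ℝ) (hT : 0 < T) (hα : α ∈ Set.Ioo (0 : ℝ) 1)
    (hβ : β ∈ Set.Ico α 1) (hk : 4 ≤ k) (hlam : 0 < lam) (hd : 5 ≤ d) :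
    ∃ C s₀ : ℝ, 0 < C ∧ 0 < s₀ ∧
      ∀ (y₀ : ℝ → ℝ) (f y : ℝ → ℝ → ℝ),
        DegenerateParabolic.MemH1 α y₀ → DegenerateParabolic.MemL2 T f →
        DegenerateParabolic.IsSolution T α y₀ f y →
        -- the one-sided derivative `y_x(t,1)` exists for almost every `t`
        (∀ᵐ t ∂(volume.restrict (Set.Ioo 0 T)),
          DifferentiableWithinAt ℝ (y t) (Set.Icc 0 1) 1) ∧
        ∀ s : ℝ, s₀ ≤ s →
          -- the three integrals are finite
          IntegrableOn (fun p : ℝ × ℝ =>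
            DegenerateParabolic.interiorTerm T α β k lam d s y p.1 p.2)
            (DegenerateParabolic.domain T) ∧
          IntegrableOn (fun p : ℝ × ℝ =>
            DegenerateParabolic.sourceTerm T β k lam d s f p.1 p.2)
            (DegenerateParabolic.domain T) ∧
          IntegrableOn (DegenerateParabolic.boundaryTerm T β k lam d s y) (Set.Ioo 0 T) ∧
          -- the estimate
          (∫ p in DegenerateParabolic.domain T,
              DegenerateParabolic.interiorTerm T α β k lam d s y p.1 p.2)
            ≤ C * ((∫ p in DegenerateParabolic.domain T,
                  DegenerateParabolic.sourceTerm T β k lam d s f p.1 p.2)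
                + ∫ t in Set.Ioo 0 T,
                  DegenerateParabolic.boundaryTerm T β k lam d s y t) := by
  obtain ⟨C, s₀, hC, hs₀, H⟩ :=
    DegenerateParabolic.exists_carleman_lintegral hT hα hβ hk hlam hd
  refine ⟨C, s₀, hC, hs₀, fun y₀ f y _ hf hy => ?_⟩
  obtain ⟨G, F, S⟩ := hy.exists_rep hα hf
  obtain ⟨b, -, -, hb⟩ := S.exists_normalDeriv hT hα
  refine ⟨hb.mono fun t ht => ht.1, fun s hs => ?_⟩
  have hs0 : 0 < s := hs₀.trans_le hs
  have hle := H f y G F S hf s hs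
  have hsrc := DegenerateParabolic.integrable_sourceTerm (k := k) hβ.2 hlam hd hs0.le hf
  have hbd := S.integrable_boundaryTerm (k := k) hT hα hβ.2 hk hlam hd hs0
  have hae := S.interiorTerm_ae (β := β) (k := k) (lam := lam) (d := d) (s := s)
  have hm : AEStronglyMeasurable (fun z : ℝ × ℝ => DegenerateParabolic.carlemanDensity T α β k lam
      d s z.1 z.2 (DegenerateParabolic.prim α G z) (z.2 ^ (-(α / 2)) * G z))
      (DegenerateParabolic.stripVol 0 T) :=
    (DegenerateParabolic.measurable_carlemanDensity measurable_fst measurable_snd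
      (DegenerateParabolic.measurable_prim α S.meas_G)
      ((by fun_prop : Measurable fun z : ℝ × ℝ => z.2 ^ (-(α / 2))).mul
        S.meas_G)).aestronglyMeasurable
  have hnn : 0 ≤ᵐ[DegenerateParabolic.stripVol 0 T] fun z : ℝ × ℝ =>
      DegenerateParabolic.carlemanDensity T α β k lam
      d s z.1 z.2 (DegenerateParabolic.prim α G z) (z.2 ^ (-(α / 2)) * G z) := by
    filter_upwards [DegenerateParabolic.ae_prod_mem_unit _,
      DegenerateParabolic.ae_stripVol_fst (ae_restrict_mem measurableSet_Ioo)] with z h1 h2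
    exact DegenerateParabolic.carlemanDensity_nonneg hs0.le h2 h1.1.le
  -- The estimate for the lower integral already contains the finiteness of the left-hand side,
  -- since its bound is a finite number.
  have hi := (lintegral_ofReal_ne_top_iff_integrable hm hnn).1 (hle.trans_lt
    ENNReal.ofReal_lt_top).ne
  rw [IntegrableOn, IntegrableOn, DegenerateParabolic.restrict_domain]
  refine ⟨hi.congr hae, hsrc, hbd, ?_⟩
  rw [← integral_congr_ae hae, integral_eq_lintegral_of_nonneg_ae hnn hm]
  refine ENNReal.toReal_le_of_le_ofReal (mul_nonneg hC.le (add_nonneg ?_ ?_)) hle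
  · exact integral_nonneg fun z => mul_nonneg (sq_nonneg _) (Real.exp_pos _).le
  · exact setIntegral_nonneg measurableSet_Ioo fun t ht =>
      DegenerateParabolic.boundaryTerm_nonneg hs0.le ht
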